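/- **Setting.** For a compact Lie group $G$ with a fixed $\mathrm{Ad}$-invariant inner product $\langle\cdot,\cdot\rangle$ on its Lie algebra, let $P_0G$ be the group of smooth maps $p:[0,1]\to G$ with $p(0)=1$, let $L_0G=\{p\in P_0G: p(1)=1\}$, let $P_0L_0G$ be the group of smooth maps $f:[0,1]^2\to G$, $(s,r)\mapsto f(s,r)$, with $f(0,r)=f(s,0)=f(s,1)=1$, and let $L_0L_0G=\{f\in P_0L_0G: f(1,r)=1\}$. Equip $P_0L_0G\times U(1)$ with the product $(f_1,z_1)(f_2,z_2)=(f_1f_2,\,z_1z_2\,c(f_1,f_2))$, where $$c(f_1,f_2)=\exp\Big(-\tfrac{i}{2\pi}\int_0^1\!\!\int_0^1\langle f_1^{-1}\partial_s f_1,\ (\partial_r f_2)f_2^{-1}\rangle\,ds\,dr\Big).$$ Let $N$ be the normal subgroup of all pairs $(f,z)$ such that $f\in L_0L_0G$ and $z=\exp\int_D\omega$ for some smooth disc $D$ in $L_0G$ with boundary $f$, given as a smooth contraction $F:[0,1]^3\to G$ of $f$ through elements $F(t,\cdot,\cdot)\in L_0L_0G$, with $F(0,\cdot,\cdot)=1$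 and $F(1,\cdot,\cdot)=f$; here $\omega(\beta_1,\beta_2)=\frac{i}{2\pi}\int_0^1\langle\beta_1,\partial_r\beta_2\rangle dr$ is the left-invariant 2-form on $L_0G$, that is, $\int_D\omega=\frac{i}{2\pi}\iiint\langle F^{-1}\partial_tF,\partial_r(F^{-1}\partial_sF)\rangle\,dr\,ds\,dt$. The crossed module $\mathsf{String}(G)$ is $$t:(P_0L_0G\times U(1))/N\to P_0G,\qquad t[(f,z)]=f(1,\cdot),$$ with action $g\rhd[(f,z)]=\big[\big(gfg^{-1},\ z\exp\big(\tfrac{i}{2\pi}\int_0^1\!\int_0^1\langle f^{-1}\partial_sf,\,g^{-1}\partial_rg\rangle\,ds\,dr\big)\big)\big]$, where $(gfg^{-1})(s,r)=g(r)f(s,r)g(r)^{-1}$. For a strict morphism $e=(e_0,e_1)$ of crossed modules from $(t_1:H_1\to G_1)$ to $(t_2:H_2\to G_2)$, the quotient groupoid has as objects $G_2$ modulo $g\sim g\,e_0(k)$, and as arrows $G_2\times H_2$ modulo $(g,h)\sim(g\,e_0(k),\,(g\rhd e_1(m))h)$ for $(k,m)\in G_1\times H_1$. The arrow $[(g,h)]$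 goes from $[t_2(h^{-1})g]$ to $[g]$, and the composition is induced by $(g,h)\circ(t_2(h^{-1})g,h')=(g,hh')$. Let $\mathrm{Spin}(5)=\mathrm{Sp}(2)$ be the group of unitary quaternionic $2\times2$ matrices, with $\langle x,y\rangle=-2\,\mathrm{Re}\,\mathrm{tr}(xy)$ on its Lie algebra (the coroot of the highest root has length squared $2$), and let $\mathrm{Spin}(4)\subset\mathrm{Spin}(5)$ be the subgroup of diagonal matrices, with the restricted inner product. The inclusion $\mathrm{Spin}(4)\subset\mathrm{Spin}(5)$ induces a morphism of crossed modules $\mathsf{String}(4)=\mathsf{String}(\mathrm{Spin}(4))\to\mathsf{String}(5)=\mathsf{String}(\mathrm{Spin}(5))$; let $\mathsf{String}(5)/\mathsf{String}(4)$ be the resulting quotient groupoid, with the quotient smooth structures on its sets of objects and arrows. **Corollary.** $\mathsf{String}(5)/\mathsf{String}(4)$ is a Lie groupoid: its sets of objects and of arrows are Hausdorff smooth Fréchet manifolds, its source and target maps are submersions, and all its structure maps are smooth. It is equivalent to the 4-sphere $S^4$ regarded as the discrete Lie groupoid $S^4\rightrightarrows S^4$ (all of whose arrows are identities): there are a Fréchet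 Lie groupoid $Z$ and smooth functors $Z\to\mathsf{String}(5)/\mathsf{String}(4)$ and $Z\to(S^4\rightrightarrows S^4)$ which are both weak equivalences, i.e. essentially surjective through a surjective submersion and fully faithful in the smooth sense. -/

import Mathlib

noncomputable section

namespace StringTwoGroup

open Set MeasureTheory
open scoped ContDiff

set_option linter.unusedSectionVars false
set_option linter.unusedVariables false

/-- A trace on a real algebra. -/
class AlgebraTrace (A : Type*) [NormedRing A] [NormedAlgebra ℝ A] where
  tr : A →L[ℝ] ℝ
  tr_mul_comm : ∀ x y : A, tr (x * y) = tr (y * x)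

section Calculus

variable {E E' A : Type*} [NormedAddCommGroup E] [NormedSpace ℝ E]
  [NormedAddCommGroup E'] [NormedSpace ℝ E'] [NormedRing A] [NormedAlgebra ℝ A]

/-- Partial derivative of `F` on the (closed) domain `S` in the direction `v`. -/
def pd {V : Type*} [NormedAddCommGroup V] [NormedSpace ℝ V] (S : Set E) (v : E) (F : E → V)
    (p : E) : V := fderivWithin ℝ F S p v

/-- The invariant inner product `⟨x, y⟩ = - tr (x y)`. -/
def ip [AlgebraTrace A] (x y : A) : ℝ := - AlgebraTrace.tr (x * y)

/-- `F⁻¹ ∂ᵥ F` for a function `F` with values in unitary elements. -/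
def mcL [Star A] (S : Set E) (v : E) (F : E → A) (p : E) : A := star (F p) * pd S v F p

/-- `(∂ᵥ F) F⁻¹` for a function `F` with values in unitary elements. -/
def mcR [Star A] (S : Set E) (v : E) (F : E → A) (p : E) : A := pd S v F p * star (F p)

/-- Closed domains on which iterated partial derivatives behave well. -/
structure GoodDom (S : Set E) : Prop where
  ud : UniqueDiffOn ℝ S
  cl : S ⊆ closure (interior S)

namespace GoodDom

lemma Icc01 : GoodDom (Icc (0 : ℝ) 1) :=
  ⟨uniqueDiffOn_Icc zero_lt_one, by rw [interior_Icc, closure_Ioo zero_ne_one]⟩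

lemma prod {S : Set E} {S' : Set E'} (h : GoodDom S) (h' : GoodDom S') :
    GoodDom (S ×ˢ S') :=
  ⟨h.ud.prod h'.ud, by
    rw [interior_prod_eq, closure_prod_eq]; exact prod_mono h.cl h'.cl⟩

variable {S : Set E}

lemma pd_smooth (hS : GoodDom S) {V : Type*} [NormedAddCommGroup V] [NormedSpace ℝ V] {F : E → V} (v : E)
    (hF : ContDiffOn ℝ ∞ F S) : ContDiffOn ℝ ∞ (pd S v F) S :=
  (hF.fderivWithin (m := ∞) hS.ud (by simp)).clm_apply contDiffOn_const

lemma pd_add (hS : GoodDom S) {V : Type*} [NormedAddCommGroup V] [NormedSpace ℝ V] {F G : E → V} (v : E)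
    (hF : ContDiffOn ℝ ∞ F S) (hG : ContDiffOn ℝ ∞ G S) {p : E} (hp : p ∈ S) :
    pd S v (fun x => F x + G x) p = pd S v F p + pd S v G p := by
  unfold pd
  rw [fderivWithin_fun_add (hS.ud p hp) ((hF.differentiableOn (by simp)) p hp)
    ((hG.differentiableOn (by simp)) p hp)]; rfl

lemma pd_mul (hS : GoodDom S) {F G : E → A} (v : E)
    (hF : ContDiffOn ℝ ∞ F S) (hG : ContDiffOn ℝ ∞ G S) {p : E} (hp : p ∈ S) :
    pd S v (fun x => F x * G x) p = pd S v F p * G p + F p * pd S v G p := by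
  unfold pd
  rw [fderivWithin_fun_mul' (hS.ud p hp) ((hF.differentiableOn (by simp)) p hp)
    ((hG.differentiableOn (by simp)) p hp)]
  simp [add_comm]

lemma pd_const (hS : GoodDom S) {V : Type*} [NormedAddCommGroup V] [NormedSpace ℝ V] (v : E) (c : V) (p : E) :
    pd S v (fun _ => c) p = 0 := by
  unfold pd; simp

lemma pd_clm (hS : GoodDom S) {V W : Type*} [NormedAddCommGroup V] [NormedSpace ℝ V] [NormedAddCommGroup W]
    [NormedSpace ℝ W] (L : V →L[ℝ] W) {F : E → V} (v : E) (hF : ContDiffOn ℝ ∞ F S)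
    {p : E} (hp : p ∈ S) : pd S v (fun x => L (F x)) p = L (pd S v F p) := by
  unfold pd
  have := (L.hasFDerivAt.comp_hasFDerivWithinAt p
    ((hF.differentiableOn (by simp)) p hp).hasFDerivWithinAt).fderivWithin (hS.ud p hp)
  exact congrArg (fun T => T v) this

lemma pd_congr (hS : GoodDom S) {V : Type*} [NormedAddCommGroup V] [NormedSpace ℝ V] {F G : E → V} (v : E)
    (h : EqOn F G S) {p : E} (hp : p ∈ S) : pd S v F p = pd S v G p := by
  unfold pd
  rw [fderivWithin_congr h (h hp)]

lemma pd_comm (hS : GoodDom S) {V : Type*} [NormedAddCommGroup V] [NormedSpace ℝ V] {F : E → V} (v w : E)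
    (hF : ContDiffOn ℝ ∞ F S) {p : E} (hp : p ∈ S) :
    pd S v (pd S w F) p = pd S w (pd S v F) p := by
  have h1 : ∀ u, pd S u F = fun x => (ContinuousLinearMap.apply ℝ V u) (fderivWithin ℝ F S x) :=
    fun u => rfl
  have hs : ContDiffOn ℝ ∞ (fderivWithin ℝ F S) S := hF.fderivWithin hS.ud (by simp)
  rw [h1 w, h1 v, hS.pd_clm _ _ hs hp, hS.pd_clm _ _ hs hp]
  have := (hF p hp).isSymmSndFDerivWithinAt (by simp; exact WithTop.coe_le_coe.2 (le_top : (2 : ℕ∞) ≤ ⊤)) hS.ud (hS.cl hp) hp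
  exact this v w

/-- Chain rule along a map with constant linearisation in the given direction. -/
lemma pd_comp (hS : GoodDom S) {V : Type*} [NormedAddCommGroup V] [NormedSpace ℝ V] {S' : Set E'}
    (hS' : GoodDom S') {F : E → V} {φ : E' → E} {L : E' →L[ℝ] E} (v : E') {p : E'}
    (hF : ContDiffOn ℝ ∞ F S) (hφ : HasFDerivAt φ L p) (hm : MapsTo φ S' S) (hp : p ∈ S') :
    pd S' v (fun x => F (φ x)) p = pd S (L v) F (φ p) := by
  unfold pd
  have := (HasFDerivWithinAt.comp p ((hF.differentiableOn (by simp)) _ (hm hp)).hasFDerivWithinAt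
    hφ.hasFDerivWithinAt hm).fderivWithin (hS'.ud p hp)
  exact congrArg (fun T => T v) this

end GoodDom

/-- Smooth functions on `S` with values in the unitary elements. -/
structure SmU [StarRing A] (S : Set E) (F : E → A) : Prop where
  sm : ContDiffOn ℝ ∞ F S
  l : ∀ p ∈ S, star (F p) * F p = 1
  r : ∀ p ∈ S, F p * star (F p) = 1

section unit

variable [StarRing A] [StarModule ℝ A] [ContinuousStar A] {S : Set E}
  {F G : E → A}

lemma SmU.star_sm (hF : SmU S F) : ContDiffOn ℝ ∞ (fun p => star (F p)) S :=
  (starL' ℝ (A := A)).contDiff.comp_contDiffOn hF.sm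

lemma SmU.star (hF : SmU S F) : SmU S (fun p => star (F p)) :=
  ⟨hF.star_sm, by simpa using hF.r, by simpa using hF.l⟩

lemma SmU.mul (hF : SmU S F) (hG : SmU S G) : SmU S (fun p => F p * G p) :=
  ⟨hF.sm.mul hG.sm,
   fun p hp => by rw [star_mul, mul_assoc, ← mul_assoc _ (F p), hF.l p hp, one_mul, hG.l p hp],
   fun p hp => by rw [star_mul, mul_assoc, ← mul_assoc (G p), hG.r p hp, one_mul, hF.r p hp]⟩

lemma SmU.one : SmU (A := A) S (fun _ => 1) := ⟨contDiffOn_const, by simp, by simp⟩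

lemma SmU.pd_star (hS : GoodDom S) (hF : SmU S F) (v : E) {p : E} (hp : p ∈ S) :
    pd S v (fun x => Star.star (F x)) p = - (Star.star (F p) * pd S v F p * Star.star (F p)) := by
  have h := hS.pd_mul v hF.star_sm hF.sm hp
  rw [hS.pd_congr (G := fun _ => 1) v (fun x hx => hF.l x hx) hp, hS.pd_const] at h
  have h2 := congrArg (· * Star.star (F p)) h.symm
  simp only [add_mul, zero_mul, mul_assoc, hF.r p hp, mul_one] at h2
  rw [mul_assoc]
  exact eq_neg_of_add_eq_zero_left h2

lemma SmU.mcL_sm (hS : GoodDom S) (hF : SmU S F) (v : E) : ContDiffOn ℝ ∞ (mcL S v F) S :=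
  hF.star_sm.mul (hS.pd_smooth v hF.sm)

lemma SmU.mcR_sm (hS : GoodDom S) (hF : SmU S F) (v : E) : ContDiffOn ℝ ∞ (mcR S v F) S :=
  (hS.pd_smooth v hF.sm).mul hF.star_sm

lemma SmU.mcL_mul (hS : GoodDom S) (hF : SmU S F) (hG : SmU S G) (v : E) {p : E} (hp : p ∈ S) :
    mcL S v (fun x => F x * G x) p = Star.star (G p) * mcL S v F p * G p + mcL S v G p := by
  unfold mcL
  rw [hS.pd_mul v hF.sm hG.sm hp, star_mul, mul_add]
  congr 1
  · simp only [mul_assoc]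
  · rw [mul_assoc, ← mul_assoc _ (F p), hF.l p hp, one_mul]

lemma SmU.mcR_mul (hS : GoodDom S) (hF : SmU S F) (hG : SmU S G) (v : E) {p : E} (hp : p ∈ S) :
    mcR S v (fun x => F x * G x) p = mcR S v F p + F p * mcR S v G p * Star.star (F p) := by
  unfold mcR
  rw [hS.pd_mul v hF.sm hG.sm hp, star_mul, add_mul]
  congr 1
  · rw [mul_assoc, ← mul_assoc (G p), hG.r p hp, one_mul]
  · simp only [mul_assoc]

lemma SmU.mcL_star (hS : GoodDom S) (hF : SmU S F) (v : E) {p : E} (hp : p ∈ S) :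
    mcL S v (fun x => Star.star (F x)) p = - mcR S v F p := by
  unfold mcL mcR
  rw [SmU.pd_star hS hF v hp, star_star, mul_neg, mul_assoc, ← mul_assoc (F p), hF.r p hp, one_mul]

lemma SmU.mcR_star (hS : GoodDom S) (hF : SmU S F) (v : E) {p : E} (hp : p ∈ S) :
    mcR S v (fun x => Star.star (F x)) p = - mcL S v F p := by
  unfold mcL mcR
  rw [SmU.pd_star hS hF v hp, star_star, neg_mul, mul_assoc, hF.l p hp, mul_one]

lemma SmU.pd_mcL (hS : GoodDom S) (hF : SmU S F) (v w : E) {p : E} (hp : p ∈ S) :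
    pd S w (mcL S v F) p
      = - (mcL S w F p * mcL S v F p) + Star.star (F p) * pd S w (pd S v F) p := by
  have := hS.pd_mul w hF.star_sm (hS.pd_smooth v hF.sm) hp
  unfold mcL
  rw [this, SmU.pd_star hS hF w hp]
  simp only [neg_mul, mul_assoc]

lemma SmU.pd_mcR (hS : GoodDom S) (hF : SmU S F) (v w : E) {p : E} (hp : p ∈ S) :
    pd S w (mcR S v F) p
      = pd S w (pd S v F) p * Star.star (F p) - mcR S v F p * mcR S w F p := by
  have := hS.pd_mul w (hS.pd_smooth v hF.sm) hF.star_sm hp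
  unfold mcR
  rw [this, SmU.pd_star hS hF w hp]
  simp only [mul_neg, mul_assoc, sub_eq_add_neg]

/-- Maurer--Cartan equation. -/
lemma SmU.mc_eq (hS : GoodDom S) (hF : SmU S F) (v w : E) {p : E} (hp : p ∈ S) :
    pd S w (mcL S v F) p
      = pd S v (mcL S w F) p + (mcL S v F p * mcL S w F p - mcL S w F p * mcL S v F p) := by
  rw [SmU.pd_mcL hS hF v w hp, SmU.pd_mcL hS hF w v hp, hS.pd_comm w v hF.sm hp]
  abel

lemma SmU.pd_mcR_eq (hS : GoodDom S) (hF : SmU S F) (v w : E) {p : E} (hp : p ∈ S) :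
    pd S w (mcR S v F) p = F p * pd S v (mcL S w F) p * Star.star (F p) := by
  rw [SmU.pd_mcL hS hF w v hp, SmU.pd_mcR hS hF v w hp, hS.pd_comm w v hF.sm hp, mul_add, add_mul]
  rw [← mul_assoc (F p) (Star.star (F p)), hF.r p hp, one_mul, sub_eq_add_neg, add_comm]
  congr 1
  unfold mcL mcR
  have := hF.r p hp
  simp only [mul_neg, neg_mul, neg_inj]
  rw [← mul_assoc (F p), ← mul_assoc (F p) (Star.star (F p)), this, one_mul]
  simp only [mul_assoc]

end unit

section ipl
variable [AlgebraTrace A]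

lemma ip_comm (x y : A) : ip x y = ip y x := by unfold ip; rw [AlgebraTrace.tr_mul_comm]
lemma ip_add_left (x y z : A) : ip (x + y) z = ip x z + ip y z := by
  unfold ip; rw [add_mul, map_add]; ring
lemma ip_add_right (x y z : A) : ip x (y + z) = ip x y + ip x z := by
  unfold ip; rw [mul_add, map_add]; ring
lemma ip_neg_left (x y : A) : ip (-x) y = - ip x y := by unfold ip; simp
lemma ip_neg_right (x y : A) : ip x (-y) = - ip x y := by unfold ip; simp
lemma ip_sub_right (x y z : A) : ip x (y - z) = ip x y - ip x z := by
  rw [sub_eq_add_neg, ip_add_right, ip_neg_right]; ring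
lemma ip_zero_left (y : A) : ip 0 y = 0 := by unfold ip; simp
lemma ip_zero_right (y : A) : ip y 0 = 0 := by unfold ip; simp
lemma ip_mul_left (g x y : A) : ip (g * x) y = ip x (y * g) := by
  unfold ip; rw [mul_assoc, AlgebraTrace.tr_mul_comm, mul_assoc]
lemma ip_mul_right (g x y : A) : ip (x * g) y = ip x (g * y) := by
  unfold ip; rw [mul_assoc]
lemma ip_conj {g h : A} (hgh : h * g = 1) (x y : A) : ip (g * x * h) (g * y * h) = ip x y := by
  rw [mul_assoc, ip_mul_left, ip_mul_right, mul_assoc, mul_assoc, hgh, mul_one, ← mul_assoc, hgh,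
    one_mul]

lemma ip_smooth {S : Set E} {F G : E → A} (hF : ContDiffOn ℝ ∞ F S) (hG : ContDiffOn ℝ ∞ G S) :
    ContDiffOn ℝ ∞ (fun p => ip (F p) (G p)) S :=
  (AlgebraTrace.tr.contDiff.comp_contDiffOn (hF.mul hG)).neg

lemma GoodDom.pd_ip {S : Set E} (hS : GoodDom S) {F G : E → A} (v : E)
    (hF : ContDiffOn ℝ ∞ F S) (hG : ContDiffOn ℝ ∞ G S) {p : E} (hp : p ∈ S) :
    pd S v (fun p => ip (F p) (G p)) p = ip (pd S v F p) (G p) + ip (F p) (pd S v G p) := by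
  have h := hS.pd_clm (-AlgebraTrace.tr) v (hF.mul hG) hp
  have e : (fun p => ip (F p) (G p)) = fun x => (-AlgebraTrace.tr (A := A)) (F x * G x) := rfl
  rw [e, h, hS.pd_mul v hF hG hp, map_add]
  rfl

/-- The pointwise identity behind the product formula. -/
lemma ip_stokes_alg {b b' αt αs βt ρ αsr αst αts βsr Bs Bt βtr : A}
    (h1 : b * b' = 1) (h2 : b' * b = 1) (hmc : αst = αts + (αs * αt - αt * αs))
    (hBs : Bs = b * βsr * b') (hBt : Bt = b * βtr * b') :
    ip (b' * αt * b + βt) ((-(b' * ρ) * αs * b + b' * αsr * b + b' * αs * (ρ * b)) + βsr)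
      = ip αt αsr + ip βt βsr - (ip αst ρ + ip αs Bt) + (ip αts ρ + ip αt Bs)
        + (ip βtr (b' * αs * b)
          + ip βt (-(b' * ρ) * αs * b + b' * αsr * b + b' * αs * (ρ * b))) := by
  have e : -(b' * ρ) * αs * b + b' * αsr * b + b' * αs * (ρ * b)
      = b' * (αsr + (αs * ρ - ρ * αs)) * b := by noncomm_ring
  rw [e, ip_add_left, ip_add_right, ip_add_right (x := βt), ip_conj h1]
  have e1 : ip (b' * αt * b) βsr = ip αt Bs := by
    rw [hBs, mul_assoc, ip_mul_left, ip_mul_right, ← mul_assoc]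
  have e2 : ip βtr (b' * αs * b) = ip αs Bt := by
    rw [ip_comm, hBt, mul_assoc, ip_mul_left, ip_mul_right, ← mul_assoc]
  have e3 : ip αt (αsr + (αs * ρ - ρ * αs)) = ip αt αsr - (ip αst ρ - ip αts ρ) := by
    rw [ip_add_right, hmc, ip_add_left]
    have : ip αt (αs * ρ - ρ * αs) = - ip (αs * αt - αt * αs) ρ := by
      unfold ip
      simp only [mul_sub, sub_mul, map_sub]
      rw [← mul_assoc αt ρ, AlgebraTrace.tr_mul_comm (αt * ρ) αs]
      simp only [mul_assoc]
      ring
    rw [this]; ring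
  rw [e1, e2, e3]; ring

end ipl

section stokes

/-- The closed unit square. -/
abbrev uSq : Set (ℝ × ℝ) := Icc (0 : ℝ) 1 ×ˢ Icc (0 : ℝ) 1

/-- The closed unit cube. -/
abbrev uCb : Set (ℝ × ℝ × ℝ) := Icc (0 : ℝ) 1 ×ˢ uSq

lemma goodSq : GoodDom uSq := GoodDom.Icc01.prod GoodDom.Icc01
lemma goodCb : GoodDom uCb := GoodDom.Icc01.prod goodSq

lemma zero_mem01 : (0 : ℝ) ∈ Icc (0 : ℝ) 1 := ⟨le_rfl, zero_le_one⟩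
lemma one_mem01 : (1 : ℝ) ∈ Icc (0 : ℝ) 1 := ⟨zero_le_one, le_rfl⟩

lemma ftc1 {X : ℝ → ℝ} (hX : ContDiffOn ℝ ∞ X (Icc 0 1)) :
    ∫ x in Icc (0 : ℝ) 1, pd (Icc (0 : ℝ) 1) 1 X x = X 1 - X 0 := by
  rw [integral_Icc_eq_integral_Ioc, ← intervalIntegral.integral_of_le zero_le_one]
  refine intervalIntegral.integral_eq_sub_of_hasDerivAt_of_le zero_le_one hX.continuousOn
    (fun x hx => ?_) ?_
  · have h := ((hX.differentiableOn (by simp)) x (Ioo_subset_Icc_self hx)).hasDerivWithinAt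
    exact h.hasDerivAt (Icc_mem_nhds hx.1 hx.2)
  · refine ContinuousOn.intervalIntegrable ?_
    rw [uIcc_of_le zero_le_one]
    exact (GoodDom.Icc01.pd_smooth 1 hX).continuousOn

lemma ftcFst {S' : Set (ℝ × ℝ)} (hS' : GoodDom S') (hc : IsCompact S') {X : ℝ × ℝ × ℝ → ℝ}
    (hX : ContDiffOn ℝ ∞ X (Icc (0 : ℝ) 1 ×ˢ S')) :
    ∫ p in Icc (0 : ℝ) 1 ×ˢ S', pd (Icc (0 : ℝ) 1 ×ˢ S') (1, 0) X p
      = ∫ q in S', (X (1, q) - X (0, q)) := by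
  have hS := GoodDom.Icc01.prod hS'
  have hint : IntegrableOn (pd (Icc (0 : ℝ) 1 ×ˢ S') (1, 0) X) (Icc (0 : ℝ) 1 ×ˢ S') :=
    (hS.pd_smooth _ hX).continuousOn.integrableOn_compact (isCompact_Icc.prod hc)
  rw [Measure.volume_eq_prod] at hint ⊢
  rw [← setIntegral_prod_swap, setIntegral_prod]
  · refine setIntegral_congr_fun hc.measurableSet fun q hq => ?_
    have : ∀ t ∈ Icc (0 : ℝ) 1, pd (Icc (0 : ℝ) 1 ×ˢ S') (1, 0) X ((q, t) : _ × ℝ).swap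
        = pd (Icc (0 : ℝ) 1) 1 (fun t => X (t, q)) t := by
      intro t ht
      exact (hS.pd_comp GoodDom.Icc01 (φ := fun t => (t, q))
        (L := (ContinuousLinearMap.id ℝ ℝ).prod 0) 1 hX
        ((hasFDerivAt_id t).prodMk (hasFDerivAt_const q t)) (fun t ht => ⟨ht, hq⟩) ht).symm
    refine (setIntegral_congr_fun measurableSet_Icc this).trans (ftc1 ?_)
    exact hX.comp ((contDiff_id.prodMk contDiff_const).contDiffOn) (fun t ht => ⟨ht, hq⟩)
  · exact hint.swap

lemma ftcFst2 {X : ℝ × ℝ → ℝ} (hX : ContDiffOn ℝ ∞ X uSq) :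
    ∫ p in uSq, pd uSq (1, 0) X p = ∫ r in Icc (0 : ℝ) 1, (X (1, r) - X (0, r)) := by
  have hint : IntegrableOn (pd uSq (1, 0) X) uSq :=
    (goodSq.pd_smooth _ hX).continuousOn.integrableOn_compact (isCompact_Icc.prod isCompact_Icc)
  rw [Measure.volume_eq_prod] at hint ⊢
  rw [← setIntegral_prod_swap, setIntegral_prod]
  · refine setIntegral_congr_fun measurableSet_Icc fun q hq => ?_
    have : ∀ t ∈ Icc (0 : ℝ) 1, pd uSq (1, 0) X ((q, t) : ℝ × ℝ).swap
        = pd (Icc (0 : ℝ) 1) 1 (fun t => X (t, q)) t := by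
      intro t ht
      exact (goodSq.pd_comp GoodDom.Icc01 (φ := fun t => (t, q))
        (L := (ContinuousLinearMap.id ℝ ℝ).prod 0) 1 hX
        ((hasFDerivAt_id t).prodMk (hasFDerivAt_const q t)) (fun t ht => ⟨ht, hq⟩) ht).symm
    refine (setIntegral_congr_fun measurableSet_Icc this).trans (ftc1 ?_)
    exact hX.comp ((contDiff_id.prodMk contDiff_const).contDiffOn) (fun t ht => ⟨ht, hq⟩)
  · exact hint.swap

lemma ftcSnd2 {X : ℝ × ℝ → ℝ} (hX : ContDiffOn ℝ ∞ X uSq) :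
    ∫ p in uSq, pd uSq (0, 1) X p = ∫ s in Icc (0 : ℝ) 1, (X (s, 1) - X (s, 0)) := by
  have hint : IntegrableOn (pd uSq (0, 1) X) uSq :=
    (goodSq.pd_smooth _ hX).continuousOn.integrableOn_compact (isCompact_Icc.prod isCompact_Icc)
  rw [Measure.volume_eq_prod] at hint ⊢
  rw [setIntegral_prod _ hint]
  refine setIntegral_congr_fun measurableSet_Icc fun q hq => ?_
  have : ∀ t ∈ Icc (0 : ℝ) 1, pd uSq (0, 1) X (q, t)
      = pd (Icc (0 : ℝ) 1) 1 (fun t => X (q, t)) t := by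
    intro t ht
    exact (goodSq.pd_comp GoodDom.Icc01 (φ := fun t => (q, t))
      (L := (0 : ℝ →L[ℝ] ℝ).prod (ContinuousLinearMap.id ℝ ℝ)) 1 hX
      ((hasFDerivAt_const q t).prodMk (hasFDerivAt_id t)) (fun t ht => ⟨hq, ht⟩) ht).symm
  refine (setIntegral_congr_fun measurableSet_Icc this).trans (ftc1 ?_)
  exact hX.comp ((contDiff_const.prodMk contDiff_id).contDiffOn) (fun t ht => ⟨hq, ht⟩)

lemma slice_smooth {V : Type*} [NormedAddCommGroup V] [NormedSpace ℝ V] {X : ℝ × ℝ × ℝ → V}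
    (hX : ContDiffOn ℝ ∞ X uCb) {t : ℝ} (ht : t ∈ Icc (0 : ℝ) 1) :
    ContDiffOn ℝ ∞ (fun q : ℝ × ℝ => X (t, q)) uSq :=
  hX.comp ((contDiff_const.prodMk contDiff_id).contDiffOn) (fun q hq => ⟨ht, hq⟩)

lemma pd_slice {V : Type*} [NormedAddCommGroup V] [NormedSpace ℝ V] {X : ℝ × ℝ × ℝ → V}
    (hX : ContDiffOn ℝ ∞ X uCb) {t : ℝ} (ht : t ∈ Icc (0 : ℝ) 1) (v : ℝ × ℝ) {q : ℝ × ℝ}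
    (hq : q ∈ uSq) : pd uSq v (fun q => X (t, q)) q = pd uCb (0, v) X (t, q) :=
  goodCb.pd_comp goodSq (φ := fun q => (t, q))
    (L := (0 : ℝ × ℝ →L[ℝ] ℝ).prod (ContinuousLinearMap.id ℝ (ℝ × ℝ))) v hX
    ((hasFDerivAt_const t q).prodMk (hasFDerivAt_id q)) (fun q hq => ⟨ht, hq⟩) hq

lemma integral_uCb {X : ℝ × ℝ × ℝ → ℝ} (hX : ContinuousOn X uCb) :
    ∫ p in uCb, X p = ∫ t in Icc (0 : ℝ) 1, ∫ q in uSq, X (t, q) := by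
  have hint : IntegrableOn X uCb :=
    hX.integrableOn_compact (isCompact_Icc.prod (isCompact_Icc.prod isCompact_Icc))
  rw [Measure.volume_eq_prod] at hint ⊢
  rw [setIntegral_prod _ hint]

lemma integral_uSq {X : ℝ × ℝ → ℝ} (hX : ContinuousOn X uSq) :
    ∫ p in uSq, X p = ∫ t in Icc (0 : ℝ) 1, ∫ r in Icc (0 : ℝ) 1, X (t, r) := by
  have hint : IntegrableOn X uSq :=
    hX.integrableOn_compact (isCompact_Icc.prod isCompact_Icc)
  rw [Measure.volume_eq_prod] at hint ⊢
  rw [setIntegral_prod _ hint]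

lemma ftcT {X : ℝ × ℝ × ℝ → ℝ} (hX : ContDiffOn ℝ ∞ X uCb) :
    ∫ p in uCb, pd uCb (1, 0, 0) X p = ∫ q in uSq, (X (1, q) - X (0, q)) :=
  ftcFst goodSq (isCompact_Icc.prod isCompact_Icc) hX

lemma ftcS {X : ℝ × ℝ × ℝ → ℝ} (hX : ContDiffOn ℝ ∞ X uCb) :
    ∫ p in uCb, pd uCb (0, 1, 0) X p = ∫ p in uSq, (X (p.1, 1, p.2) - X (p.1, 0, p.2)) := by
  have h1 : ContinuousOn (fun p : ℝ × ℝ => X (p.1, 1, p.2)) uSq :=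
    hX.continuousOn.comp (by fun_prop) (fun p hp => ⟨hp.1, one_mem01, hp.2⟩)
  have h0 : ContinuousOn (fun p : ℝ × ℝ => X (p.1, 0, p.2)) uSq :=
    hX.continuousOn.comp (by fun_prop) (fun p hp => ⟨hp.1, zero_mem01, hp.2⟩)
  rw [integral_uCb (goodCb.pd_smooth _ hX).continuousOn, integral_uSq (h1.fun_sub h0)]
  refine setIntegral_congr_fun measurableSet_Icc fun t ht => ?_
  refine (setIntegral_congr_fun (measurableSet_Icc.prod measurableSet_Icc)
    (fun q hq => (pd_slice hX ht (1, 0) hq).symm)).trans ?_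
  exact ftcFst2 (slice_smooth hX ht)

lemma ftcR {X : ℝ × ℝ × ℝ → ℝ} (hX : ContDiffOn ℝ ∞ X uCb) :
    ∫ p in uCb, pd uCb (0, 0, 1) X p = ∫ p in uSq, (X (p.1, p.2, 1) - X (p.1, p.2, 0)) := by
  have h1 : ContinuousOn (fun p : ℝ × ℝ => X (p.1, p.2, 1)) uSq :=
    hX.continuousOn.comp (by fun_prop) (fun p hp => ⟨hp.1, hp.2, one_mem01⟩)
  have h0 : ContinuousOn (fun p : ℝ × ℝ => X (p.1, p.2, 0)) uSq :=
    hX.continuousOn.comp (by fun_prop) (fun p hp => ⟨hp.1, hp.2, zero_mem01⟩)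
  rw [integral_uCb (goodCb.pd_smooth _ hX).continuousOn, integral_uSq (h1.fun_sub h0)]
  refine setIntegral_congr_fun measurableSet_Icc fun t ht => ?_
  refine (setIntegral_congr_fun (measurableSet_Icc.prod measurableSet_Icc)
    (fun q hq => (pd_slice hX ht (0, 1) hq).symm)).trans ?_
  exact ftcSnd2 (slice_smooth hX ht)

variable [StarRing A] [StarModule ℝ A] [ContinuousStar A] [AlgebraTrace A]

/-- `∫∫ ⟨f₁⁻¹ ∂ₛ f₁, (∂ᵣ f₂) f₂⁻¹⟩ ds dr`. -/
def rawJ (f g : ℝ × ℝ → A) : ℝ :=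
  ∫ p in uSq, ip (mcL uSq (1, 0) f p) (mcR uSq (0, 1) g p)

/-- `∫∫∫ ⟨F⁻¹ ∂ₜ F, ∂ᵣ (F⁻¹ ∂ₛ F)⟩ dt ds dr`. -/
def rawW (F : ℝ × ℝ × ℝ → A) : ℝ :=
  ∫ p in uCb, ip (mcL uCb (1, 0, 0) F p) (pd uCb (0, 0, 1) (mcL uCb (0, 1, 0) F) p)

/-- `∫∫ ⟨f⁻¹ ∂ₛ f, g⁻¹ ∂ᵣ g⟩ ds dr`. -/
def rawX (g : ℝ → A) (f : ℝ × ℝ → A) : ℝ :=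
  ∫ p in uSq, ip (mcL uSq (1, 0) f p) (mcL (Icc (0 : ℝ) 1) 1 g p.2)

/-- Boundary term at `s = 1`. -/
def rawB (a b : ℝ × ℝ × ℝ → A) : ℝ :=
  ∫ p in uSq, ip (mcL uCb (1, 0, 0) a (p.1, 1, p.2)) (mcR uCb (0, 0, 1) b (p.1, 1, p.2))

lemma int_uSq_of {X : ℝ × ℝ → ℝ} (hX : ContinuousOn X uSq) : IntegrableOn X uSq :=
  hX.integrableOn_compact (isCompact_Icc.prod isCompact_Icc)

lemma int_uCb_of {X : ℝ × ℝ × ℝ → ℝ} (hX : ContDiffOn ℝ ∞ X uCb) : IntegrableOn X uCb :=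
  hX.continuousOn.integrableOn_compact (isCompact_Icc.prod (isCompact_Icc.prod isCompact_Icc))

lemma mcL_slice {F : ℝ × ℝ × ℝ → A} (hF : SmU uCb F) {t : ℝ} (ht : t ∈ Icc (0 : ℝ) 1) (v : ℝ × ℝ)
    {q : ℝ × ℝ} (hq : q ∈ uSq) :
    mcL uSq v (fun q => F (t, q)) q = mcL uCb (0, v) F (t, q) := by
  unfold mcL; rw [pd_slice hF.sm ht v hq]

lemma mcR_slice {F : ℝ × ℝ × ℝ → A} (hF : SmU uCb F) {t : ℝ} (ht : t ∈ Icc (0 : ℝ) 1) (v : ℝ × ℝ)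
    {q : ℝ × ℝ} (hq : q ∈ uSq) :
    mcR uSq v (fun q => F (t, q)) q = mcR uCb (0, v) F (t, q) := by
  unfold mcR; rw [pd_slice hF.sm ht v hq]

/-- A smooth curve of based paths of based loops: `F(t,0,r) = F(t,s,0) = F(t,s,1) = 1`. -/
structure CurveU (F : ℝ × ℝ × ℝ → A) : Prop where
  smu : SmU uCb F
  s0 : ∀ t ∈ Icc (0 : ℝ) 1, ∀ r ∈ Icc (0 : ℝ) 1, F (t, 0, r) = 1
  r0 : ∀ t ∈ Icc (0 : ℝ) 1, ∀ s ∈ Icc (0 : ℝ) 1, F (t, s, 0) = 1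
  r1 : ∀ t ∈ Icc (0 : ℝ) 1, ∀ s ∈ Icc (0 : ℝ) 1, F (t, s, 1) = 1

lemma pd_t_line {F : ℝ × ℝ × ℝ → A} (hF : ContDiffOn ℝ ∞ F uCb) {t : ℝ} {q : ℝ × ℝ}
    (ht : t ∈ Icc (0 : ℝ) 1) (hq : q ∈ uSq) :
    pd uCb (1, 0, 0) F (t, q) = pd (Icc (0 : ℝ) 1) 1 (fun t => F (t, q)) t :=
  (goodCb.pd_comp GoodDom.Icc01 (φ := fun t => (t, q))
    (L := (ContinuousLinearMap.id ℝ ℝ).prod 0) 1 hF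
    ((hasFDerivAt_id t).prodMk (hasFDerivAt_const q t)) (fun t ht => ⟨ht, hq⟩) ht).symm

lemma mcL_t_zero {F : ℝ × ℝ × ℝ → A} (hF : ContDiffOn ℝ ∞ F uCb) {q : ℝ × ℝ} (hq : q ∈ uSq) {c : A}
    (h : ∀ t ∈ Icc (0 : ℝ) 1, F (t, q) = c) {t : ℝ} (ht : t ∈ Icc (0 : ℝ) 1) :
    mcL uCb (1, 0, 0) F (t, q) = 0 := by
  unfold mcL
  rw [pd_t_line hF ht hq, GoodDom.Icc01.pd_congr (G := fun _ => c) 1 (fun t ht => h t ht) ht,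
    GoodDom.Icc01.pd_const, mul_zero]

lemma conj_sm {a b : ℝ × ℝ × ℝ → A} (ha : SmU uCb a) (hb : SmU uCb b) (v : ℝ × ℝ × ℝ) :
    ContDiffOn ℝ ∞ (fun p => star (b p) * mcL uCb v a p * b p) uCb :=
  (hb.star_sm.mul (SmU.mcL_sm goodCb ha v)).mul hb.sm

lemma pd_conj {a b : ℝ × ℝ × ℝ → A} (ha : SmU uCb a) (hb : SmU uCb b) (v w : ℝ × ℝ × ℝ)
    {p : ℝ × ℝ × ℝ} (hp : p ∈ uCb) :
    pd uCb w (fun p => star (b p) * mcL uCb v a p * b p) p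
      = -(star (b p) * mcR uCb w b p) * mcL uCb v a p * b p
        + star (b p) * pd uCb w (mcL uCb v a) p * b p
        + star (b p) * mcL uCb v a p * (mcR uCb w b p * b p) := by
  rw [goodCb.pd_mul w (hb.star_sm.mul (SmU.mcL_sm goodCb ha v)) hb.sm hp,
    goodCb.pd_mul w hb.star_sm (SmU.mcL_sm goodCb ha v) hp, SmU.pd_star goodCb hb w hp, add_mul]
  have : mcR uCb w b p * b p = pd uCb w b p := by
    unfold mcR; rw [mul_assoc, hb.l p hp, mul_one]
  rw [this]
  unfold mcR
  simp only [mul_assoc]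

theorem stokes_pointwise {a b : ℝ × ℝ × ℝ → A} (ha : SmU uCb a) (hb : SmU uCb b)
    {p : ℝ × ℝ × ℝ} (hp : p ∈ uCb) :
    ip (mcL uCb (1, 0, 0) (fun p => a p * b p) p)
        (pd uCb (0, 0, 1) (mcL uCb (0, 1, 0) (fun p => a p * b p)) p)
      = ip (mcL uCb (1, 0, 0) a p) (pd uCb (0, 0, 1) (mcL uCb (0, 1, 0) a) p)
        + ip (mcL uCb (1, 0, 0) b p) (pd uCb (0, 0, 1) (mcL uCb (0, 1, 0) b) p)
        - pd uCb (1, 0, 0) (fun p => ip (mcL uCb (0, 1, 0) a p) (mcR uCb (0, 0, 1) b p)) p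
        + pd uCb (0, 1, 0) (fun p => ip (mcL uCb (1, 0, 0) a p) (mcR uCb (0, 0, 1) b p)) p
        + pd uCb (0, 0, 1) (fun p => ip (mcL uCb (1, 0, 0) b p)
            (star (b p) * mcL uCb (0, 1, 0) a p * b p)) p := by
  have g := goodCb
  have hA := fun v => SmU.mcL_sm g ha v
  have hB := fun v => SmU.mcL_sm g hb v
  have hR := fun v => SmU.mcR_sm g hb v
  rw [g.pd_ip _ (hA _) (hR _) hp, g.pd_ip _ (hA _) (hR _) hp,
    g.pd_ip _ (hB _) (conj_sm ha hb _) hp, pd_conj ha hb _ _ hp,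
    g.pd_congr (0, 0, 1) (fun q hq => SmU.mcL_mul g ha hb (0, 1, 0) hq) hp,
    g.pd_add _ (conj_sm ha hb _) (hB _) hp, pd_conj ha hb _ _ hp, SmU.mcL_mul g ha hb _ hp]
  exact ip_stokes_alg (hb.r p hp) (hb.l p hp) (SmU.mc_eq g ha _ _ hp)
    (SmU.pd_mcR_eq g hb _ _ hp) (SmU.pd_mcR_eq g hb _ _ hp)

lemma int5 {f₁ f₂ f₃ f₄ f₅ : ℝ × ℝ × ℝ → ℝ} (h₁ : IntegrableOn f₁ uCb) (h₂ : IntegrableOn f₂ uCb)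
    (h₃ : IntegrableOn f₃ uCb) (h₄ : IntegrableOn f₄ uCb) (h₅ : IntegrableOn f₅ uCb) :
    ∫ p in uCb, (f₁ p + f₂ p - f₃ p + f₄ p + f₅ p)
      = (∫ p in uCb, f₁ p) + (∫ p in uCb, f₂ p) - (∫ p in uCb, f₃ p) + (∫ p in uCb, f₄ p)
        + (∫ p in uCb, f₅ p) := by
  have e1 := integral_add h₁ h₂
  have e2 := integral_sub (h₁.add h₂) h₃
  have e3 := integral_add ((h₁.add h₂).sub h₃) h₄
  have e4 := integral_add (((h₁.add h₂).sub h₃).add h₄) h₅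
  simp only [Pi.add_apply, Pi.sub_apply] at e1 e2 e3 e4
  rw [e4, e3, e2, e1]

theorem stokes_mul {a b : ℝ × ℝ × ℝ → A} (ha : CurveU a) (hb : CurveU b) :
    rawW (fun p => a p * b p) = rawW a + rawW b
      - (rawJ (fun q => a (1, q)) (fun q => b (1, q))
        - rawJ (fun q => a (0, q)) (fun q => b (0, q))) + rawB a b := by
  have g := goodCb
  have hA := fun v => SmU.mcL_sm g ha.smu v
  have hB := fun v => SmU.mcL_sm g hb.smu v
  have hR := fun v => SmU.mcR_sm g hb.smu v
  have hW : ∀ {F : ℝ × ℝ × ℝ → A}, SmU uCb F → IntegrableOn (fun p =>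
      ip (mcL uCb (1, 0, 0) F p) (pd uCb (0, 0, 1) (mcL uCb (0, 1, 0) F) p)) uCb := fun h =>
    int_uCb_of (ip_smooth (SmU.mcL_sm g h _) (g.pd_smooth _ (SmU.mcL_sm g h _)))
  have s3 := ip_smooth (hA (0, 1, 0)) (hR (0, 0, 1))
  have s4 := ip_smooth (hA (1, 0, 0)) (hR (0, 0, 1))
  have s5 := ip_smooth (hB (1, 0, 0)) (conj_sm ha.smu hb.smu (0, 1, 0))
  have i3 := int_uCb_of (g.pd_smooth (1, 0, 0) s3)
  have i4 := int_uCb_of (g.pd_smooth (0, 1, 0) s4)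
  have i5 := int_uCb_of (g.pd_smooth (0, 0, 1) s5)
  have key := setIntegral_congr_fun (μ := volume)
    (measurableSet_Icc.prod (measurableSet_Icc.prod measurableSet_Icc))
    (fun p hp => stokes_pointwise ha.smu hb.smu hp)
  replace key := key.trans (int5 (hW ha.smu) (hW hb.smu) i3 i4 i5)
  have e3 := ftcT s3
  have e4 := ftcS s4
  have e5 := ftcR s5
  have j : ∀ t ∈ Icc (0 : ℝ) 1, ∫ q in uSq, ip (mcL uCb (0, 1, 0) a (t, q))
      (mcR uCb (0, 0, 1) b (t, q)) = rawJ (fun q => a (t, q)) (fun q => b (t, q)) := by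
    intro t ht
    refine setIntegral_congr_fun (measurableSet_Icc.prod measurableSet_Icc) fun q hq => ?_
    rw [mcL_slice ha.smu ht _ hq, mcR_slice hb.smu ht _ hq]
  rw [integral_sub (int_uSq_of (slice_smooth s3 one_mem01).continuousOn)
    (int_uSq_of (slice_smooth s3 zero_mem01).continuousOn), j 1 one_mem01, j 0 zero_mem01] at e3
  have e4' : ∫ p in uSq, (ip (mcL uCb (1, 0, 0) a (p.1, 1, p.2)) (mcR uCb (0, 0, 1) b (p.1, 1, p.2))
      - ip (mcL uCb (1, 0, 0) a (p.1, 0, p.2)) (mcR uCb (0, 0, 1) b (p.1, 0, p.2))) = rawB a b := by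
    refine setIntegral_congr_fun (measurableSet_Icc.prod measurableSet_Icc) fun q hq => ?_
    rw [mcL_t_zero ha.smu.sm (q := (0, q.2)) ⟨zero_mem01, hq.2⟩ (c := 1)
      (fun t ht => ha.s0 t ht _ hq.2) hq.1, ip_zero_left, sub_zero]
  have e5' : ∫ p in uSq, (ip (mcL uCb (1, 0, 0) b (p.1, p.2, 1))
        (star (b (p.1, p.2, 1)) * mcL uCb (0, 1, 0) a (p.1, p.2, 1) * b (p.1, p.2, 1))
      - ip (mcL uCb (1, 0, 0) b (p.1, p.2, 0))
        (star (b (p.1, p.2, 0)) * mcL uCb (0, 1, 0) a (p.1, p.2, 0) * b (p.1, p.2, 0))) = 0 := by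
    refine setIntegral_eq_zero_of_forall_eq_zero fun q hq => ?_
    rw [mcL_t_zero hb.smu.sm (q := (q.2, 1)) ⟨hq.2, one_mem01⟩ (c := 1)
      (fun t ht => hb.r1 t ht _ hq.2) hq.1,
      mcL_t_zero hb.smu.sm (q := (q.2, 0)) ⟨hq.2, zero_mem01⟩ (c := 1)
      (fun t ht => hb.r0 t ht _ hq.2) hq.1, ip_zero_left, ip_zero_left, sub_zero]
  rw [e4'] at e4
  rw [e5'] at e5
  rw [e3, e4, e5] at key
  unfold rawW
  linarith [key]

/-- `∫∫ ⟨F⁻¹ ∂ₜ F, g⁻¹ ∂ᵣ g⟩ dt dr` at `s = 1`. -/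
def rawD (g : ℝ → A) (F : ℝ × ℝ × ℝ → A) : ℝ :=
  ∫ p in uSq, ip (mcL uCb (1, 0, 0) F (p.1, 1, p.2)) (mcL (Icc (0 : ℝ) 1) 1 g p.2)

lemma pull_smooth {V : Type*} [NormedAddCommGroup V] [NormedSpace ℝ V] {g : ℝ → V}
    (hg : ContDiffOn ℝ ∞ g (Icc 0 1)) : ContDiffOn ℝ ∞ (fun p : ℝ × ℝ × ℝ => g p.2.2) uCb :=
  hg.comp (contDiff_snd.comp contDiff_snd).contDiffOn (fun p hp => hp.2.2)

lemma pd_pull {V : Type*} [NormedAddCommGroup V] [NormedSpace ℝ V] {g : ℝ → V}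
    (hg : ContDiffOn ℝ ∞ g (Icc 0 1)) (v : ℝ × ℝ × ℝ) {p : ℝ × ℝ × ℝ} (hp : p ∈ uCb) :
    pd uCb v (fun p : ℝ × ℝ × ℝ => g p.2.2) p = pd (Icc (0 : ℝ) 1) v.2.2 g p.2.2 :=
  GoodDom.Icc01.pd_comp goodCb (φ := fun p : ℝ × ℝ × ℝ => p.2.2)
    (L := (ContinuousLinearMap.snd ℝ ℝ ℝ).comp (ContinuousLinearMap.snd ℝ ℝ (ℝ × ℝ))) v hg
    (((ContinuousLinearMap.snd ℝ ℝ ℝ).comp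
      (ContinuousLinearMap.snd ℝ ℝ (ℝ × ℝ))).hasFDerivAt) (fun p hp => hp.2.2) hp

lemma pd_zero_dir {V : Type*} [NormedAddCommGroup V] [NormedSpace ℝ V] {S : Set E} {F : E → V}
    (p : E) : pd S 0 F p = 0 := by unfold pd; simp

lemma SmU.pull {g : ℝ → A} (hg : SmU (Icc (0 : ℝ) 1) g) :
    SmU uCb (fun p : ℝ × ℝ × ℝ => g p.2.2) :=
  ⟨pull_smooth hg.sm, fun p hp => hg.l _ hp.2.2, fun p hp => hg.r _ hp.2.2⟩

lemma mcL_pull {g : ℝ → A} (hg : SmU (Icc (0 : ℝ) 1) g) (v : ℝ × ℝ × ℝ) {p : ℝ × ℝ × ℝ}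
    (hp : p ∈ uCb) : mcL uCb v (fun p : ℝ × ℝ × ℝ => g p.2.2) p
      = mcL (Icc (0 : ℝ) 1) v.2.2 g p.2.2 := by
  unfold mcL; rw [pd_pull hg.sm v hp]

lemma mcR_pull {g : ℝ → A} (hg : SmU (Icc (0 : ℝ) 1) g) (v : ℝ × ℝ × ℝ) {p : ℝ × ℝ × ℝ}
    (hp : p ∈ uCb) : mcR uCb v (fun p : ℝ × ℝ × ℝ => g p.2.2) p
      = mcR (Icc (0 : ℝ) 1) v.2.2 g p.2.2 := by
  unfold mcR; rw [pd_pull hg.sm v hp]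

lemma mcL_conj_pull {g : ℝ → A} {F : ℝ × ℝ × ℝ → A} (hg : SmU (Icc (0 : ℝ) 1) g) (hF : SmU uCb F)
    (v : ℝ × ℝ × ℝ) (hv : v.2.2 = 0) {p : ℝ × ℝ × ℝ} (hp : p ∈ uCb) :
    mcL uCb v (fun p => g p.2.2 * F p * star (g p.2.2)) p
      = star (star (g p.2.2)) * mcL uCb v F p * star (g p.2.2) := by
  have g0 := goodCb
  rw [SmU.mcL_mul g0 (hg.pull.mul hF) hg.pull.star v hp, SmU.mcL_mul g0 hg.pull hF v hp,
    SmU.mcL_star g0 hg.pull v hp, mcR_pull hg v hp, mcL_pull hg v hp, hv]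
  unfold mcR mcL
  simp [pd_zero_dir]

theorem conj_pointwise {g : ℝ → A} {F : ℝ × ℝ × ℝ → A} (hg : SmU (Icc (0 : ℝ) 1) g)
    (hF : SmU uCb F) {p : ℝ × ℝ × ℝ} (hp : p ∈ uCb) :
    ip (mcL uCb (1, 0, 0) (fun p => g p.2.2 * F p * star (g p.2.2)) p)
        (pd uCb (0, 0, 1) (mcL uCb (0, 1, 0) (fun p => g p.2.2 * F p * star (g p.2.2))) p)
      = ip (mcL uCb (1, 0, 0) F p) (pd uCb (0, 0, 1) (mcL uCb (0, 1, 0) F) p)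
        + 0
        - pd uCb (0, 1, 0)
            (fun p => ip (mcL uCb (1, 0, 0) F p) (mcL (Icc (0 : ℝ) 1) 1 g p.2.2)) p
        + pd uCb (1, 0, 0)
            (fun p => ip (mcL uCb (0, 1, 0) F p) (mcL (Icc (0 : ℝ) 1) 1 g p.2.2)) p + 0 := by
  have g0 := goodCb
  have hA := fun v => SmU.mcL_sm g0 hF v
  have hγ := SmU.mcL_sm GoodDom.Icc01 hg 1
  rw [g0.pd_ip _ (hA _) (pull_smooth hγ) hp, g0.pd_ip _ (hA _) (pull_smooth hγ) hp,
    pd_pull hγ _ hp, pd_pull hγ _ hp, pd_zero_dir, ip_zero_right, ip_zero_right,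
    mcL_conj_pull hg hF _ rfl hp,
    g0.pd_congr (0, 0, 1) (fun q hq => mcL_conj_pull hg hF (0, 1, 0) rfl hq) hp,
    pd_conj hF hg.pull.star _ _ hp, SmU.mcR_star g0 hg.pull _ hp, mcL_pull hg _ hp,
    SmU.mc_eq g0 hF (0, 1, 0) (1, 0, 0) hp]
  set γ := mcL (Icc (0 : ℝ) 1) 1 g p.2.2
  set x := mcL uCb (1, 0, 0) F p
  set y := mcL uCb (0, 1, 0) F p
  set z := pd uCb (0, 0, 1) (mcL uCb (0, 1, 0) F) p
  have h1 := hg.l _ hp.2.2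
  have e : -(star (star (g p.2.2)) * -γ) * y * star (g p.2.2)
      + star (star (g p.2.2)) * z * star (g p.2.2)
      + star (star (g p.2.2)) * y * (-γ * star (g p.2.2))
      = star (star (g p.2.2)) * (z + (γ * y - y * γ)) * star (g p.2.2) := by noncomm_ring
  have e2 : ip x (γ * y - y * γ) = ip (y * x - x * y) γ := by
    unfold ip
    simp only [mul_sub, sub_mul, map_sub]
    rw [← mul_assoc x γ y, AlgebraTrace.tr_mul_comm (x * γ) y]
    simp only [mul_assoc]
  rw [e, ip_conj (by rw [star_star, h1]), ip_add_right, e2, ip_add_left]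
  ring

theorem stokes_conj {g : ℝ → A} {F : ℝ × ℝ × ℝ → A} (hg : SmU (Icc (0 : ℝ) 1) g) (hF : CurveU F) :
    rawW (fun p => g p.2.2 * F p * star (g p.2.2)) = rawW F
      + (rawX g (fun q => F (1, q)) - rawX g (fun q => F (0, q))) - rawD g F := by
  have g0 := goodCb
  have hA := fun v => SmU.mcL_sm g0 hF.smu v
  have hγ := pull_smooth (SmU.mcL_sm GoodDom.Icc01 hg 1)
  have s3 := ip_smooth (hA (1, 0, 0)) hγ
  have s4 := ip_smooth (hA (0, 1, 0)) hγ
  have i3 := int_uCb_of (g0.pd_smooth (0, 1, 0) s3)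
  have i4 := int_uCb_of (g0.pd_smooth (1, 0, 0) s4)
  have i0 : IntegrableOn (fun _ : ℝ × ℝ × ℝ => (0 : ℝ)) uCb := integrableOn_zero
  have key := setIntegral_congr_fun (μ := volume)
    (measurableSet_Icc.prod (measurableSet_Icc.prod measurableSet_Icc))
    (fun p hp => conj_pointwise hg hF.smu hp)
  replace key := key.trans (int5
    (int_uCb_of (ip_smooth (hA _) (g0.pd_smooth _ (hA _)))) i0 i3 i4 i0)
  have e4 := ftcT s4
  have e3 := ftcS s3
  have j : ∀ t ∈ Icc (0 : ℝ) 1, ∫ q in uSq, ip (mcL uCb (0, 1, 0) F (t, q))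
      (mcL (Icc (0 : ℝ) 1) 1 g q.2) = rawX g (fun q => F (t, q)) := by
    intro t ht
    refine setIntegral_congr_fun (measurableSet_Icc.prod measurableSet_Icc) fun q hq => ?_
    rw [mcL_slice hF.smu ht _ hq]
  rw [integral_sub (int_uSq_of (slice_smooth s4 one_mem01).continuousOn)
    (int_uSq_of (slice_smooth s4 zero_mem01).continuousOn), j 1 one_mem01, j 0 zero_mem01] at e4
  have e3' : ∫ p in uSq, (ip (mcL uCb (1, 0, 0) F (p.1, 1, p.2)) (mcL (Icc (0 : ℝ) 1) 1 g p.2)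
      - ip (mcL uCb (1, 0, 0) F (p.1, 0, p.2)) (mcL (Icc (0 : ℝ) 1) 1 g p.2)) = rawD g F := by
    refine setIntegral_congr_fun (measurableSet_Icc.prod measurableSet_Icc) fun q hq => ?_
    rw [mcL_t_zero hF.smu.sm (q := (0, q.2)) ⟨zero_mem01, hq.2⟩ (c := 1)
      (fun t ht => hF.s0 t ht _ hq.2) hq.1, ip_zero_left, sub_zero]
  rw [e3'] at e3
  rw [e3, e4] at key
  simp only [integral_zero] at key
  unfold rawW
  linarith [key]

end stokes

end Calculus

section Raw

variable {A : Type*} [NormedRing A] [NormedAlgebra ℝ A] [StarRing A] [StarModule ℝ A]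
  [ContinuousStar A] [AlgebraTrace A]

lemma mcL_one {E : Type*} [NormedAddCommGroup E] [NormedSpace ℝ E] {S : Set E} (v p : E) :
    mcL S v (fun _ => (1 : A)) p = 0 := by unfold mcL pd; simp

lemma mcR_one {E : Type*} [NormedAddCommGroup E] [NormedSpace ℝ E] {S : Set E} (v p : E) :
    mcR S v (fun _ => (1 : A)) p = 0 := by unfold mcR pd; simp

lemma rawJ_one_left (g : ℝ × ℝ → A) : rawJ (fun _ => 1) g = 0 := by
  unfold rawJ; simp [mcL_one, ip_zero_left]

lemma rawJ_one_right (f : ℝ × ℝ → A) : rawJ f (fun _ => 1) = 0 := by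
  unfold rawJ; simp [mcR_one, ip_zero_right]

lemma rawW_one : rawW (fun _ => (1 : A)) = 0 := by
  unfold rawW; simp [mcL_one, ip_zero_left]

lemma rawX_one_right (g : ℝ → A) : rawX g (fun _ => 1) = 0 := by
  unfold rawX; simp [mcL_one, ip_zero_left]

lemma rawX_one_left (f : ℝ × ℝ → A) : rawX (fun _ => 1) f = 0 := by
  unfold rawX; simp [mcL_one, ip_zero_right]

lemma msSq : MeasurableSet uSq := measurableSet_Icc.prod measurableSet_Icc
lemma msCb : MeasurableSet uCb := measurableSet_Icc.prod msSq

lemma rawJ_assoc {f g h : ℝ × ℝ → A} (hf : SmU uSq f) (hg : SmU uSq g) (hh : SmU uSq h) :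
    rawJ (fun p => f p * g p) h + rawJ f g = rawJ f (fun p => g p * h p) + rawJ g h := by
  have G := goodSq
  have hI : ∀ {a b : ℝ × ℝ → A}, SmU uSq a → SmU uSq b → IntegrableOn
      (fun p => ip (mcL uSq (1, 0) a p) (mcR uSq (0, 1) b p)) uSq := fun ha hb =>
    int_uSq_of (ip_smooth (SmU.mcL_sm G ha _) (SmU.mcR_sm G hb _)).continuousOn
  unfold rawJ
  rw [← integral_add (hI (hf.mul hg) hh) (hI hf hg), ← integral_add (hI hf (hg.mul hh)) (hI hg hh)]
  refine setIntegral_congr_fun msSq fun p hp => ?_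
  rw [SmU.mcL_mul G hf hg _ hp, SmU.mcR_mul G hg hh _ hp, ip_add_left, ip_add_right]
  have e := ip_conj (g := g p) (h := star (g p)) (hg.l p hp)
    (star (g p) * mcL uSq (1, 0) f p * g p) (mcR uSq (0, 1) h p)
  have e2 : g p * (star (g p) * mcL uSq (1, 0) f p * g p) * star (g p) = mcL uSq (1, 0) f p := by
    rw [← mul_assoc, ← mul_assoc, hg.r p hp, one_mul, mul_assoc, hg.r p hp, mul_one]
  rw [e2] at e
  rw [e]; ring

lemma rawJ_inv {f : ℝ × ℝ → A} (hf : SmU uSq f) :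
    rawJ (fun p => star (f p)) f = rawJ f (fun p => star (f p)) := by
  have h := rawJ_assoc hf hf.star hf
  have e1 : rawJ (fun p => f p * star (f p)) f = 0 := by
    have G := goodSq
    refine setIntegral_eq_zero_of_forall_eq_zero fun p hp => ?_
    unfold mcL
    rw [G.pd_congr (G := fun _ => 1) _ (fun x hx => hf.r x hx) hp, G.pd_const, mul_zero,
      ip_zero_left]
  have e2 : rawJ f (fun p => star (f p) * f p) = 0 := by
    have G := goodSq
    refine setIntegral_eq_zero_of_forall_eq_zero fun p hp => ?_
    unfold mcR
    rw [G.pd_congr (G := fun _ => 1) _ (fun x hx => hf.l x hx) hp, G.pd_const, zero_mul,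
      ip_zero_right]
  linarith

/-- The pullback of a path to the square. -/
lemma SmU.pull2 {g : ℝ → A} (hg : SmU (Icc (0 : ℝ) 1) g) : SmU uSq (fun p : ℝ × ℝ => g p.2) :=
  ⟨hg.sm.comp contDiff_snd.contDiffOn fun p hp => hp.2, fun p hp => hg.l _ hp.2,
    fun p hp => hg.r _ hp.2⟩

lemma pd_pull2 {V : Type*} [NormedAddCommGroup V] [NormedSpace ℝ V] {g : ℝ → V}
    (hg : ContDiffOn ℝ ∞ g (Icc 0 1)) (v : ℝ × ℝ) {p : ℝ × ℝ} (hp : p ∈ uSq) :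
    pd uSq v (fun p : ℝ × ℝ => g p.2) p = pd (Icc (0 : ℝ) 1) v.2 g p.2 :=
  GoodDom.Icc01.pd_comp goodSq (φ := fun p : ℝ × ℝ => p.2)
    (L := ContinuousLinearMap.snd ℝ ℝ ℝ) v hg
    (ContinuousLinearMap.snd ℝ ℝ ℝ).hasFDerivAt (fun p hp => hp.2) hp

lemma mcL_pull2 {g : ℝ → A} (hg : SmU (Icc (0 : ℝ) 1) g) (v : ℝ × ℝ) {p : ℝ × ℝ}
    (hp : p ∈ uSq) : mcL uSq v (fun p : ℝ × ℝ => g p.2) p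
      = mcL (Icc (0 : ℝ) 1) v.2 g p.2 := by
  unfold mcL; rw [pd_pull2 hg.sm v hp]

lemma mcL_conj2 {g : ℝ → A} {f : ℝ × ℝ → A} (hg : SmU (Icc (0 : ℝ) 1) g) (hf : SmU uSq f)
    {p : ℝ × ℝ} (hp : p ∈ uSq) :
    mcL uSq (1, 0) (fun p => g p.2 * f p * star (g p.2)) p
      = g p.2 * mcL uSq (1, 0) f p * star (g p.2) := by
  have G := goodSq
  have z : mcL uSq (1, 0) (fun p : ℝ × ℝ => g p.2) p = 0 := by
    rw [mcL_pull2 hg _ hp]; unfold mcL; simp [pd_zero_dir]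
  have z' : mcR uSq (1, 0) (fun p : ℝ × ℝ => g p.2) p = 0 := by
    unfold mcR; rw [pd_pull2 hg.sm _ hp]; simp [pd_zero_dir]
  rw [SmU.mcL_mul G (hg.pull2.mul hf) hg.pull2.star _ hp, SmU.mcL_mul G hg.pull2 hf _ hp,
    SmU.mcL_star G hg.pull2 _ hp, z, z']
  simp

lemma int_X {g : ℝ → A} {f : ℝ × ℝ → A} (hg : SmU (Icc (0 : ℝ) 1) g) (hf : SmU uSq f) :
    IntegrableOn (fun p : ℝ × ℝ =>
      ip (mcL uSq (1, 0) f p) (mcL (Icc (0 : ℝ) 1) 1 g p.2)) uSq :=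
  int_uSq_of (ip_smooth (SmU.mcL_sm goodSq hf _) ((SmU.mcL_sm GoodDom.Icc01 hg 1).comp
    contDiff_snd.contDiffOn fun p hp => hp.2)).continuousOn

lemma int_J {f g : ℝ × ℝ → A} (hf : SmU uSq f) (hg : SmU uSq g) :
    IntegrableOn (fun p : ℝ × ℝ => ip (mcL uSq (1, 0) f p) (mcR uSq (0, 1) g p)) uSq :=
  int_uSq_of (ip_smooth (SmU.mcL_sm goodSq hf _) (SmU.mcR_sm goodSq hg _)).continuousOn

lemma SmU.conj2 {g : ℝ → A} {f : ℝ × ℝ → A} (hg : SmU (Icc (0 : ℝ) 1) g) (hf : SmU uSq f) :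
    SmU uSq (fun p => g p.2 * f p * Star.star (g p.2)) := (hg.pull2.mul hf).mul hg.pull2.star

lemma rawX_mul {g : ℝ → A} {a b : ℝ × ℝ → A} (hg : SmU (Icc (0 : ℝ) 1) g)
    (ha : SmU uSq a) (hb : SmU uSq b) :
    rawX g (fun p => a p * b p) + rawJ (fun p => g p.2 * a p * star (g p.2))
        (fun p => g p.2 * b p * star (g p.2))
      = rawX g a + rawX g b + rawJ a b := by
  have G := goodSq
  unfold rawX rawJ
  rw [← integral_add (int_X hg (ha.mul hb)) (int_J (hg.conj2 ha) (hg.conj2 hb)),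
    ← integral_add (int_X hg ha) (int_X hg hb),
    ← integral_add (Integrable.fun_add (int_X hg ha) (int_X hg hb)) (int_J ha hb)]
  refine setIntegral_congr_fun msSq fun p hp => ?_
  rw [mcL_conj2 hg ha hp, SmU.mcL_mul G ha hb _ hp,
    SmU.mcR_mul G (hg.pull2.mul hb) hg.pull2.star _ hp, SmU.mcR_mul G hg.pull2 hb _ hp,
    SmU.mcR_star G hg.pull2 _ hp, mcL_pull2 hg _ hp]
  have hr : mcR uSq (0, 1) (fun p : ℝ × ℝ => g p.2) p
      = g p.2 * mcL (Icc (0 : ℝ) 1) 1 g p.2 * star (g p.2) := by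
    unfold mcR mcL
    rw [pd_pull2 hg.sm _ hp, ← mul_assoc, hg.r _ hp.2, one_mul]
  rw [hr]
  set γ := mcL (Icc (0 : ℝ) 1) 1 g p.2
  set α := mcL uSq (1, 0) a p
  set ρ := mcR uSq (0, 1) b p
  set β := mcL uSq (1, 0) b p
  have h1 := hg.l _ hp.2
  have e1 : g p.2 * γ * star (g p.2) + g p.2 * ρ * star (g p.2)
      + (g p.2 * b p) * -γ * star (g p.2 * b p)
      = g p.2 * (γ + ρ + -(b p * γ * star (b p))) * star (g p.2) := by
    rw [star_mul]; noncomm_ring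
  have e2 := ip_conj (g := b p) (h := star (b p)) (hb.l p hp) (star (b p) * α * b p) γ
  have e3 : b p * (star (b p) * α * b p) * star (b p) = α := by
    rw [← mul_assoc, ← mul_assoc, hb.r p hp, one_mul, mul_assoc, hb.r p hp, mul_one]
  rw [e3] at e2
  rw [e1, ip_conj h1, ip_add_left, ip_add_right, ip_add_right, ip_neg_right, e2]
  ring

lemma rawX_comp {g h : ℝ → A} {f : ℝ × ℝ → A} (hg : SmU (Icc (0 : ℝ) 1) g)
    (hh : SmU (Icc (0 : ℝ) 1) h) (hf : SmU uSq f) :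
    rawX (fun r => g r * h r) f = rawX h f + rawX g (fun p => h p.2 * f p * star (h p.2)) := by
  unfold rawX
  rw [← integral_add (int_X hh hf) (int_X hg (hh.conj2 hf))]
  refine setIntegral_congr_fun msSq fun p hp => ?_
  rw [mcL_conj2 hh hf hp, SmU.mcL_mul GoodDom.Icc01 hg hh _ hp.2, ip_add_right]
  set γ := mcL (Icc (0 : ℝ) 1) 1 g p.2
  set α := mcL uSq (1, 0) f p
  have e2 := ip_conj (g := h p.2) (h := star (h p.2)) (hh.l _ hp.2) α (star (h p.2) * γ * h p.2)
  have e3 : h p.2 * (star (h p.2) * γ * h p.2) * star (h p.2) = γ := by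
    rw [← mul_assoc, ← mul_assoc, hh.r _ hp.2, one_mul, mul_assoc, hh.r _ hp.2, mul_one]
  rw [e3] at e2
  rw [e2]; ring

/-- A smooth path of based loops starting at the constant loop. -/
structure SqU (f : ℝ × ℝ → A) : Prop where
  smu : SmU uSq f
  s0 : ∀ r ∈ Icc (0 : ℝ) 1, f (0, r) = 1
  r0 : ∀ s ∈ Icc (0 : ℝ) 1, f (s, 0) = 1
  r1 : ∀ s ∈ Icc (0 : ℝ) 1, f (s, 1) = 1

lemma CurveU.mul {a b : ℝ × ℝ × ℝ → A} (ha : CurveU a) (hb : CurveU b) :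
    CurveU (fun p => a p * b p) :=
  ⟨ha.smu.mul hb.smu, fun t ht r hr => by simp only [ha.s0 t ht r hr, hb.s0 t ht r hr, mul_one],
    fun t ht r hr => by simp only [ha.r0 t ht r hr, hb.r0 t ht r hr, mul_one],
    fun t ht r hr => by simp only [ha.r1 t ht r hr, hb.r1 t ht r hr, mul_one]⟩

lemma CurveU.star {a : ℝ × ℝ × ℝ → A} (ha : CurveU a) : CurveU (fun p => star (a p)) :=
  ⟨ha.smu.star, fun t ht r hr => by simp only [ha.s0 t ht r hr, star_one],
    fun t ht r hr => by simp only [ha.r0 t ht r hr, star_one],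
    fun t ht r hr => by simp only [ha.r1 t ht r hr, star_one]⟩

/-- Constant curves. -/
lemma SqU.curve {f : ℝ × ℝ → A} (hf : SqU f) : CurveU (fun p : ℝ × ℝ × ℝ => f p.2) :=
  ⟨⟨hf.smu.sm.comp contDiff_snd.contDiffOn fun p hp => hp.2, fun p hp => hf.smu.l _ hp.2,
    fun p hp => hf.smu.r _ hp.2⟩, fun t _ r hr => hf.s0 r hr, fun t _ s hs => hf.r0 s hs,
    fun t _ s hs => hf.r1 s hs⟩

lemma CurveU.conj {g : ℝ → A} {a : ℝ × ℝ × ℝ → A} (hg : SmU (Icc (0 : ℝ) 1) g) (ha : CurveU a) :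
    CurveU (fun p => g p.2.2 * a p * Star.star (g p.2.2)) :=
  ⟨(hg.pull.mul ha.smu).mul hg.pull.star,
    fun t ht r hr => by simp only [ha.s0 t ht r hr, mul_one, hg.r r hr],
    fun t ht r hr => by simp only [ha.r0 t ht r hr, mul_one, hg.r _ zero_mem01],
    fun t ht r hr => by simp only [ha.r1 t ht r hr, mul_one, hg.r _ one_mem01]⟩

lemma mcL_t_const {f : ℝ × ℝ → A} (hf : SqU f) {p : ℝ × ℝ × ℝ} (hp : p ∈ uCb) :
    mcL uCb (1, 0, 0) (fun p : ℝ × ℝ × ℝ => f p.2) p = 0 :=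
  mcL_t_zero hf.curve.smu.sm (q := p.2) hp.2 (c := f p.2) (fun _ _ => rfl) hp.1

lemma rawW_const {f : ℝ × ℝ → A} (hf : SqU f) : rawW (fun p : ℝ × ℝ × ℝ => f p.2) = 0 :=
  setIntegral_eq_zero_of_forall_eq_zero fun p hp => by rw [mcL_t_const hf hp, ip_zero_left]

lemma rawB_zero {a b : ℝ × ℝ × ℝ → A} (ha : CurveU a) (c : ℝ → A)
    (h : ∀ t ∈ Icc (0 : ℝ) 1, ∀ r ∈ Icc (0 : ℝ) 1, a (t, 1, r) = c r) : rawB a b = 0 :=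
  setIntegral_eq_zero_of_forall_eq_zero fun p hp => by
    rw [mcL_t_zero ha.smu.sm (q := (1, p.2)) ⟨one_mem01, hp.2⟩ (c := c p.2)
      (fun t ht => h t ht _ hp.2) hp.1, ip_zero_left]

/-- `W` of a curve conjugated by a path of loops. -/
lemma rawW_conj_sq {f : ℝ × ℝ → A} {F : ℝ × ℝ × ℝ → A} (hf : SqU f) (hF : CurveU F)
    (h0 : ∀ q, F (0, q) = 1) :
    rawW (fun p => f p.2 * F p * star (f p.2)) = rawW F
      - rawJ f (fun q => F (1, q)) - rawJ (fun q => f q * F (1, q)) (fun q => star (f q))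
      + rawJ f (fun q => star (f q))
      + rawB (fun p => f p.2 * F p) (fun p => star (f p.2)) := by
  have e1 := stokes_mul hf.curve hF
  have e2 := stokes_mul (hf.curve.mul hF) hf.curve.star
  have hs : SqU (fun q => star (f q)) :=
    ⟨hf.smu.star, fun r hr => by simp only [hf.s0 r hr, star_one],
      fun r hr => by simp only [hf.r0 r hr, star_one],
      fun r hr => by simp only [hf.r1 r hr, star_one]⟩
  rw [rawB_zero hf.curve (fun r => f (1, r)) (fun _ _ _ _ => rfl), rawW_const hf] at e1
  simp only [h0, mul_one, rawJ_one_right] at e1 e2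
  have e3 := rawW_const hs
  linarith

end Raw

section Peiffer

variable {A : Type*} [NormedRing A] [NormedAlgebra ℝ A] [StarRing A] [StarModule ℝ A]
  [ContinuousStar A] [AlgebraTrace A]

lemma ip_smul_left (c : ℝ) (x y : A) : ip (c • x) y = c * ip x y := by unfold ip; simp
lemma ip_smul_right (c : ℝ) (x y : A) : ip x (c • y) = c * ip x y := by unfold ip; simp

lemma pd_r_line {V : Type*} [NormedAddCommGroup V] [NormedSpace ℝ V] {F : ℝ × ℝ × ℝ → V}
    (hF : ContDiffOn ℝ ∞ F uCb) {t s r : ℝ} (ht : t ∈ Icc (0 : ℝ) 1) (hs : s ∈ Icc (0 : ℝ) 1)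
    (hr : r ∈ Icc (0 : ℝ) 1) :
    pd uCb (0, 0, 1) F (t, s, r) = pd (Icc (0 : ℝ) 1) 1 (fun r => F (t, s, r)) r :=
  (goodCb.pd_comp GoodDom.Icc01 (φ := fun r => (t, s, r))
    (L := (0 : ℝ →L[ℝ] ℝ).prod ((0 : ℝ →L[ℝ] ℝ).prod (ContinuousLinearMap.id ℝ ℝ))) 1 hF
    ((hasFDerivAt_const t r).prodMk ((hasFDerivAt_const s r).prodMk (hasFDerivAt_id r)))
    (fun r hr => ⟨ht, hs, hr⟩) hr).symm

lemma mul_mem01 {t s : ℝ} (ht : t ∈ Icc (0 : ℝ) 1) (hs : s ∈ Icc (0 : ℝ) 1) :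
    t * s ∈ Icc (0 : ℝ) 1 := ⟨mul_nonneg ht.1 hs.1, mul_le_one₀ ht.2 hs.1 hs.2⟩

lemma mcL_scale {f : ℝ × ℝ → A} {F : ℝ × ℝ × ℝ → A} (hf : SmU uSq f)
    (h : ∀ p ∈ uCb, F p = f (p.1 * p.2.1, p.2.2)) {p : ℝ × ℝ × ℝ} (hp : p ∈ uCb) :
    mcL uCb (1, 0, 0) F p = p.2.1 • mcL uSq (1, 0) f (p.1 * p.2.1, p.2.2) ∧
    mcL uCb (0, 1, 0) F p = p.1 • mcL uSq (1, 0) f (p.1 * p.2.1, p.2.2) := by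
  have e : ∀ v, pd uCb v F p = pd uCb v (fun p => f (p.1 * p.2.1, p.2.2)) p := fun v =>
    goodCb.pd_congr v h hp
  have h2 : HasFDerivAt (fun p : ℝ × ℝ × ℝ => p.2.1)
      ((ContinuousLinearMap.fst ℝ ℝ ℝ).comp (ContinuousLinearMap.snd ℝ ℝ (ℝ × ℝ))) p :=
    ((ContinuousLinearMap.fst ℝ ℝ ℝ).comp (ContinuousLinearMap.snd ℝ ℝ (ℝ × ℝ))).hasFDerivAt
  have h3 : HasFDerivAt (fun p : ℝ × ℝ × ℝ => p.2.2)
      ((ContinuousLinearMap.snd ℝ ℝ ℝ).comp (ContinuousLinearMap.snd ℝ ℝ (ℝ × ℝ))) p :=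
    ((ContinuousLinearMap.snd ℝ ℝ ℝ).comp (ContinuousLinearMap.snd ℝ ℝ (ℝ × ℝ))).hasFDerivAt
  have hφ := (((hasFDerivAt_fst (𝕜 := ℝ) (p := p)).mul h2).prodMk h3)
  have c := fun v => goodSq.pd_comp goodCb (F := f) v hf.sm hφ
    (fun q hq => ⟨mul_mem01 hq.1 hq.2.1, hq.2.2⟩) hp
  simp only [Pi.mul_apply] at c
  have l : ∀ (x : ℝ) (q : ℝ × ℝ), pd uSq (x, 0) f q = x • pd uSq (1, 0) f q := by
    intro x q
    unfold pd
    rw [← map_smul]; simp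
  constructor
  · unfold mcL
    rw [e, c, h p hp]
    simp [-Set.Icc_prod_Icc]
    rw [l, mul_smul_comm]
  · unfold mcL
    rw [e, c, h p hp]
    simp [-Set.Icc_prod_Icc]
    rw [l, mul_smul_comm]

lemma rawW_scale {f : ℝ × ℝ → A} {F : ℝ × ℝ × ℝ → A} (hf : SqU f) (hF : CurveU F)
    (h : ∀ p ∈ uCb, F p = f (p.1 * p.2.1, p.2.2)) : rawW F = 0 := by
  have g := goodCb
  have hA := fun v => SmU.mcL_sm g hF.smu v
  have sX := ip_smooth (hA (1, 0, 0)) (hA (0, 1, 0))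
  have e := ftcR sX
  have z : ∫ p in uSq, (ip (mcL uCb (1, 0, 0) F (p.1, p.2, 1)) (mcL uCb (0, 1, 0) F (p.1, p.2, 1))
      - ip (mcL uCb (1, 0, 0) F (p.1, p.2, 0)) (mcL uCb (0, 1, 0) F (p.1, p.2, 0))) = 0 := by
    refine setIntegral_eq_zero_of_forall_eq_zero fun q hq => ?_
    rw [mcL_t_zero hF.smu.sm (q := (q.2, 1)) ⟨hq.2, one_mem01⟩ (c := 1)
      (fun t ht => hF.r1 t ht _ hq.2) hq.1,
      mcL_t_zero hF.smu.sm (q := (q.2, 0)) ⟨hq.2, zero_mem01⟩ (c := 1)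
      (fun t ht => hF.r0 t ht _ hq.2) hq.1, ip_zero_left, ip_zero_left, sub_zero]
  rw [z] at e
  have k : ∫ p in uCb, pd uCb (0, 0, 1)
      (fun p => ip (mcL uCb (1, 0, 0) F p) (mcL uCb (0, 1, 0) F p)) p = 2 * rawW F := by
    unfold rawW
    rw [← integral_const_mul]
    refine setIntegral_congr_fun msCb fun p hp => ?_
    obtain ⟨t, s, r⟩ := p
    rw [g.pd_ip _ (hA _) (hA _) hp, pd_r_line (hA _) hp.1 hp.2.1 hp.2.2,
      pd_r_line (hA _) hp.1 hp.2.1 hp.2.2]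
    have hσ : ContDiffOn ℝ ∞ (fun r => mcL uSq (1, 0) f (t * s, r)) (Icc (0 : ℝ) 1) :=
      (SmU.mcL_sm goodSq hf.smu (1, 0)).comp (contDiff_const.prodMk contDiff_id).contDiffOn
        fun r hr => ⟨mul_mem01 hp.1 hp.2.1, hr⟩
    have a1 := fun r (hr : r ∈ Icc (0 : ℝ) 1) => mcL_scale hf.smu h (p := (t, s, r))
      ⟨hp.1, hp.2.1, hr⟩
    rw [GoodDom.Icc01.pd_congr 1 (fun r hr => (a1 r hr).1) hp.2.2,
      GoodDom.Icc01.pd_congr 1 (fun r hr => (a1 r hr).2) hp.2.2,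
      (a1 r hp.2.2).1, (a1 r hp.2.2).2]
    have b := fun c : ℝ => GoodDom.Icc01.pd_clm (c • ContinuousLinearMap.id ℝ A) 1 hσ hp.2.2
    have b1 := b s
    have b2 := b t
    simp only [_root_.smul_apply, ContinuousLinearMap.id_apply] at b1 b2
    simp only
    rw [b1, b2]
    simp only [ip_smul_left, ip_smul_right]
    rw [ip_comm (pd _ _ _ _)]
    ring
  linarith

/-- The computation behind the Peiffer identity. -/
lemma rawW_peiffer {f₁ f₂ : ℝ × ℝ → A} {F : ℝ × ℝ × ℝ → A} {γ : ℝ → A} (h₁ : SqU f₁)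
    (h₂ : SqU f₂) (hF : CurveU F) (h : ∀ p ∈ uCb, F p = f₂ (p.1 * p.2.1, p.2.2))
    (hγ : SmU (Icc (0 : ℝ) 1) γ) (hγf : ∀ r, f₁ (1, r) = γ r) (F0 : ∀ q, F (0, q) = 1)
    (F1 : ∀ q, F (1, q) = f₂ q) :
    rawW (fun p => (γ p.2.2 * F p * star (γ p.2.2)) * star (f₁ p.2 * F p * star (f₁ p.2)))
      = rawX γ f₂ + rawJ f₁ f₂ + rawJ (fun q => f₁ q * f₂ q) (fun q => star (f₁ q))
        - rawJ f₁ (fun q => star (f₁ q))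
        + rawJ (fun q => f₁ q * f₂ q * star (f₁ q)) (fun q => star (f₁ q * f₂ q * star (f₁ q)))
        - rawJ (fun q => γ q.2 * f₂ q * star (γ q.2))
            (fun q => star (f₁ q * f₂ q * star (f₁ q))) := by
  have g := goodCb
  have hP : CurveU (fun p : ℝ × ℝ × ℝ => f₁ p.2 * F p * star (f₁ p.2)) :=
    (h₁.curve.mul hF).mul h₁.curve.star
  have hR : CurveU (fun p : ℝ × ℝ × ℝ => γ p.2.2 * F p * star (γ p.2.2)) := hF.conj hγ
  have wR := stokes_conj hγ hF
  have wP := rawW_conj_sq h₁ hF F0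
  have wY := stokes_mul hR hP.star
  have w1 := stokes_mul hP hP.star
  have hone : rawW (fun p => (f₁ p.2 * F p * star (f₁ p.2))
      * star (f₁ p.2 * F p * star (f₁ p.2))) = 0 := by
    refine setIntegral_eq_zero_of_forall_eq_zero fun p hp => ?_
    unfold mcL
    rw [g.pd_congr (G := fun _ => 1) _ (fun x hx => hP.smu.r x hx) hp, g.pd_const, mul_zero,
      ip_zero_left]
  -- on the boundary `s = 1` both conjugates agree
  have hB : rawB (fun p : ℝ × ℝ × ℝ => γ p.2.2 * F p * star (γ p.2.2))
        (fun p : ℝ × ℝ × ℝ => star (f₁ p.2 * F p * star (f₁ p.2)))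
      = rawB (fun p : ℝ × ℝ × ℝ => f₁ p.2 * F p * star (f₁ p.2))
        (fun p : ℝ × ℝ × ℝ => star (f₁ p.2 * F p * star (f₁ p.2))) := by
    refine setIntegral_congr_fun msSq fun p hp => ?_
    have e : mcL uCb (1, 0, 0) (fun p : ℝ × ℝ × ℝ => γ p.2.2 * F p * star (γ p.2.2))
        (p.1, 1, p.2) = mcL uCb (1, 0, 0) (fun p : ℝ × ℝ × ℝ => f₁ p.2 * F p * star (f₁ p.2))
        (p.1, 1, p.2) := by
      unfold mcL
      rw [pd_t_line hR.smu.sm hp.1 (q := (1, p.2)) ⟨one_mem01, hp.2⟩,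
        pd_t_line hP.smu.sm hp.1 (q := (1, p.2)) ⟨one_mem01, hp.2⟩]
      simp only [hγf]
    rw [e]
  have hBD : rawB (fun p : ℝ × ℝ × ℝ => f₁ p.2 * F p) (fun p => star (f₁ p.2)) = - rawD γ F := by
    unfold rawB rawD
    rw [← integral_neg]
    refine setIntegral_congr_fun msSq fun p hp => ?_
    have hq : ((p.1, 1, p.2) : ℝ × ℝ × ℝ) ∈ uCb := ⟨hp.1, one_mem01, hp.2⟩
    rw [SmU.mcL_mul g h₁.curve.smu hF.smu _ hq, mcL_t_const h₁ hq,
      SmU.mcR_star g h₁.curve.smu _ hq, mul_zero, zero_mul, zero_add, ip_neg_right]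
    congr 2
    unfold mcL
    rw [pd_r_line h₁.curve.smu.sm hp.1 one_mem01 hp.2]
    simp only [hγf]
  have z := rawW_scale h₂ hF h
  simp only [F0, F1, mul_one] at wR wP wY w1
  have u1 : rawJ (fun q => f₁ q * star (f₁ q)) (fun q => star (f₁ q * star (f₁ q))) = 0 := by
    refine setIntegral_eq_zero_of_forall_eq_zero fun p hp => ?_
    unfold mcL
    rw [goodSq.pd_congr (G := fun _ => 1) _ (fun x hx => h₁.smu.r x hx) hp, goodSq.pd_const,
      mul_zero, ip_zero_left]
  have u2 : rawJ (fun q : ℝ × ℝ => γ q.2 * star (γ q.2)) (fun q => star (f₁ q * star (f₁ q)))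
      = 0 := by
    refine setIntegral_eq_zero_of_forall_eq_zero fun p hp => ?_
    unfold mcL
    rw [goodSq.pd_congr (G := fun _ => 1) _ (fun x hx => hγ.r x.2 hx.2) hp, goodSq.pd_const,
      mul_zero, ip_zero_left]
  rw [rawX_one_right] at wR
  linarith

end Peiffer

section Smooth

open Diffeology Topology

/-- `ℝⁿ` as a Euclidean space. -/
abbrev Eu (n : ℕ) : Type := EuclideanSpace ℝ (Fin n)

/-- A smooth map on an open set can be extended to all of `ℝᵐ` away from the boundary. -/
lemma exists_cutoff {m n : ℕ} {v : Set (Eu m)} (hv : IsOpen v) {f : Eu m → Eu n}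
    (hf : ContDiffOn ℝ ∞ f v) {x : Eu m} (hx : x ∈ v) :
    ∃ g : Eu m → Eu n, ContDiff ℝ ∞ g ∧ g =ᶠ[𝓝 x] f := by
  obtain ⟨ε, hε, hb⟩ := Metric.isOpen_iff.1 hv x hx
  let χ : ContDiffBump x := ⟨ε / 4, ε / 2, by positivity, by linarith⟩
  refine ⟨fun y => χ y • f y, contDiff_iff_contDiffAt.2 fun y => ?_, ?_⟩
  · by_cases h1 : y ∈ tsupport χ
    · rw [χ.tsupport_eq] at h1
      have h2 : y ∈ v := hb (Metric.closedBall_subset_ball (by simp only [χ]; linarith) h1)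
      exact χ.contDiff.contDiffAt.smul (hf.contDiffAt (hv.mem_nhds h2))
    · refine (contDiffAt_const (c := (0 : Eu n))).congr_of_eventuallyEq ?_
      filter_upwards [notMem_tsupport_iff_eventuallyEq.1 h1] with z hz
      simp [hz]
  · filter_upwards [χ.eventuallyEq_one] with y hy
    simp [hy]

/-- The subspace diffeology (more generally the pullback diffeology) along `f`. -/
@[reducible] def inducedDiffeology {X Y : Type*} [DiffeologicalSpace Y] (f : X → Y) :
    DiffeologicalSpace X where
  plots _ := {p | IsPlot (f ∘ p)}
  constant_plots x := isPlot_const (x := f x)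
  plot_reparam {n m p g} hp hg := isPlot_reparam (p := f ∘ p) hp hg
  locality hp := DiffeologicalSpace.locality (p := f ∘ _) hp

instance instDiffeologySubtype {X : Type*} [DiffeologicalSpace X] (q : X → Prop) :
    DiffeologicalSpace (Subtype q) := inducedDiffeology Subtype.val

/-- The product diffeology. -/
instance instDiffeologyProd {X Y : Type*} [DiffeologicalSpace X] [DiffeologicalSpace Y] :
    DiffeologicalSpace (X × Y) where
  plots _ := {p | IsPlot (fun x => (p x).1) ∧ IsPlot (fun x => (p x).2)}
  constant_plots x := ⟨isPlot_const, isPlot_const⟩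
  plot_reparam hp hf := ⟨isPlot_reparam hp.1 hf, isPlot_reparam hp.2 hf⟩
  locality hp := ⟨DiffeologicalSpace.locality fun x => by
      obtain ⟨u, hu, hx, h⟩ := hp x
      exact ⟨u, hu, hx, fun a b => (h a b).1⟩,
    DiffeologicalSpace.locality fun x => by
      obtain ⟨u, hu, hx, h⟩ := hp x
      exact ⟨u, hu, hx, fun a b => (h a b).2⟩⟩

/-- The quotient diffeology along a surjection `π`: plots are the maps that locally lift to plots
of the total space. -/
@[reducible] def quotientDiffeology {X Y : Type*} [DiffeologicalSpace X] (π : X → Y)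
    (hπ : Function.Surjective π) : DiffeologicalSpace Y :=
  .ofCorePlotsOn {
    isPlotOn := fun {n u} _ p => ∀ x ∈ u, ∃ q : Eu n → X, IsPlot q ∧ (π ∘ q) =ᶠ[𝓝 x] p
    isPlotOn_congr := fun {n u} hu p q h => by
      have key : ∀ {p q : Eu n → Y}, EqOn p q u →
          (∀ x ∈ u, ∃ r : Eu n → X, IsPlot r ∧ (π ∘ r) =ᶠ[𝓝 x] p) →
          ∀ x ∈ u, ∃ r : Eu n → X, IsPlot r ∧ (π ∘ r) =ᶠ[𝓝 x] q := by
        intro p q h hp x hx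
        obtain ⟨r, hr, e⟩ := hp x hx
        exact ⟨r, hr, e.trans (h.eventuallyEq_of_mem (hu.mem_nhds hx))⟩
      exact ⟨key h, key h.symm⟩
    isPlot_const := fun y x _ => by
      obtain ⟨z, rfl⟩ := hπ y
      exact ⟨fun _ => z, isPlot_const, Filter.EventuallyEq.rfl⟩
    isPlotOn_reparam := by
      intro n m u v hu hv p f h hp hf x hx
      obtain ⟨q, hq, e⟩ := hp (f x) (h hx)
      obtain ⟨g, hg, e'⟩ := exists_cutoff hv hf hx
      have hc : Filter.Tendsto f (𝓝 x) (𝓝 (f x)) :=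
        (hf.continuousOn.continuousAt (hv.mem_nhds hx))
      refine ⟨q ∘ g, isPlot_reparam hq hg, ?_⟩
      filter_upwards [e', hc.eventually e] with y hy hy'
      simpa [hy] using hy'
    locality := by
      intro n u hu p hp x hx
      obtain ⟨v, hv, hxv, h⟩ := hp x hx
      exact h x hxv }

/-- The functional diffeology on a set `X` of smooth functions `T → V` given by `ev`: plots are the
jointly smooth families. -/
@[reducible] def functionalDiffeology {X W V : Type*} [NormedAddCommGroup W] [NormedSpace ℝ W]
    [NormedAddCommGroup V] [NormedSpace ℝ V] (T : Set W) (ev : X → W → V)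
    (hev : ∀ x, ContDiffOn ℝ ∞ (ev x) T) : DiffeologicalSpace X :=
  .ofCorePlotsOn {
    isPlotOn := fun {n u} _ p => ContDiffOn ℝ ∞ (fun z : Eu n × W => ev (p z.1) z.2) (u ×ˢ T)
    isPlotOn_congr := fun _ _ _ h => contDiffOn_congr fun z hz => by
      show ev _ _ = ev _ _
      rw [h hz.1]
    isPlot_const := fun x => (hev x).comp contDiff_snd.contDiffOn fun z hz => hz.2
    isPlotOn_reparam := fun _ _ _ h hp hf =>
      hp.comp ((hf.comp contDiff_fst.contDiffOn fun z hz => hz.1).prodMk contDiff_snd.contDiffOn)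
        fun z hz => ⟨h hz.1, hz.2⟩
    locality := by
      intro n u hu p hp z hz
      obtain ⟨v, hv, hxv, h⟩ := hp z.1 hz.1
      refine (h z ⟨hxv, hz.2⟩).mono_of_mem_nhdsWithin ?_
      have h1 : (v ×ˢ (univ : Set W)) ∈ 𝓝 z := (hv.prod isOpen_univ).mem_nhds ⟨hxv, trivial⟩
      filter_upwards [self_mem_nhdsWithin, mem_nhdsWithin_of_mem_nhds h1] with y hy hy'
      exact ⟨hy'.1, hy.2⟩ }

/-- The standard smooth structure of the circle. -/
instance instDiffeologyCircle : DiffeologicalSpace Circle :=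
  letI : DiffeologicalSpace ℂ := NormedSpace.toDiffeology ℂ
  inducedDiffeology (fun z : Circle => (z : ℂ))

/-- `k` times continuously differentiable maps from `ℝⁿ` to a topological vector space. -/
def IsCk {E : Type*} [AddCommGroup E] [Module ℝ E] [TopologicalSpace E] {n : ℕ} :
    ℕ → (Eu n → E) → Prop
  | 0, f => Continuous f
  | k + 1, f => Continuous f ∧ ∃ f' : Eu n → Eu n →L[ℝ] E,
      (∀ x, HasFDerivAt f (f' x) x) ∧ ∀ v, IsCk k (fun x => f' x v)

/-- A real Fréchet space. -/
structure FrechetSpace where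
  carrier : Type
  [addCommGroup : AddCommGroup carrier]
  [module : Module ℝ carrier]
  [uniformSpace : UniformSpace carrier]
  [isUniformAddGroup : IsUniformAddGroup carrier]
  [continuousSMul : ContinuousSMul ℝ carrier]
  [locallyConvex : LocallyConvexSpace ℝ carrier]
  [t2 : T2Space carrier]
  [complete : CompleteSpace carrier]
  [metrizable : (uniformity carrier).IsCountablyGenerated]

instance : CoeSort FrechetSpace Type := ⟨FrechetSpace.carrier⟩

attribute [instance] FrechetSpace.addCommGroup FrechetSpace.module FrechetSpace.uniformSpace

/-- A smooth chart of the diffeological space `X` in the topological vector space `E`: a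
diffeomorphism from a D-open subset of `X` onto an open subset of `E`. -/
structure Chart (X : Type*) [DiffeologicalSpace X] (E : Type*) [AddCommGroup E] [Module ℝ E]
    [TopologicalSpace E] extends PartialEquiv X E where
  open_source : IsOpen[dTopology] source
  open_target : IsOpen target
  smooth : ∀ (n : ℕ) (p : Eu n → X), (∀ x, p x ∈ source) →
    (IsPlot p ↔ ∀ k, IsCk k (toFun ∘ p))

/-- `X` is a (Hausdorff, smooth) Fréchet manifold. -/
structure IsFrechetManifold (X : Type*) [DiffeologicalSpace X] : Prop where
  hausdorff : @T2Space X dTopology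
  charts : ∀ x : X, ∃ (E : FrechetSpace) (φ : Chart X E), x ∈ φ.source

/-- `f` is a submersion of Fréchet manifolds: locally it is the projection `E × F → E`. -/
def IsSubmersion {X Y : Type*} [DiffeologicalSpace X] [DiffeologicalSpace Y] (f : X → Y) : Prop :=
  ∀ x : X, ∃ (E F : FrechetSpace) (φ : Chart X (E × F)) (ψ : Chart Y E),
    x ∈ φ.source ∧ MapsTo f φ.source ψ.source ∧ ∀ y ∈ φ.source, ψ.toFun (f y) = (φ.toFun y).1

/-- Groupoids with set of objects `Ob` and set of arrows `Ar`. The composite `comp a b` is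
`a ∘ b`, defined if the source of `a` is the target of `b`. -/
structure Grpd (Ob Ar : Type*) where
  src : Ar → Ob
  tgt : Ar → Ob
  one : Ob → Ar
  inv : Ar → Ar
  comp : (a b : Ar) → src a = tgt b → Ar
  src_one : ∀ x, src (one x) = x
  tgt_one : ∀ x, tgt (one x) = x
  src_inv : ∀ a, src (inv a) = tgt a
  tgt_inv : ∀ a, tgt (inv a) = src a
  src_comp : ∀ a b h, src (comp a b h) = src b
  tgt_comp : ∀ a b h, tgt (comp a b h) = tgt a
  comp_assoc : ∀ a b c h₁ h₂ h₃ h₄, comp (comp a b h₁) c h₃ = comp a (comp b c h₂) h₄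
  one_comp : ∀ a h, comp (one (tgt a)) a h = a
  comp_one : ∀ a h, comp a (one (src a)) h = a
  inv_comp : ∀ a h, comp (inv a) a h = one (src a)
  comp_inv : ∀ a h, comp a (inv a) h = one (tgt a)

/-- `G` is a Lie groupoid (modelled on Fréchet spaces). -/
structure IsLieGroupoid {Ob Ar : Type*} [DiffeologicalSpace Ob] [DiffeologicalSpace Ar]
    (G : Grpd Ob Ar) : Prop where
  ob : IsFrechetManifold Ob
  ar : IsFrechetManifold Ar
  smooth_src : DSmooth G.src
  smooth_tgt : DSmooth G.tgt
  submersion_src : IsSubmersion G.src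
  submersion_tgt : IsSubmersion G.tgt
  smooth_one : DSmooth G.one
  smooth_inv : DSmooth G.inv
  smooth_comp : DSmooth (fun p : {p : Ar × Ar // G.src p.1 = G.tgt p.2} =>
    G.comp p.1.1 p.1.2 p.2)

/-- Smooth functors of groupoids. -/
structure SmoothFunctor {Ob Ar Ob' Ar' : Type*} [DiffeologicalSpace Ob] [DiffeologicalSpace Ar]
    [DiffeologicalSpace Ob'] [DiffeologicalSpace Ar'] (G : Grpd Ob Ar) (G' : Grpd Ob' Ar') where
  obj : Ob → Ob'
  arr : Ar → Ar'
  smooth_obj : DSmooth obj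
  smooth_arr : DSmooth arr
  src_arr : ∀ a, G'.src (arr a) = obj (G.src a)
  tgt_arr : ∀ a, G'.tgt (arr a) = obj (G.tgt a)
  arr_one : ∀ x, arr (G.one x) = G'.one (obj x)
  arr_comp : ∀ a b h h', arr (G.comp a b h) = G'.comp (arr a) (arr b) h'

/-- Weak equivalences of Lie groupoids: smoothly essentially surjective and smoothly fully
faithful functors. -/
structure IsWeakEquivalence {Ob Ar Ob' Ar' : Type*} [DiffeologicalSpace Ob] [DiffeologicalSpace Ar]
    [DiffeologicalSpace Ob'] [DiffeologicalSpace Ar'] {G : Grpd Ob Ar} {G' : Grpd Ob' Ar'}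
    (F : SmoothFunctor G G') : Prop where
  ess_surj : Function.Surjective
    (fun p : {p : Ob × Ar' // G'.src p.2 = F.obj p.1} => G'.tgt p.1.2)
  ess_subm : IsSubmersion
    (fun p : {p : Ob × Ar' // G'.src p.2 = F.obj p.1} => G'.tgt p.1.2)
  full_faithful : ∀ (x y : Ob) (b : Ar'), G'.src b = F.obj x → G'.tgt b = F.obj y →
    ∃! a : Ar, G.src a = x ∧ G.tgt a = y ∧ F.arr a = b
  smooth_full_faithful : ∀ (n : ℕ) (p : Eu n → Ar), IsPlot (G.src ∘ p) → IsPlot (G.tgt ∘ p) →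
    IsPlot (F.arr ∘ p) → IsPlot p

/-- Equivalence of Lie groupoids: there is a span of weak equivalences of Lie groupoids. -/
def LieGroupoidEquivalent {Ob Ar Ob' Ar' : Type*} [DiffeologicalSpace Ob] [DiffeologicalSpace Ar]
    [DiffeologicalSpace Ob'] [DiffeologicalSpace Ar'] (G : Grpd Ob Ar) (G' : Grpd Ob' Ar') : Prop :=
  ∃ (O A : Type) (_ : DiffeologicalSpace O) (_ : DiffeologicalSpace A) (Z : Grpd O A)
    (F : SmoothFunctor Z G) (F' : SmoothFunctor Z G'),
    IsLieGroupoid Z ∧ IsWeakEquivalence F ∧ IsWeakEquivalence F'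

/-- The discrete groupoid `M ⇉ M`, with only identity arrows. -/
def discreteGroupoid (M : Type*) : Grpd M M where
  src := id
  tgt := id
  one := id
  inv := id
  comp a _ _ := a
  src_one _ := rfl
  tgt_one _ := rfl
  src_inv _ := rfl
  tgt_inv _ := rfl
  src_comp _ _ h := h
  tgt_comp _ _ _ := rfl
  comp_assoc _ _ _ _ _ _ _ := rfl
  one_comp _ _ := rfl
  comp_one _ _ := rfl
  inv_comp _ _ := rfl
  comp_inv _ _ := rfl

end Smooth

section CrossedModules

/-- Crossed modules of groups `H → G`. -/
structure CrossedModule (H G : Type*) [Group H] [Group G] where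
  t : H →* G
  act : G →* MulAut H
  equivariant : ∀ g h, t (act g h) = g * t h * g⁻¹
  peiffer : ∀ h k, act (t h) k = h * k * h⁻¹

/-- Strict morphisms of crossed modules. -/
structure CrossedModule.Hom {H₁ G₁ H₂ G₂ : Type*} [Group H₁] [Group G₁] [Group H₂] [Group G₂]
    (C₁ : CrossedModule H₁ G₁) (C₂ : CrossedModule H₂ G₂) where
  e₀ : G₁ →* G₂
  e₁ : H₁ →* H₂
  t_comm : ∀ h, e₀ (C₁.t h) = C₂.t (e₁ h)
  act_comm : ∀ g h, C₂.act (e₀ g) (e₁ h) = e₁ (C₁.act g h)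

lemma act_t_inv {H G : Type*} [Group H] [Group G] (C : CrossedModule H G) (h k : H) :
    C.act (C.t h⁻¹) k = h⁻¹ * k * h := by rw [C.peiffer, inv_inv]

namespace CrossedModule.Hom

variable {H₁ G₁ H₂ G₂ : Type*} [Group H₁] [Group G₁] [Group H₂] [Group G₂]
  {C₁ : CrossedModule H₁ G₁} {C₂ : CrossedModule H₂ G₂} (e : CrossedModule.Hom C₁ C₂)

/-- Objects of the quotient groupoid: `G₂` modulo `g ∼ g e₀(k)`. -/
def QOb : Type _ := G₂ ⧸ e.e₀.range

/-- `(g, h) ∼ (g e₀(k), (g ▷ e₁(m)) h)`. -/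
def arrSetoid : Setoid (G₂ × H₂) where
  r a b := ∃ (k : G₁) (m : H₁), b = (a.1 * e.e₀ k, C₂.act a.1 (e.e₁ m) * a.2)
  iseqv := by
    refine ⟨fun a => ⟨1, 1, by simp⟩, ?_, ?_⟩
    · rintro ⟨g, h⟩ _ ⟨k, m, rfl⟩
      refine ⟨k⁻¹, C₁.act k⁻¹ m⁻¹, ?_⟩
      simp only [map_mul, MulAut.mul_apply, e.act_comm]
      simp
    · rintro ⟨g, h⟩ _ _ ⟨k, m, rfl⟩ ⟨k', m', rfl⟩
      refine ⟨k * k', C₁.act k m' * m, ?_⟩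
      simp only [map_mul, MulAut.mul_apply, e.act_comm, mul_assoc]

/-- Arrows of the quotient groupoid: `G₂ ⋉ H₂` modulo the right action of `G₁ ⋉ H₁`. -/
def QAr : Type _ := Quotient e.arrSetoid

/-- The class of an object. -/
def mkOb (g : G₂) : e.QOb := QuotientGroup.mk g

/-- The class of an arrow. -/
def mkAr (a : G₂ × H₂) : e.QAr := Quotient.mk e.arrSetoid a

lemma mkOb_surjective : Function.Surjective e.mkOb := QuotientGroup.mk_surjective

lemma mkAr_surjective : Function.Surjective e.mkAr := Quotient.mk_surjective

lemma mkOb_eq {g g' : G₂} : e.mkOb g = e.mkOb g' ↔ ∃ k, g' = g * e.e₀ k := by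
  refine (QuotientGroup.eq (s := e.e₀.range)).trans ?_
  constructor
  · rintro ⟨k, hk⟩; exact ⟨k, by rw [hk]; group⟩
  · rintro ⟨k, rfl⟩; exact ⟨k, by group⟩

lemma mkAr_eq {a b : G₂ × H₂} : e.mkAr a = e.mkAr b ↔
    ∃ (k : G₁) (m : H₁), b = (a.1 * e.e₀ k, C₂.act a.1 (e.e₁ m) * a.2) := Quotient.eq

/-- `(g, h) ↦ t(h⁻¹) g`. -/
def qsrc : e.QAr → e.QOb :=
  Quotient.lift (fun a : G₂ × H₂ => e.mkOb (C₂.t a.2⁻¹ * a.1)) (by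
    rintro ⟨g, h⟩ _ ⟨k, m, rfl⟩
    refine e.mkOb_eq.2 ⟨C₁.t m⁻¹ * k, ?_⟩
    simp only [mul_inv_rev, map_mul, map_inv, C₂.equivariant, e.t_comm]
    group)

/-- `(g, h) ↦ g`. -/
def qtgt : e.QAr → e.QOb :=
  Quotient.lift (fun a : G₂ × H₂ => e.mkOb a.1) (by
    rintro ⟨g, h⟩ _ ⟨k, m, rfl⟩
    exact e.mkOb_eq.2 ⟨k, rfl⟩)

/-- `g ↦ (g, 1)`. -/
def qone : e.QOb → e.QAr := fun x =>
  Quotient.liftOn' x (fun g => e.mkAr (g, 1)) (by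
    intro g g' h
    obtain ⟨k, rfl⟩ := e.mkOb_eq.1 (Quotient.sound' h : e.mkOb g = e.mkOb g')
    exact e.mkAr_eq.2 ⟨k, 1, by simp⟩)

/-- `(g, h) ↦ (t(h⁻¹) g, h⁻¹)`. -/
def qinv : e.QAr → e.QAr :=
  Quotient.lift (fun a : G₂ × H₂ => e.mkAr (C₂.t a.2⁻¹ * a.1, a.2⁻¹)) (by
    rintro ⟨g, h⟩ _ ⟨k, m, rfl⟩
    refine e.mkAr_eq.2 ⟨C₁.t m⁻¹ * k, m⁻¹, Prod.ext ?_ ?_⟩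
    · simp only [mul_inv_rev, map_mul, map_inv, C₂.equivariant, e.t_comm]
      group
    · simp only [map_mul C₂.act, MulAut.mul_apply, act_t_inv, map_inv e.e₁, map_inv (C₂.act g)]
      group)

/-- Composition, induced by `(g, h) ∘ (t(h⁻¹) g, h') = (g, h h')`. -/
def qcomp (a b : e.QAr) (_ : e.qsrc a = e.qtgt b) : e.QAr :=
  e.mkAr ((Quotient.out a).1, (Quotient.out a).2 * (Quotient.out b).2)

lemma qcomp_mk {g g' : G₂} {h h' : H₂} (H : e.qsrc (e.mkAr (g, h)) = e.qtgt (e.mkAr (g', h'))) :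
    e.qcomp (e.mkAr (g, h)) (e.mkAr (g', h')) H = e.mkAr (g, h * h') := by
  unfold qcomp
  obtain ⟨k₁, m₁, e₁⟩ := e.mkAr_eq.1 (Quotient.out_eq (e.mkAr (g, h))).symm
  obtain ⟨k₂, m₂, e₂⟩ := e.mkAr_eq.1 (Quotient.out_eq (e.mkAr (g', h'))).symm
  obtain ⟨k, hk⟩ := e.mkOb_eq.1 (H : e.mkOb (C₂.t h⁻¹ * g) = e.mkOb g')
  refine (e.mkAr_eq.2 ⟨k₁, m₁ * C₁.act k m₂, ?_⟩).symm
  rw [e₁, e₂]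
  refine Prod.ext rfl ?_
  replace hk : g' = C₂.t h⁻¹ * g * e.e₀ k := hk
  simp only [hk, map_mul C₂.act, MulAut.mul_apply, act_t_inv, map_mul e.e₁, map_mul (C₂.act g),
    ← e.act_comm]
  group

lemma qsrc_mk (g : G₂) (h : H₂) : e.qsrc (e.mkAr (g, h)) = e.mkOb (C₂.t h⁻¹ * g) := rfl
lemma qtgt_mk (g : G₂) (h : H₂) : e.qtgt (e.mkAr (g, h)) = e.mkOb g := rfl
lemma qone_mk (g : G₂) : e.qone (e.mkOb g) = e.mkAr (g, 1) := rfl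
lemma qinv_mk (g : G₂) (h : H₂) :
    e.qinv (e.mkAr (g, h)) = e.mkAr (C₂.t h⁻¹ * g, h⁻¹) := rfl

lemma exists_mk (a : e.QAr) : ∃ g h, a = e.mkAr (g, h) := by
  obtain ⟨⟨g, h⟩, rfl⟩ := e.mkAr_surjective a
  exact ⟨g, h, rfl⟩

/-- The quotient groupoid of the 2-group of `C₂` by that of `C₁`. -/
def quotientGroupoid : Grpd e.QOb e.QAr where
  src := e.qsrc
  tgt := e.qtgt
  one := e.qone
  inv := e.qinv
  comp := e.qcomp
  src_one x := by
    obtain ⟨g, rfl⟩ := e.mkOb_surjective x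
    simp [qone_mk, qsrc_mk]
  tgt_one x := by
    obtain ⟨g, rfl⟩ := e.mkOb_surjective x
    rfl
  src_inv a := by
    obtain ⟨g, h, rfl⟩ := e.exists_mk a
    simp [qinv_mk, qsrc_mk, qtgt_mk]
  tgt_inv a := by
    obtain ⟨g, h, rfl⟩ := e.exists_mk a
    rfl
  src_comp a b H := by
    obtain ⟨g, h, rfl⟩ := e.exists_mk a
    obtain ⟨g', h', rfl⟩ := e.exists_mk b
    obtain ⟨k, hk⟩ := e.mkOb_eq.1 (H : e.mkOb (C₂.t h⁻¹ * g) = e.mkOb g')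
    rw [qcomp_mk, qsrc_mk, qsrc_mk]
    replace hk : g' = C₂.t h⁻¹ * g * e.e₀ k := hk
    exact e.mkOb_eq.2 ⟨k, by rw [hk]; simp [mul_assoc]⟩
  tgt_comp a b H := by
    obtain ⟨g, h, rfl⟩ := e.exists_mk a
    obtain ⟨g', h', rfl⟩ := e.exists_mk b
    rw [qcomp_mk]; rfl
  comp_assoc a b c h₁ h₂ h₃ h₄ := by
    obtain ⟨ga, a, rfl⟩ := e.exists_mk a
    obtain ⟨gb, b, rfl⟩ := e.exists_mk b
    obtain ⟨gc, c, rfl⟩ := e.exists_mk c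
    simp only [qcomp_mk, mul_assoc]
  one_comp a H := by
    obtain ⟨g, h, rfl⟩ := e.exists_mk a
    simp only [qtgt_mk, qone_mk, qcomp_mk, one_mul]
  comp_one a H := by
    obtain ⟨g, h, rfl⟩ := e.exists_mk a
    simp only [qsrc_mk, qone_mk, qcomp_mk, mul_one]
  inv_comp a H := by
    obtain ⟨g, h, rfl⟩ := e.exists_mk a
    simp only [qsrc_mk, qone_mk, qinv_mk, qcomp_mk, inv_mul_cancel]
  comp_inv a H := by
    obtain ⟨g, h, rfl⟩ := e.exists_mk a
    simp only [qtgt_mk, qone_mk, qinv_mk, qcomp_mk, mul_inv_cancel]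

/-- The smooth structure of the objects of the quotient groupoid. -/
instance [DiffeologicalSpace G₂] : DiffeologicalSpace e.QOb :=
  quotientDiffeology e.mkOb e.mkOb_surjective

/-- The smooth structure of the arrows of the quotient groupoid. -/
instance [DiffeologicalSpace G₂] [DiffeologicalSpace H₂] : DiffeologicalSpace e.QAr :=
  quotientDiffeology e.mkAr e.mkAr_surjective

end CrossedModule.Hom

end CrossedModules

section StringModel

open unitInterval

variable {A : Type} [NormedRing A] [NormedAlgebra ℝ A] [StarRing A] [StarModule ℝ A]
  [ContinuousStar A] [AlgebraTrace A]

/-- The projection of `ℝ` onto the unit interval. -/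
def prI (t : ℝ) : I := projIcc 0 1 zero_le_one t

/-- A path in the unitary group as a function `ℝ → A`; only its values on `[0,1]` matter. -/
def ext1 (p : I → unitary A) : ℝ → A := fun t => p (prI t)

/-- A map from the square to the unitary group as a function `ℝ² → A`. -/
def ext2 (f : I × I → unitary A) : ℝ × ℝ → A := fun p => f (prI p.1, prI p.2)

/-- A map from the cube to the unitary group as a function `ℝ³ → A`. -/
def ext3 (F : I × I × I → unitary A) : ℝ × ℝ × ℝ → A := fun p => F (prI p.1, prI p.2.1, prI p.2.2)

lemma prI_of_mem {t : ℝ} (ht : t ∈ Icc (0 : ℝ) 1) : prI t = ⟨t, ht⟩ := projIcc_of_mem _ ht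
@[simp] lemma prI_zero : prI 0 = 0 := projIcc_left _
@[simp] lemma prI_one : prI 1 = 1 := projIcc_right _

lemma smU_of {E X : Type*} [NormedAddCommGroup E] [NormedSpace ℝ E] {S : Set E}
    {q : E → X} {f : X → unitary A} (h : ContDiffOn ℝ ∞ (fun p => (f (q p) : A)) S) :
    SmU S (fun p => (f (q p) : A)) :=
  ⟨h, fun _ _ => Unitary.coe_star_mul_self _, fun _ _ => Unitary.coe_mul_star_self _⟩

/-- The path group `P₀Γ` of smooth paths in `Γ` starting at the unit. -/
def pathSubgroup (Γ : Subgroup (unitary A)) : Subgroup (I → unitary A) where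
  carrier := {p | ContDiffOn ℝ ∞ (ext1 p) (Icc 0 1) ∧ p 0 = 1 ∧ ∀ t, p t ∈ Γ}
  mul_mem' {p q} hp hq := ⟨((smU_of hp.1).mul (smU_of hq.1)).sm,
    by simp [hp.2.1, hq.2.1], fun t => Γ.mul_mem (hp.2.2 t) (hq.2.2 t)⟩
  one_mem' := ⟨contDiffOn_const, rfl, fun _ => Γ.one_mem⟩
  inv_mem' {p} hp := ⟨(smU_of hp.1).star.sm, by simp [hp.2.1], fun t => Γ.inv_mem (hp.2.2 t)⟩

/-- The group `P₀L₀Γ` of smooth paths `s ↦ f(s, ·)` of based loops in `Γ` (the loops are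
smooth on `[0,1]`), starting at the constant loop. -/
def pathLoopSubgroup (Γ : Subgroup (unitary A)) : Subgroup (I × I → unitary A) where
  carrier := {f | ContDiffOn ℝ ∞ (ext2 f) uSq ∧ (∀ r, f (0, r) = 1) ∧ (∀ s, f (s, 0) = 1) ∧
    (∀ s, f (s, 1) = 1) ∧ ∀ p, f p ∈ Γ}
  mul_mem' {f g} hf hg := ⟨((smU_of hf.1).mul (smU_of hg.1)).sm,
    fun r => by simp [hf.2.1, hg.2.1], fun s => by simp [hf.2.2.1, hg.2.2.1],
    fun s => by simp [hf.2.2.2.1, hg.2.2.2.1], fun p => Γ.mul_mem (hf.2.2.2.2 p) (hg.2.2.2.2 p)⟩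
  one_mem' := ⟨contDiffOn_const, fun _ => rfl, fun _ => rfl, fun _ => rfl, fun _ => Γ.one_mem⟩
  inv_mem' {f} hf := ⟨(smU_of hf.1).star.sm,
    fun r => by simp [hf.2.1], fun s => by simp [hf.2.2.1],
    fun s => by simp [hf.2.2.2.1], fun p => Γ.inv_mem (hf.2.2.2.2 p)⟩

/-- The path group `P₀Γ`. -/
def P0 (Γ : Subgroup (unitary A)) : Type := pathSubgroup Γ

/-- The group `P₀L₀Γ`. -/
def P0L0 (Γ : Subgroup (unitary A)) : Type := pathLoopSubgroup Γ

instance (Γ : Subgroup (unitary A)) : Group (P0 Γ) := inferInstanceAs (Group (pathSubgroup Γ))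
instance (Γ : Subgroup (unitary A)) : Group (P0L0 Γ) :=
  inferInstanceAs (Group (pathLoopSubgroup Γ))

variable {Γ : Subgroup (unitary A)}

/-- A based path as a function `ℝ → A`. -/
def P0.ev (p : P0 Γ) : ℝ → A := ext1 p.1

/-- An element of `P₀L₀Γ` as a function `ℝ² → A`. -/
def P0L0.ev (f : P0L0 Γ) : ℝ × ℝ → A := ext2 f.1

lemma P0.smu (p : P0 Γ) : SmU (Icc (0 : ℝ) 1) p.ev := smU_of p.2.1

lemma P0L0.squ (f : P0L0 Γ) : SqU f.ev :=
  ⟨smU_of f.2.1, fun r _ => by simp [P0L0.ev, ext2, f.2.2.1],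
    fun r _ => by simp [P0L0.ev, ext2, f.2.2.2.1],
    fun r _ => by simp [P0L0.ev, ext2, f.2.2.2.2.1]⟩

lemma P0L0.ev_mul (f g : P0L0 Γ) : (f * g).ev = fun p => f.ev p * g.ev p := rfl
lemma P0L0.ev_inv (f : P0L0 Γ) : (f⁻¹).ev = fun p => star (f.ev p) := rfl
lemma P0L0.ev_one : (1 : P0L0 Γ).ev = fun _ => 1 := rfl
lemma P0.ev_mul (f g : P0 Γ) : (f * g).ev = fun p => f.ev p * g.ev p := rfl
lemma P0.ev_inv (f : P0 Γ) : (f⁻¹).ev = fun p => star (f.ev p) := rfl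
lemma P0.ev_one : (1 : P0 Γ).ev = fun _ => 1 := rfl

lemma P0.ext' {p q : P0 Γ} (h : ∀ t, p.1 t = q.1 t) : p = q := Subtype.ext (funext h)
lemma P0L0.ext' {p q : P0L0 Γ} (h : ∀ t, p.1 t = q.1 t) : p = q := Subtype.ext (funext h)

instance instDiffeologyP0 : DiffeologicalSpace (P0 Γ) :=
  functionalDiffeology (Icc (0 : ℝ) 1) P0.ev fun p => p.smu.sm

instance instDiffeologyP0L0 : DiffeologicalSpace (P0L0 Γ) :=
  functionalDiffeology uSq P0L0.ev fun p => p.squ.smu.sm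

/-- `exp(i x / 2π)`. -/
def ph (x : ℝ) : Circle := Circle.exp (x / (2 * Real.pi))

lemma ph_add (x y : ℝ) : ph (x + y) = ph x * ph y := by
  unfold ph; rw [add_div, Circle.exp_add]
lemma ph_neg (x : ℝ) : ph (-x) = (ph x)⁻¹ := by
  unfold ph; rw [neg_div, Circle.exp_neg]
lemma ph_zero : ph 0 = 1 := by unfold ph; simp

variable (Γ) in
/-- The set `P₀L₀Γ × U(1)`, underlying the extended group. -/
@[ext] structure Ext where
  path : P0L0 Γ
  phase : Circle

/-- The cocycle `c(f,g) = exp(-(i/2π) ∫∫ ⟨f⁻¹ ∂ₛ f, ∂ᵣ g g⁻¹⟩ ds dr)`. -/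
def cocycle (f g : P0L0 Γ) : Circle := ph (-rawJ f.ev g.ev)

lemma cocycle_assoc (f g h : P0L0 Γ) :
    cocycle (f * g) h * cocycle f g = cocycle f (g * h) * cocycle g h := by
  unfold cocycle
  rw [← ph_add, ← ph_add, P0L0.ev_mul, P0L0.ev_mul]
  have := rawJ_assoc f.squ.smu g.squ.smu h.squ.smu
  congr 1; linarith

lemma cocycle_one_left (f : P0L0 Γ) : cocycle 1 f = 1 := by
  unfold cocycle; rw [P0L0.ev_one, rawJ_one_left, neg_zero, ph_zero]

lemma cocycle_one_right (f : P0L0 Γ) : cocycle f 1 = 1 := by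
  unfold cocycle; rw [P0L0.ev_one, rawJ_one_right, neg_zero, ph_zero]

lemma cocycle_inv (f : P0L0 Γ) : cocycle f⁻¹ f = cocycle f f⁻¹ := by
  unfold cocycle; rw [P0L0.ev_inv, rawJ_inv f.squ.smu]

namespace Ext

/-- `(f₁, z₁)(f₂, z₂) = (f₁ f₂, z₁ z₂ c(f₁, f₂))`. -/
instance : Mul (Ext Γ) := ⟨fun a b => ⟨a.path * b.path, a.phase * b.phase * cocycle a.path b.path⟩⟩
instance : One (Ext Γ) := ⟨⟨1, 1⟩⟩
instance : Inv (Ext Γ) := ⟨fun a => ⟨a.path⁻¹, (a.phase * cocycle a.path⁻¹ a.path)⁻¹⟩⟩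

lemma mul_path (a b : Ext Γ) : (a * b).path = a.path * b.path := rfl
lemma mul_phase (a b : Ext Γ) :
    (a * b).phase = a.phase * b.phase * cocycle a.path b.path := rfl
lemma one_path : (1 : Ext Γ).path = 1 := rfl
lemma one_phase : (1 : Ext Γ).phase = 1 := rfl
lemma inv_path (a : Ext Γ) : (a⁻¹).path = a.path⁻¹ := rfl
lemma inv_phase (a : Ext Γ) : (a⁻¹).phase = (a.phase * cocycle a.path⁻¹ a.path)⁻¹ := rfl

instance : Group (Ext Γ) where
  mul_assoc a b c := by
    refine Ext.ext (mul_assoc _ _ _) ?_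
    simp only [mul_phase, mul_path]
    have := cocycle_assoc a.path b.path c.path
    calc _ = a.phase * b.phase * c.phase
          * (cocycle (a.path * b.path) c.path * cocycle a.path b.path) := by
            simp only [mul_assoc, mul_comm, mul_left_comm]
      _ = _ := by rw [this]; simp only [mul_assoc, mul_comm, mul_left_comm]
  one_mul a := Ext.ext (one_mul _) (by
    rw [mul_phase, one_path, one_phase, cocycle_one_left, one_mul, mul_one])
  mul_one a := Ext.ext (mul_one _) (by
    rw [mul_phase, one_path, one_phase, cocycle_one_right, mul_one, mul_one])
  inv_mul_cancel a := Ext.ext (inv_mul_cancel _) (by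
    rw [mul_phase, inv_path, inv_phase, one_phase, mul_assoc, inv_mul_cancel])

end Ext

/-- `F` is a smooth disc (contraction) `t ↦ F(t, ·)` in `L₀L₀Γ` from the constant loop to `f`. -/
structure IsDisc (F : I × I × I → unitary A) (f : P0L0 Γ) : Prop where
  sm : ContDiffOn ℝ ∞ (ext3 F) uCb
  mem : ∀ p, F p ∈ Γ
  s0 : ∀ t r, F (t, 0, r) = 1
  s1 : ∀ t r, F (t, 1, r) = 1
  r0 : ∀ t s, F (t, s, 0) = 1
  r1 : ∀ t s, F (t, s, 1) = 1
  t0 : ∀ p, F (0, p) = 1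
  t1 : ∀ p, F (1, p) = f.1 p

namespace IsDisc

variable {F G : I × I × I → unitary A} {f g : P0L0 Γ}

lemma curve (h : IsDisc F f) : CurveU (ext3 F) :=
  ⟨smU_of h.sm, fun _ _ _ _ => by simp [ext3, h.s0], fun _ _ _ _ => by simp [ext3, h.r0],
    fun _ _ _ _ => by simp [ext3, h.r1]⟩

lemma ext_zero (h : IsDisc F f) (q : ℝ × ℝ) : ext3 F (0, q) = 1 := by simp [ext3, h.t0]
lemma ext_one (h : IsDisc F f) (q : ℝ × ℝ) : ext3 F (1, q) = f.ev q := by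
  simp [ext3, h.t1, P0L0.ev, ext2]
lemma ext_s (h : IsDisc F f) (t r : ℝ) : ext3 F (t, 1, r) = 1 := by simp [ext3, h.s1]

lemma mul (hF : IsDisc F f) (hG : IsDisc G g) : IsDisc (F * G) (f * g) where
  sm := (hF.curve.mul hG.curve).smu.sm
  mem p := Γ.mul_mem (hF.mem p) (hG.mem p)
  s0 t r := by simp [hF.s0, hG.s0]
  s1 t r := by simp [hF.s1, hG.s1]
  r0 t r := by simp [hF.r0, hG.r0]
  r1 t r := by simp [hF.r1, hG.r1]
  t0 t := by simp [hF.t0, hG.t0]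
  t1 t := by simp only [Pi.mul_apply, hF.t1, hG.t1]; rfl

lemma inv (hF : IsDisc F f) : IsDisc F⁻¹ f⁻¹ where
  sm := hF.curve.star.smu.sm
  mem p := Γ.inv_mem (hF.mem p)
  s0 t r := by simp [hF.s0]
  s1 t r := by simp [hF.s1]
  r0 t r := by simp [hF.r0]
  r1 t r := by simp [hF.r1]
  t0 t := by simp [hF.t0]
  t1 t := by simp only [Pi.inv_apply, hF.t1]; rfl

lemma one : IsDisc (1 : I × I × I → unitary A) (1 : P0L0 Γ) :=
  ⟨contDiffOn_const, fun _ => Γ.one_mem, fun _ _ => rfl, fun _ _ => rfl, fun _ _ => rfl,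
    fun _ _ => rfl, fun _ => rfl, fun _ => rfl⟩

lemma rawW_mul (hF : IsDisc F f) (hG : IsDisc G g) :
    rawW (ext3 (F * G)) = rawW (ext3 F) + rawW (ext3 G) - rawJ f.ev g.ev := by
  have e := stokes_mul hF.curve hG.curve
  rw [rawB_zero hF.curve (fun _ => 1) (fun t _ r _ => hF.ext_s t r)] at e
  simp only [hF.ext_zero, hG.ext_zero, hF.ext_one, hG.ext_one, rawJ_one_left] at e
  have e2 : ext3 (F * G) = fun p => ext3 F p * ext3 G p := rfl
  rw [e2, e]
  ring

lemma rawW_inv (hF : IsDisc F f) :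
    rawW (ext3 F⁻¹) = - rawW (ext3 F) + rawJ (f⁻¹).ev f.ev := by
  have e := hF.inv.rawW_mul hF
  rw [inv_mul_cancel] at e
  have e2 : ext3 (1 : I × I × I → unitary A) = fun _ => 1 := rfl
  rw [e2, rawW_one] at e
  linarith

/-- Conjugation by a path of loops. -/
lemma conj (hF : IsDisc F f) (g : P0L0 Γ) :
    IsDisc (fun p => g.1 p.2 * F p * (g.1 p.2)⁻¹) (g * f * g⁻¹) where
  sm := ((g.squ.curve.mul hF.curve).mul g.squ.curve.star).smu.sm
  mem p := Γ.mul_mem (Γ.mul_mem (g.2.2.2.2.2 _) (hF.mem p)) (Γ.inv_mem (g.2.2.2.2.2 _))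
  s0 t r := by simp [hF.s0]
  s1 t r := by simp [hF.s1]
  r0 t r := by simp [hF.r0]
  r1 t r := by simp [hF.r1]
  t0 t := by simp [hF.t0]
  t1 t := by simp only [hF.t1]; rfl

lemma rawW_conj (hF : IsDisc F f) (g : P0L0 Γ) :
    rawW (ext3 (fun p => g.1 p.2 * F p * (g.1 p.2)⁻¹)) = rawW (ext3 F)
      - rawJ g.ev f.ev - rawJ (g * f).ev (g⁻¹).ev + rawJ g.ev (g⁻¹).ev := by
  have e := rawW_conj_sq g.squ hF.curve hF.ext_zero
  have hB : rawB (fun p : ℝ × ℝ × ℝ => g.ev p.2 * ext3 F p) (fun p => star (g.ev p.2)) = 0 :=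
    rawB_zero (g.squ.curve.mul hF.curve) (fun r => g.ev (1, r)) fun t _ r _ => by
      simp only [hF.ext_s, mul_one]
  rw [hB, add_zero] at e
  simp only [hF.ext_one] at e
  exact e

end IsDisc

variable (Γ) in
/-- The subgroup `N` of the pairs `(f, z)` where `f ∈ L₀L₀Γ` is a loop and `z = exp ∫_D ω` for a
disc `D = F` in `L₀L₀Γ` with boundary `f`. Here `ω(β₁, β₂) = (i/2π) ∫ ⟨β₁, ∂ᵣ β₂⟩ dr` is the
left-invariant 2-form on `L₀Γ`, so that
`∫_D ω = (i/2π) ∫∫∫ ⟨F⁻¹ ∂ₜ F, ∂ᵣ (F⁻¹ ∂ₛ F)⟩ dr ds dt`. -/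
def N : Subgroup (Ext Γ) where
  carrier := {a | ∃ F, IsDisc F a.path ∧ a.phase = ph (rawW (ext3 F))}
  mul_mem' := by
    rintro a b ⟨F, hF, hz⟩ ⟨G, hG, hw⟩
    refine ⟨F * G, hF.mul hG, ?_⟩
    rw [hF.rawW_mul hG, Ext.mul_phase, hz, hw, sub_eq_add_neg, ph_add, ph_add]
    rfl
  one_mem' := ⟨1, IsDisc.one, by
    have e2 : ext3 (1 : I × I × I → unitary A) = fun _ => 1 := rfl
    rw [e2, rawW_one, ph_zero]; rfl⟩
  inv_mem' := by
    rintro a ⟨F, hF, hz⟩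
    refine ⟨F⁻¹, hF.inv, ?_⟩
    rw [hF.rawW_inv, Ext.inv_phase, hz, ph_add, ph_neg, mul_inv]
    unfold cocycle
    rw [ph_neg, inv_inv]

instance : (N Γ).Normal where
  conj_mem := by
    rintro a ⟨F, hF, hz⟩ b
    refine ⟨_, hF.conj b.path, ?_⟩
    rw [hF.rawW_conj, Ext.mul_phase, Ext.mul_phase, Ext.inv_phase, Ext.inv_path, Ext.mul_path,
      cocycle_inv, hz]
    unfold cocycle
    rw [sub_eq_add_neg, sub_eq_add_neg, ph_add, ph_add, ph_add, ph_neg, ph_neg, ph_neg, mul_inv,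
      inv_inv]
    rw [mul_comm b.phase]
    simp only [mul_assoc]
    congr 1
    rw [mul_left_comm b.phase, mul_left_comm b.phase, inv_mul_cancel_left]
    simp only [mul_comm]

variable (Γ) in
/-- The central extension `(P₀L₀Γ × U(1))/N` of the based loop group. -/
def LHat : Type := Ext Γ ⧸ N Γ

instance : Group (LHat Γ) := inferInstanceAs (Group (Ext Γ ⧸ N Γ))

/-- The quotient map. -/
def LHat.mk : Ext Γ →* LHat Γ := QuotientGroup.mk' (N Γ)

lemma LHat.mk_surjective : Function.Surjective (LHat.mk (Γ := Γ)) := QuotientGroup.mk'_surjective _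

instance instDiffeologyExt : DiffeologicalSpace (Ext Γ) :=
  inducedDiffeology (fun a : Ext Γ => (a.path, a.phase))

instance instDiffeologyLHat : DiffeologicalSpace (LHat Γ) :=
  quotientDiffeology LHat.mk LHat.mk_surjective

end StringModel

section StringCrossedModule

open unitInterval

variable {A : Type} [NormedRing A] [NormedAlgebra ℝ A] [StarRing A] [StarModule ℝ A]
  [ContinuousStar A] [AlgebraTrace A] {Γ : Subgroup (unitary A)}

/-- `(g f g⁻¹)(s, r) = g(r) f(s, r) g(r)⁻¹` for a path `g`. -/
def conjP (g : P0 Γ) (f : P0L0 Γ) : P0L0 Γ :=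
  ⟨fun p => g.1 p.2 * f.1 p * (g.1 p.2)⁻¹, (g.smu.conj2 f.squ.smu).sm,
    fun r => by simp [f.2.2.1], fun s => by simp [f.2.2.2.1], fun s => by simp [f.2.2.2.2.1],
    fun p => Γ.mul_mem (Γ.mul_mem (g.2.2.2 _) (f.2.2.2.2.2 _)) (Γ.inv_mem (g.2.2.2 _))⟩

lemma conjP_ev (g : P0 Γ) (f : P0L0 Γ) :
    (conjP g f).ev = fun p => g.ev p.2 * f.ev p * star (g.ev p.2) := rfl

lemma conjP_mul (g : P0 Γ) (f f' : P0L0 Γ) : conjP g (f * f') = conjP g f * conjP g f' :=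
  P0L0.ext' fun p => by
    show g.1 p.2 * (f.1 p * f'.1 p) * (g.1 p.2)⁻¹
      = (g.1 p.2 * f.1 p * (g.1 p.2)⁻¹) * (g.1 p.2 * f'.1 p * (g.1 p.2)⁻¹)
    group

lemma conjP_comp (g g' : P0 Γ) (f : P0L0 Γ) : conjP (g * g') f = conjP g (conjP g' f) :=
  P0L0.ext' fun p => by
    show (g.1 p.2 * g'.1 p.2) * f.1 p * (g.1 p.2 * g'.1 p.2)⁻¹
      = g.1 p.2 * (g'.1 p.2 * f.1 p * (g'.1 p.2)⁻¹) * (g.1 p.2)⁻¹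
    group

lemma conjP_one (f : P0L0 Γ) : conjP 1 f = f :=
  P0L0.ext' fun p => by
    show 1 * f.1 p * 1⁻¹ = f.1 p
    group

/-- The action `g ▷ (f, z) = (g f g⁻¹, z exp((i/2π) ∫∫ ⟨f⁻¹ ∂ₛ f, g⁻¹ ∂ᵣ g⟩ ds dr))`. -/
def extAct (g : P0 Γ) : Ext Γ →* Ext Γ where
  toFun a := ⟨conjP g a.path, a.phase * ph (rawX g.ev a.path.ev)⟩
  map_one' := Ext.ext (by
      show conjP g 1 = 1
      have h := conjP_mul g 1 1
      rw [one_mul] at h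
      exact mul_eq_left.1 h.symm)
    (by
      show 1 * ph (rawX g.ev (1 : P0L0 Γ).ev) = 1
      rw [P0L0.ev_one, rawX_one_right, ph_zero, one_mul])
  map_mul' a b := Ext.ext (conjP_mul _ _ _) (by
    simp only [Ext.mul_phase, Ext.mul_path]
    have h := rawX_mul g.smu a.path.squ.smu b.path.squ.smu
    have h2 : ph (rawX g.ev (a.path * b.path).ev)
        = ph (rawX g.ev a.path.ev) * ph (rawX g.ev b.path.ev)
          * cocycle (conjP g a.path) (conjP g b.path) * (cocycle a.path b.path)⁻¹ := by
      unfold cocycle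
      rw [← ph_neg, ← ph_add, ← ph_add, ← ph_add, P0L0.ev_mul, conjP_ev, conjP_ev]
      congr 1; linarith
    rw [h2]
    calc _ = (cocycle a.path b.path * (cocycle a.path b.path)⁻¹) * (a.phase * b.phase
          * (ph (rawX g.ev a.path.ev) * ph (rawX g.ev b.path.ev)
            * cocycle (conjP g a.path) (conjP g b.path))) := by
          simp only [mul_assoc, mul_comm, mul_left_comm]
      _ = _ := by
          rw [mul_inv_cancel, one_mul]
          simp only [mul_assoc, mul_comm, mul_left_comm])

lemma extAct_comp (g g' : P0 Γ) (a : Ext Γ) : extAct (g * g') a = extAct g (extAct g' a) :=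
  Ext.ext (conjP_comp _ _ _) (by
    show a.phase * ph (rawX (g * g').ev a.path.ev)
      = a.phase * ph (rawX g'.ev a.path.ev) * ph (rawX g.ev (conjP g' a.path).ev)
    rw [P0.ev_mul, rawX_comp g.smu g'.smu a.path.squ.smu, ph_add, mul_assoc, conjP_ev])

lemma extAct_one (a : Ext Γ) : extAct 1 a = a :=
  Ext.ext (conjP_one _) (by
    show a.phase * ph (rawX (1 : P0 Γ).ev a.path.ev) = a.phase
    rw [P0.ev_one, rawX_one_left, ph_zero, mul_one])

lemma IsDisc.conjPath {F : I × I × I → unitary A} {f : P0L0 Γ} (hF : IsDisc F f) (g : P0 Γ) :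
    IsDisc (fun p => g.1 p.2.2 * F p * (g.1 p.2.2)⁻¹) (conjP g f) where
  sm := (hF.curve.conj g.smu).smu.sm
  mem p := Γ.mul_mem (Γ.mul_mem (g.2.2.2 _) (hF.mem p)) (Γ.inv_mem (g.2.2.2 _))
  s0 t r := by simp [hF.s0]
  s1 t r := by simp [hF.s1]
  r0 t r := by simp [hF.r0]
  r1 t r := by simp [hF.r1]
  t0 t := by simp [hF.t0]
  t1 t := by simp only [hF.t1]; rfl

lemma extAct_mem (g : P0 Γ) {a : Ext Γ} (ha : a ∈ N Γ) : extAct g a ∈ N Γ := by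
  obtain ⟨F, hF, hz⟩ := ha
  refine ⟨_, hF.conjPath g, ?_⟩
  have e := stokes_conj g.smu hF.curve
  have hD : rawD g.ev (ext3 F) = 0 := by
    refine setIntegral_eq_zero_of_forall_eq_zero fun p hp => ?_
    rw [mcL_t_zero hF.curve.smu.sm (q := (1, p.2)) ⟨one_mem01, hp.2⟩ (c := 1)
      (fun t _ => hF.ext_s t _) hp.1, ip_zero_left]
  rw [hD] at e
  simp only [hF.ext_zero, hF.ext_one, rawX_one_right, sub_zero] at e
  show a.phase * ph (rawX g.ev a.path.ev) = _
  rw [hz, ← ph_add]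
  exact congrArg ph e.symm

/-- The induced endomorphisms of the central extension. -/
def hatAct (g : P0 Γ) : LHat Γ →* LHat Γ :=
  QuotientGroup.map (N Γ) (N Γ) (extAct g) fun _ ha => extAct_mem g ha

lemma hatAct_mk (g : P0 Γ) (a : Ext Γ) : hatAct g (LHat.mk a) = LHat.mk (extAct g a) := rfl

/-- The action of `P₀Γ` on the central extension of the based loop group. -/
def stringAct : P0 Γ →* MulAut (LHat Γ) where
  toFun g :=
    { toFun := hatAct g
      invFun := hatAct g⁻¹
      left_inv := fun x => by
        obtain ⟨a, rfl⟩ := LHat.mk_surjective x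
        rw [hatAct_mk, hatAct_mk, ← extAct_comp, inv_mul_cancel, extAct_one]
      right_inv := fun x => by
        obtain ⟨a, rfl⟩ := LHat.mk_surjective x
        rw [hatAct_mk, hatAct_mk, ← extAct_comp, mul_inv_cancel, extAct_one]
      map_mul' := map_mul _ }
  map_one' := by
    ext x
    obtain ⟨a, rfl⟩ := LHat.mk_surjective x
    show hatAct 1 (LHat.mk a) = LHat.mk a
    rw [hatAct_mk, extAct_one]
  map_mul' g g' := by
    ext x
    obtain ⟨a, rfl⟩ := LHat.mk_surjective x
    show hatAct (g * g') (LHat.mk a) = hatAct g (hatAct g' (LHat.mk a))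
    rw [hatAct_mk, hatAct_mk, hatAct_mk, extAct_comp]

lemma stringAct_mk (g : P0 Γ) (a : Ext Γ) :
    stringAct g (LHat.mk a) = LHat.mk (extAct g a) := rfl

/-- The endpoint `f(1, ·)` of a path of loops. -/
def endP : P0L0 Γ →* P0 Γ where
  toFun f := ⟨fun r => f.1 (1, r),
    by
      have h : ContDiffOn ℝ ∞ (fun r : ℝ => f.ev (1, r)) (Icc 0 1) :=
        f.squ.smu.sm.comp (contDiff_const.prodMk contDiff_id).contDiffOn
          fun r hr => ⟨one_mem01, hr⟩
      have e : ext1 (fun r => f.1 (1, r)) = fun r : ℝ => f.ev (1, r) := by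
        funext r; simp [ext1, P0L0.ev, ext2]
      rw [e]; exact h,
    f.2.2.2.1 1, fun t => f.2.2.2.2.2 _⟩
  map_one' := rfl
  map_mul' _ _ := rfl

lemma endP_ev (f : P0L0 Γ) (r : ℝ) : f.ev (1, r) = (endP f).ev r := by
  simp only [P0.ev, ext1, P0L0.ev, ext2, prI_one]
  rfl

/-- `(f, z) ↦ f(1, ·)`. -/
def extT : Ext Γ →* P0 Γ where
  toFun a := endP a.path
  map_one' := rfl
  map_mul' _ _ := rfl

/-- `[f, z] ↦ f(1, ·)`. -/
def stringT : LHat Γ →* P0 Γ :=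
  QuotientGroup.lift (N Γ) extT (by
    rintro a ⟨F, hF, -⟩
    refine P0.ext' fun r => ?_
    show a.path.1 (1, r) = 1
    rw [← hF.t1, hF.s1])

lemma stringT_mk (a : Ext Γ) : stringT (LHat.mk a) = endP a.path := rfl

/-- The disc used in the Peiffer identity. -/
def peifferDisc (f g : P0L0 Γ) : I × I × I → unitary A := fun p =>
  (f.1 (1, p.2.2) * g.1 (p.1 * p.2.1, p.2.2) * (f.1 (1, p.2.2))⁻¹)
    * (f.1 p.2 * g.1 (p.1 * p.2.1, p.2.2) * (f.1 p.2)⁻¹)⁻¹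

/-- The contraction `(t, s, r) ↦ g(t s, r)`. -/
def scaleP (g : P0L0 Γ) : I × I × I → unitary A := fun p => g.1 (p.1 * p.2.1, p.2.2)

lemma scaleP_eq (g : P0L0 Γ) {p : ℝ × ℝ × ℝ} (hp : p ∈ uCb) :
    ext3 (scaleP g) p = g.ev (p.1 * p.2.1, p.2.2) := by
  have e : prI p.1 * prI p.2.1 = prI (p.1 * p.2.1) := by
    rw [prI_of_mem hp.1, prI_of_mem hp.2.1, prI_of_mem (mul_mem01 hp.1 hp.2.1)]
    rfl
  simp [ext3, scaleP, P0L0.ev, ext2, e]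

lemma scaleP_curve (g : P0L0 Γ) : CurveU (ext3 (scaleP g)) :=
  ⟨smU_of (by
      refine ContDiffOn.congr (f := fun p : ℝ × ℝ × ℝ => g.ev (p.1 * p.2.1, p.2.2)) ?_
        fun p hp => scaleP_eq g hp
      exact g.squ.smu.sm.comp (by fun_prop) fun p hp => ⟨mul_mem01 hp.1 hp.2.1, hp.2.2⟩),
    fun t _ r _ => by simp [ext3, scaleP, g.2.2.1],
    fun t _ r _ => by simp [ext3, scaleP, g.2.2.2.1],
    fun t _ r _ => by simp [ext3, scaleP, g.2.2.2.2.1]⟩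

lemma peifferDisc_isDisc (f g : P0L0 Γ) :
    IsDisc (peifferDisc f g) (conjP (endP f) g * (f * g * f⁻¹)⁻¹) where
  sm := by
    have h := ((scaleP_curve g).conj (endP f).smu).mul
      ((f.squ.curve.mul (scaleP_curve g)).mul f.squ.curve.star).star
    exact h.smu.sm
  mem p := by
    have h := fun q => f.2.2.2.2.2 q
    have h' := fun q => g.2.2.2.2.2 q
    exact Γ.mul_mem (Γ.mul_mem (Γ.mul_mem (h _) (h' _)) (Γ.inv_mem (h _)))
      (Γ.inv_mem (Γ.mul_mem (Γ.mul_mem (h _) (h' _)) (Γ.inv_mem (h _))))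
  s0 t r := by simp [peifferDisc, g.2.2.1]
  s1 t r := by simp [peifferDisc]
  r0 t r := by simp [peifferDisc, g.2.2.2.1]
  r1 t r := by simp [peifferDisc, g.2.2.2.2.1]
  t0 p := by simp [peifferDisc, g.2.2.1]
  t1 p := by simp only [peifferDisc, one_mul]; rfl

lemma string_peiffer (a b : Ext Γ) :
    LHat.mk (extAct (endP a.path) b) = LHat.mk (a * b * a⁻¹) := by
  rw [← mul_inv_eq_one, ← map_inv, ← map_mul]
  refine (QuotientGroup.eq_one_iff _).2 ⟨_, peifferDisc_isDisc a.path b.path, ?_⟩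
  have e := rawW_peiffer a.path.squ b.path.squ (scaleP_curve b.path)
    (fun p hp => scaleP_eq b.path hp) (endP a.path).smu (endP_ev a.path)
    (fun q => by simp [ext3, scaleP, b.path.2.2.1])
    (fun q => by simp [ext3, scaleP, P0L0.ev, ext2])
  have e' : rawW (ext3 (peifferDisc a.path b.path)) = _ := e
  rw [e']
  set f := a.path
  set g := b.path
  show (b.phase * ph (rawX (endP f).ev g.ev))
      * ((a.phase * b.phase * cocycle f g * (a.phase * cocycle f⁻¹ f)⁻¹
          * cocycle (f * g) f⁻¹) * cocycle (f * g * f⁻¹)⁻¹ (f * g * f⁻¹))⁻¹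
      * cocycle (conjP (endP f) g) (f * g * f⁻¹)⁻¹ = _
  have k : ph (rawX (endP f).ev g.ev + rawJ f.ev g.ev
        + rawJ (fun q => f.ev q * g.ev q) (fun q => star (f.ev q))
        - rawJ f.ev (fun q => star (f.ev q))
        + rawJ (fun q => f.ev q * g.ev q * star (f.ev q))
            (fun q => star (f.ev q * g.ev q * star (f.ev q)))
        - rawJ (fun q => (endP f).ev q.2 * g.ev q * star ((endP f).ev q.2))
            (fun q => star (f.ev q * g.ev q * star (f.ev q))))
      = ph (rawX (endP f).ev g.ev) * (cocycle f g)⁻¹ * (cocycle (f * g) f⁻¹)⁻¹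
        * cocycle f f⁻¹ * (cocycle (f * g * f⁻¹) (f * g * f⁻¹)⁻¹)⁻¹
        * cocycle (conjP (endP f) g) (f * g * f⁻¹)⁻¹ := by
    unfold cocycle
    simp only [← ph_neg, neg_neg, ← ph_add, sub_eq_add_neg]
    rfl
  rw [k, cocycle_inv, cocycle_inv]
  simp only [mul_inv, inv_inv]
  generalize a.phase = x
  generalize b.phase = y
  generalize cocycle f g = c₁
  generalize cocycle f f⁻¹ = c₂
  generalize cocycle (f * g) f⁻¹ = c₃
  generalize cocycle (f * g * f⁻¹) (f * g * f⁻¹)⁻¹ = c₄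
  generalize cocycle (conjP (endP f) g) (f * g * f⁻¹)⁻¹ = c₅
  generalize ph _ = w
  calc _ = (y * y⁻¹) * (x * x⁻¹) * (w * c₁⁻¹ * c₃⁻¹ * c₂ * c₄⁻¹ * c₅) := by
        simp only [mul_assoc, mul_comm, mul_left_comm]
    _ = _ := by rw [mul_inv_cancel, mul_inv_cancel, one_mul, one_mul]

variable (Γ) in
/-- The string 2-group model `String(Γ) = ((P₀L₀Γ × U(1))/N → P₀Γ)`. -/
def stringCM : CrossedModule (LHat Γ) (P0 Γ) where
  t := stringT
  act := stringAct
  equivariant g h := by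
    obtain ⟨a, rfl⟩ := LHat.mk_surjective h
    rw [stringAct_mk, stringT_mk, stringT_mk]
    exact P0.ext' fun r => rfl
  peiffer h k := by
    obtain ⟨a, rfl⟩ := LHat.mk_surjective h
    obtain ⟨b, rfl⟩ := LHat.mk_surjective k
    rw [stringAct_mk, stringT_mk, string_peiffer, map_mul, map_mul, map_inv]

/-! Functoriality for subgroups. -/

variable {Δ : Subgroup (unitary A)}

/-- A path in a subgroup is a path in the group. -/
def incP0 (h : Γ ≤ Δ) : P0 Γ →* P0 Δ where
  toFun p := ⟨p.1, p.2.1, p.2.2.1, fun t => h (p.2.2.2 t)⟩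
  map_one' := rfl
  map_mul' _ _ := rfl

/-- A path of loops in a subgroup is a path of loops in the group. -/
def incP0L0 (h : Γ ≤ Δ) : P0L0 Γ →* P0L0 Δ where
  toFun p := ⟨p.1, p.2.1, p.2.2.1, p.2.2.2.1, p.2.2.2.2.1, fun t => h (p.2.2.2.2.2 t)⟩
  map_one' := rfl
  map_mul' _ _ := rfl

/-- `(f, z) ↦ (f, z)`. -/
def incExt (h : Γ ≤ Δ) : Ext Γ →* Ext Δ where
  toFun a := ⟨incP0L0 h a.path, a.phase⟩
  map_one' := rfl
  map_mul' _ _ := rfl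

lemma incExt_mem (h : Γ ≤ Δ) {a : Ext Γ} (ha : a ∈ N Γ) : incExt h a ∈ N Δ := by
  obtain ⟨F, hF, hz⟩ := ha
  exact ⟨F, ⟨hF.sm, fun p => h (hF.mem p), hF.s0, hF.s1, hF.r0, hF.r1, hF.t0, hF.t1⟩, hz⟩

/-- The morphism of crossed modules `String(Γ) → String(Δ)` induced by a subgroup `Γ ≤ Δ`. -/
def stringInc (h : Γ ≤ Δ) : CrossedModule.Hom (stringCM Γ) (stringCM Δ) where
  e₀ := incP0 h
  e₁ := QuotientGroup.map (N Γ) (N Δ) (incExt h) fun _ ha => incExt_mem h ha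
  t_comm x := by
    obtain ⟨a, rfl⟩ := LHat.mk_surjective x
    rfl
  act_comm g x := by
    obtain ⟨a, rfl⟩ := LHat.mk_surjective x
    rfl

end StringCrossedModule

section Spin

open Quaternion

/-- The algebra of quaternionic `2 × 2` matrices, with the star operation given by conjugate
transposition (and the operator norm of the supremum norm). -/
def MatH : Type := Matrix (Fin 2) (Fin 2) ℍ[ℝ]

instance : NormedRing MatH := Matrix.linftyOpNormedRing (n := Fin 2) (α := ℍ[ℝ])
instance : NormedAlgebra ℝ MatH := Matrix.linftyOpNormedAlgebra (n := Fin 2) (α := ℍ[ℝ])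
instance : StarRing MatH := Matrix.instStarRing (n := Fin 2) (α := ℍ[ℝ])

instance : ContinuousStar MatH :=
  ⟨(continuous_id.matrix_conjTranspose :
    Continuous fun x : Matrix (Fin 2) (Fin 2) ℍ[ℝ] => x.conjTranspose)⟩

instance : FiniteDimensional ℝ MatH :=
  inferInstanceAs (FiniteDimensional ℝ (Matrix (Fin 2) (Fin 2) ℍ[ℝ]))

instance : StarModule ℝ MatH :=
  ⟨fun r x => by
    refine Matrix.ext fun i j => ?_
    show star (r • x j i : ℍ[ℝ]) = r • star (x j i : ℍ[ℝ])
    ext <;> simp⟩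

/-- The matrix `diag(e, f)`. -/
def diagH (e f : ℍ[ℝ]) : MatH := Matrix.diagonal ![e, f]

lemma diagH_mul (e f e' f' : ℍ[ℝ]) : diagH e f * diagH e' f' = diagH (e * e') (f * f') := by
  refine (Matrix.diagonal_mul_diagonal (n := Fin 2) ![e, f] ![e', f']).trans ?_
  refine congrArg Matrix.diagonal (funext fun i => ?_)
  fin_cases i <;> rfl

lemma diagH_one : diagH 1 1 = 1 := by
  refine Eq.trans ?_ (Matrix.diagonal_one (n := Fin 2) (α := ℍ[ℝ]))
  refine congrArg Matrix.diagonal (funext fun i => ?_)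
  fin_cases i <;> rfl

lemma star_diagH (e f : ℍ[ℝ]) : star (diagH e f) = diagH (star e) (star f) := by
  refine (Matrix.diagonal_conjTranspose (n := Fin 2) ![e, f]).trans ?_
  refine congrArg Matrix.diagonal (funext fun i => ?_)
  fin_cases i <;> rfl

/-- The linear form `x ↦ 2 Re tr x`. -/
def traceH : Matrix (Fin 2) (Fin 2) ℍ[ℝ] →ₗ[ℝ] ℝ where
  toFun x := 2 * x.trace.re
  map_add' x y := by rw [Matrix.trace_add, Quaternion.re_add, mul_add]
  map_smul' c x := by
    rw [Matrix.trace_smul, Quaternion.re_smul]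
    simp only [smul_eq_mul, RingHom.id_apply]
    ring

lemma traceH_mul_comm (x y : Matrix (Fin 2) (Fin 2) ℍ[ℝ]) : traceH (x * y) = traceH (y * x) := by
  show 2 * (x * y).trace.re = 2 * (y * x).trace.re
  simp only [Matrix.trace, Matrix.diag, Matrix.mul_apply, Fin.sum_univ_two, Quaternion.re_add,
    Quaternion.re_mul]
  ring

/-- The invariant inner product on `𝔰𝔭(2)` is `⟨x, y⟩ = -2 Re tr (x y)`; the coroot `diag(i, 0)` of
the highest root has length squared `2`. -/
instance : AlgebraTrace MatH where
  tr := LinearMap.toContinuousLinearMap (E := MatH) traceH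
  tr_mul_comm x y := traceH_mul_comm x y

/-- `Spin(5) = Sp(2)`, the group of unitary quaternionic `2 × 2` matrices. -/
def Spin5 : Subgroup (unitary MatH) := ⊤

/-- `Spin(4) = SU(2) × SU(2) ⊂ Spin(5)`: the diagonal matrices `diag(e, f)` in `Sp(2)`. -/
def Spin4 : Subgroup (unitary MatH) where
  carrier := {g | ∃ e f : ℍ[ℝ], (g : MatH) = diagH e f}
  mul_mem' := by
    rintro g g' ⟨e, f, h⟩ ⟨e', f', h'⟩
    exact ⟨e * e', f * f', by rw [Submonoid.coe_mul, h, h', diagH_mul]⟩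
  one_mem' := ⟨1, 1, by rw [OneMemClass.coe_one, diagH_one]⟩
  inv_mem' := by
    rintro g ⟨e, f, h⟩
    refine ⟨star e, star f, ?_⟩
    have e1 : ((g⁻¹ : unitary MatH) : MatH) = star (g : MatH) := rfl
    rw [e1, h, star_diagH]

/-- The morphism of crossed modules `String(4) → String(5)` induced by `Spin(4) ⊂ Spin(5)`. -/
def string4to5 : CrossedModule.Hom (stringCM Spin4) (stringCM Spin5) := stringInc le_top

/-- The quotient groupoid `String(5)/String(4)`. -/
def stringQuotient : Grpd string4to5.QOb string4to5.QAr := string4to5.quotientGroupoid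

/-- The 4-sphere, with its smooth structure as a submanifold of `ℝ⁵`. -/
abbrev S4 : Type := Metric.sphere (0 : EuclideanSpace ℝ (Fin 5)) 1

end Spin

end StringTwoGroup

end

/-! An object is a based path g in Sp(2) modulo based paths of diagonal matrices, and the diagonal
unitary matrices are the stabiliser of the line ℍe₁ in ℍ². So the class of g is the same thing as
the path r ↦ g(r)ℍe₁ of quaternionic lines, encoded by the projections g diag(1,0) g* (`obP`,
`obP_ext`). Lines in ℍ² form ℍP¹ ≅ S⁴; the space of objects is the space of smooth based paths in
S⁴. The local section `sec` of Sp(2) → ℍP¹ shows that the quotient smooth structure is the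
functional one (`isPlot_ob_iff`) and yields affine charts modelled on smooth functions [0,1] → ℍ
vanishing at 0.

The map t takes values in based loops, so the source and target of an arrow are paths in S⁴ with the
same endpoint. Conversely, two paths with a common endpoint are joined by exactly one arrow
(`exists_arrow`, `ar_ext`), and smoothly so in families (`exists_arrows`, `isPlot_ar_iff`). Three
facts are behind this. Based loops in Spin(4) and in Spin(5) contract, so t hits all of them. An
element of the kernel of t is represented by a map of the square trivial on the boundary; it bounds
a disc in Spin(5), so modulo N only a phase remains (`exists_phase`). Finally, phases already come
from String(4) and are divided out. Hence the space of arrows is the fibre product of the endpoint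
map P₀S⁴ → S⁴ with itself.

The contractions are explicit. The Cayley transform centred at a unitary a turns the unitary y for
which a*y has no eigenvalue -1 into a linear space of skew-Hermitian matrices, where straight lines
give a contraction `contr` that fixes 1. Unitary matrices with eigenvalue -1 depend on at most 7
parameters, so a square of matrices excludes a set of centres of dimension at most 9 in the
10-dimensional Sp(2). Hausdorff dimension then supplies a good centre (`exists_inDom_sq`). For a
path in the 6-dimensional Spin(4) the count is 1 + 3 (`exists_inDom_diag`).

The groupoid is thus that of the surjective submersion P₀S⁴ → S⁴, and the endpoint functor to the
discrete groupoid is a weak equivalence. The span uses the groupoid itself as Z, with the identity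
as the other leg. The analytic input is the exponential law `forall_isCk_mkJet_iff`: smooth maps
into the Fréchet space of smooth functions are jointly smooth families. -/

noncomputable section

namespace StringTwoGroup

open Set MeasureTheory Topology Diffeology Asymptotics
open scoped ContDiff unitInterval Quaternion

set_option linter.unusedSectionVars false
set_option linter.unusedVariables false

/-! ### Differentiability of finite order with values in topological vector spaces. -/

section Ck

variable {E F : Type*} [AddCommGroup E] [Module ℝ E] [TopologicalSpace E]
  [AddCommGroup F] [Module ℝ F] [TopologicalSpace F] {n : ℕ}

lemma IsCk.continuous {k : ℕ} {f : Eu n → E} (hf : IsCk k f) : Continuous f := by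
  cases k with
  | zero => exact hf
  | succ k => exact hf.1

/-- The remainder of the composite is the image under L of the remainder of f, and a continuous
linear map is big-O of its argument in the topological-vector-space sense. -/
lemma HasFDerivAt.clm_comp (L : E →L[ℝ] F) {f : Eu n → E} {f' : Eu n →L[ℝ] E} {x : Eu n}
    (hf : HasFDerivAt f f' x) : HasFDerivAt (fun y => L (f y)) (L.comp f') x := by
  rw [hasFDerivAt_iff_isLittleOTVS] at hf ⊢
  refine IsBigOTVS.trans_isLittleOTVS (g := fun x' => f x' - f x - f' (x' - x)) ?_ hf
  exact (L.isBigOTVS_fun_comp (f := fun x' => f x' - f x - f' (x' - x))).congr_left fun y => by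
    simp only [map_sub]; rfl

lemma IsCk.clm_comp (L : E →L[ℝ] F) : ∀ {k : ℕ} {f : Eu n → E}, IsCk k f →
    IsCk k (fun x => L (f x))
  | 0, _, hf => L.continuous.comp hf
  | _ + 1, _, ⟨hc, f', h, h'⟩ => ⟨L.continuous.comp hc, fun x => L.comp (f' x),
      fun x => HasFDerivAt.clm_comp L (h x), fun v => IsCk.clm_comp L (h' v)⟩

lemma IsCk.prodMk [ContinuousSMul ℝ E] [ContinuousSMul ℝ F] : ∀ {k : ℕ} {f : Eu n → E}
    {g : Eu n → F}, IsCk k f → IsCk k g → IsCk k (fun x => (f x, g x))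
  | 0, _, _, hf, hg => Continuous.prodMk hf hg
  | _ + 1, _, _, ⟨hc, f', h, h'⟩, ⟨kc, g', k, k'⟩ =>
    ⟨hc.prodMk kc, fun x => (f' x).prod (g' x), fun x => by
      have h1 := h x
      have h2 := k x
      rw [hasFDerivAt_iff_isLittleOTVS] at h1 h2 ⊢
      exact h1.prodMk h2, fun v => IsCk.prodMk (h' v) (k' v)⟩

lemma isCk_prod [ContinuousSMul ℝ E] [ContinuousSMul ℝ F] {f : Eu n → E × F} :
    (∀ k, IsCk k f) ↔ (∀ k, IsCk k (fun x => (f x).1)) ∧ ∀ k, IsCk k (fun x => (f x).2) :=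
  ⟨fun h => ⟨fun k => (h k).clm_comp (ContinuousLinearMap.fst ℝ E F),
    fun k => (h k).clm_comp (ContinuousLinearMap.snd ℝ E F)⟩,
    fun h k => (h.1 k).prodMk (h.2 k)⟩

/-- The source is finite-dimensional, so smoothness of the derivative can be tested one direction v
at a time, which is what the recursion in `IsCk` does. -/
lemma isCk_iff_contDiff {V : Type*} [NormedAddCommGroup V] [NormedSpace ℝ V] : ∀ {k : ℕ}
    {f : Eu n → V}, IsCk k f ↔ ContDiff ℝ k f
  | 0, f => by
    show Continuous f ↔ _
    simp
  | k + 1, f => by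
    rw [Nat.cast_add, Nat.cast_one, contDiff_succ_iff_fderiv_apply]
    constructor
    · rintro ⟨hc, f', h, h'⟩
      have e : f' = fderiv ℝ f := funext fun x => (h x).fderiv.symm
      refine ⟨fun x => (h x).differentiableAt, fun h => by simp at h, fun v => ?_⟩
      exact e ▸ isCk_iff_contDiff.1 (h' v)
    · rintro ⟨hd, -, h⟩
      exact ⟨hd.continuous, fderiv ℝ f, fun x => (hd x).hasFDerivAt,
        fun v => isCk_iff_contDiff.2 (h v)⟩

lemma forall_isCk_iff {V : Type*} [NormedAddCommGroup V] [NormedSpace ℝ V] {f : Eu n → V} :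
    (∀ k, IsCk k f) ↔ ContDiff ℝ ∞ f := by
  simp_rw [isCk_iff_contDiff]
  exact contDiff_infty.symm

end Ck

/-! ### The Fréchet space of smooth functions on the unit interval. -/

section Jets

variable (V : Type) [NormedAddCommGroup V] [NormedSpace ℝ V]

lemma continuous_prI : Continuous prI := continuous_projIcc (h := zero_le_one)

/-- `f ↦ ∫₀ᵗ f`. -/
def intTo (t : ℝ) : C(I, V) →L[ℝ] V :=
  LinearMap.mkContinuous
    { toFun := fun f => ∫ s in (0 : ℝ)..t, f (prI s)
      map_add' := fun f g => intervalIntegral.integral_add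
        ((f.continuous.comp continuous_prI).intervalIntegrable _ _)
        ((g.continuous.comp continuous_prI).intervalIntegrable _ _)
      map_smul' := fun c f => intervalIntegral.integral_smul _ _ } |t| fun f => by
    have := intervalIntegral.norm_integral_le_of_norm_le_const (a := 0) (b := t) (C := ‖f‖)
      (f := fun s => f (prI s)) fun s _ => f.norm_coe_le_norm _
    simpa [mul_comm] using this

lemma intTo_apply (t : ℝ) (f : C(I, V)) : intTo V t f = ∫ s in (0 : ℝ)..t, f (prI s) := rfl

/-- Smooth functions on `[0,1]` vanishing on `T`, as the sequences of their derivatives. -/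
def Jet (T : Set ℝ) : Submodule ℝ (ℕ → C(I, V)) where
  -- The integral relation says that component k + 1 is the derivative of component k, in a form
  -- that is closed for uniform convergence. The set T will be {0} for coordinates of based paths
  -- and {0, 1} for differences of paths with common ends.
  carrier := {f | (∀ k, ∀ t ∈ Icc (0 : ℝ) 1, f k (prI t) = f k 0 + intTo V t (f (k + 1))) ∧
    ∀ t ∈ T, f 0 (prI t) = 0}
  add_mem' {f g} hf hg := ⟨fun k t ht => by
    simp only [Pi.add_apply, ContinuousMap.add_apply, map_add, hf.1 k t ht, hg.1 k t ht]; abel,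
    fun t ht => by simp [hf.2 t ht, hg.2 t ht]⟩
  zero_mem' := ⟨fun k t ht => by simp, fun t ht => by simp⟩
  smul_mem' c f hf := ⟨fun k t ht => by
    simp only [Pi.smul_apply, ContinuousMap.smul_apply, map_smul, hf.1 k t ht, smul_add],
    fun t ht => by simp [hf.2 t ht]⟩

variable {V} {T : Set ℝ}

/-- All conditions are equations between continuous functions on a countable product of Banach
spaces. Closedness makes the subspace complete, hence Fréchet. -/
lemma Jet.isClosed : IsClosed (Jet V T : Set (ℕ → C(I, V))) := by
  have : (Jet V T : Set (ℕ → C(I, V))) =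
      (⋂ k, ⋂ t ∈ Icc (0 : ℝ) 1, {f | f k (prI t) = f k 0 + intTo V t (f (k + 1))}) ∩
        ⋂ t ∈ T, {f | f 0 (prI t) = 0} := by
    ext f
    simp only [mem_inter_iff, mem_iInter, mem_ofPred_eq]
    rfl
  rw [this]
  have c : ∀ k t, Continuous fun f : ℕ → C(I, V) => f k t := fun k t =>
    (continuous_eval_const t).comp (continuous_apply k)
  refine IsClosed.inter ?_ ?_
  · refine isClosed_iInter fun k => isClosed_iInter fun t => isClosed_iInter fun _ => ?_
    exact isClosed_eq (c _ _) ((c _ _).add ((intTo V t).continuous.comp (continuous_apply _)))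
  · exact isClosed_iInter fun t => isClosed_iInter fun _ => isClosed_eq (c _ _) continuous_const

instance : IsUniformAddGroup (Jet V T) :=
  inferInstanceAs (IsUniformAddGroup (Jet V T).toAddSubgroup)

instance : LocallyConvexSpace ℝ (ℕ → C(I, V)) :=
  LocallyConvexSpace.iInf fun i =>
    LocallyConvexSpace.induced (LinearMap.proj (R := ℝ) (φ := fun _ : ℕ => C(I, V)) i)

instance : LocallyConvexSpace ℝ (Jet V T) :=
  Topology.IsInducing.locallyConvexSpace (f := (Jet V T).subtype) Topology.IsInducing.subtypeVal

variable (V T) in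
/-- The Fréchet space of smooth functions on `[0,1]` vanishing on `T`. -/
@[reducible] def frechetJet [CompleteSpace V] : FrechetSpace where
  carrier := Jet V T
  complete := Jet.isClosed.completeSpace_coe
  metrizable := Filter.comap.isCountablyGenerated _ _

variable (V) in
/-- A Banach space as a Fréchet space. -/
@[reducible] def frechetNormed [CompleteSpace V] : FrechetSpace where
  carrier := V

/-- The product of Fréchet spaces. -/
@[reducible] def FrechetSpace.prod (E F : FrechetSpace) : FrechetSpace :=
  letI := E.isUniformAddGroup
  letI := F.isUniformAddGroup
  letI := E.continuousSMul
  letI := F.continuousSMul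
  letI := E.locallyConvex
  letI := F.locallyConvex
  letI := E.t2
  letI := F.t2
  letI := E.complete
  letI := F.complete
  letI := E.metrizable
  letI := F.metrizable
  { carrier := E × F
    locallyConvex := LocallyConvexSpace.inf
      (LocallyConvexSpace.induced (LinearMap.fst ℝ E F))
      (LocallyConvexSpace.induced (LinearMap.snd ℝ E F)) }

end Jets

/-! ### Smooth families of functions as smooth maps into the jet space. -/

section Jets

variable {V : Type} [NormedAddCommGroup V] [NormedSpace ℝ V] {T : Set ℝ} {n : ℕ}

/-- Restriction of a function to `[0,1]`. -/
def toC (ψ : ℝ → V) : C(I, V) :=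
  open Classical in
  if h : ContinuousOn ψ (Icc 0 1) then ⟨fun t => ψ t, h.domRestrict⟩ else 0

lemma toC_apply {ψ : ℝ → V} (h : ContinuousOn ψ (Icc 0 1)) (t : I) : toC ψ t = ψ t := by
  unfold toC
  rw [dif_pos h]; rfl

lemma toC_congr {ψ χ : ℝ → V} (h : EqOn ψ χ (Icc 0 1)) : toC ψ = toC χ := by
  ext t
  by_cases hc : ContinuousOn ψ (Icc 0 1)
  · rw [toC_apply hc, toC_apply (hc.congr h.symm), h t.2]
  · have hc' : ¬ ContinuousOn χ (Icc 0 1) := fun k => hc (k.congr h)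
    unfold toC
    rw [dif_neg hc, dif_neg hc']

lemma prI_coe (t : I) : prI t = t := projIcc_val _ t

lemma coe_prI {t : ℝ} (ht : t ∈ Icc (0 : ℝ) 1) : ((prI t : I) : ℝ) = t := by
  rw [prI_of_mem ht]

lemma GoodDom.iter_smooth {E : Type*} [NormedAddCommGroup E] [NormedSpace ℝ E] {S : Set E}
    (hS : GoodDom S) {F : E → V} (v : E) (hF : ContDiffOn ℝ ∞ F S) (k : ℕ) :
    ContDiffOn ℝ ∞ ((pd S v)^[k] F) S := by
  induction k with
  | zero => exact hF
  | succ k ih => rw [Function.iterate_succ_apply']; exact hS.pd_smooth v ih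

/-- Provides the relation defining `Jet` for the iterated derivatives of a smooth function. -/
lemma ftc_to [CompleteSpace V] {X : ℝ → V} (hX : ContDiffOn ℝ ∞ X (Icc 0 1)) {t : ℝ} (ht : t ∈ Icc (0 : ℝ) 1) :
    X t = X 0 + intTo V t (toC (pd (Icc (0 : ℝ) 1) 1 X)) := by
  have hc := (GoodDom.Icc01.pd_smooth 1 hX).continuousOn
  have hs : Icc 0 t ⊆ Icc (0 : ℝ) 1 := Icc_subset_Icc_right ht.2
  have e : intTo V t (toC (pd (Icc (0 : ℝ) 1) 1 X))
      = ∫ s in (0 : ℝ)..t, pd (Icc (0 : ℝ) 1) 1 X s := by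
    rw [intTo_apply]
    refine intervalIntegral.integral_congr fun s hs' => ?_
    rw [uIcc_of_le ht.1] at hs'
    simp only [toC_apply hc, coe_prI (hs hs')]
  have hi : IntervalIntegrable (pd (Icc (0 : ℝ) 1) 1 X) volume 0 t := by
    refine ContinuousOn.intervalIntegrable ?_
    rw [uIcc_of_le ht.1]
    exact hc.mono hs
  have hd : ∀ x ∈ Ioo 0 t, HasDerivAt X (pd (Icc (0 : ℝ) 1) 1 X x) x := by
    intro x hx
    have h := ((hX.differentiableOn (by simp)) x
      (hs (Ioo_subset_Icc_self hx))).hasDerivWithinAt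
    exact h.hasDerivAt (Icc_mem_nhds hx.1 (hx.2.trans_le ht.2))
  rw [e, intervalIntegral.integral_eq_sub_of_hasDerivAt_of_le ht.1 (hX.continuousOn.mono hs) hd hi]
  abel

variable (T) in
/-- Smooth functions vanishing on `T`. -/
structure IsJet (w : ℝ → V) : Prop where
  sm : ContDiffOn ℝ ∞ w (Icc 0 1)
  van : ∀ t ∈ T, w (prI t) = 0

variable [CompleteSpace V]

variable (T) in
/-- The jet of a smooth function. -/
def mkJet (w : ℝ → V) : Jet V T :=
  open Classical in
  -- The value 0 for other functions only makes the map total. Coordinates of points in the source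
  -- of a chart satisfy the condition.
  if h : IsJet T w then ⟨fun k => toC ((pd (Icc (0 : ℝ) 1) 1)^[k] w),
    fun k t ht => by
      have hk := GoodDom.Icc01.iter_smooth 1 h.sm k
      have := ftc_to hk ht
      rw [← Function.iterate_succ_apply' (pd (Icc (0 : ℝ) 1) 1)] at this
      simp only [toC_apply hk.continuousOn, coe_prI ht]
      exact this,
    fun t ht => by
      simp only [Function.iterate_zero_apply, toC_apply h.sm.continuousOn]
      exact h.van t ht⟩
  else 0

lemma mkJet_val {w : ℝ → V} (h : IsJet T w) (k : ℕ) :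
    (mkJet T w).1 k = toC ((pd (Icc (0 : ℝ) 1) 1)^[k] w) := by
  unfold mkJet
  rw [dif_pos h]

/-- The function on `ℝ` underlying a jet. -/
def Jet.fn (f : Jet V T) : ℝ → V := fun t => f.1 0 (prI t)

lemma mkJet_fn {w : ℝ → V} (h : IsJet T w) {t : ℝ} (ht : t ∈ Icc (0 : ℝ) 1) :
    Jet.fn (mkJet T w) t = w t := by
  unfold Jet.fn
  rw [mkJet_val h, Function.iterate_zero_apply, toC_apply h.sm.continuousOn, coe_prI ht]

variable (n) in
/-- Parameter space times the unit interval. -/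
abbrev strip : Set (Eu n × ℝ) := univ ×ˢ Icc (0 : ℝ) 1

lemma goodStrip : GoodDom (strip n) :=
  GoodDom.prod ⟨uniqueDiffOn_univ, by simp⟩ GoodDom.Icc01

lemma strip_slice {ψ : Eu n × ℝ → V} (h : ContDiffOn ℝ ∞ ψ (strip n)) (x : Eu n) :
    ContDiffOn ℝ ∞ (fun t => ψ (x, t)) (Icc 0 1) :=
  h.comp (contDiff_const.prodMk contDiff_id).contDiffOn fun t ht => ⟨trivial, ht⟩

lemma iter_slice {ψ : Eu n × ℝ → V} (h : ContDiffOn ℝ ∞ ψ (strip n)) (x : Eu n) (k : ℕ) :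
    EqOn ((pd (Icc (0 : ℝ) 1) 1)^[k] (fun t => ψ (x, t)))
      (fun t => (pd (strip n) (0, 1))^[k] ψ (x, t)) (Icc 0 1) := by
  induction k with
  | zero => exact fun t _ => rfl
  | succ k ih =>
    intro t ht
    have hk := goodStrip.iter_smooth (0, 1) h k
    rw [Function.iterate_succ_apply', GoodDom.Icc01.pd_congr 1 ih ht]
    simp only [Function.iterate_succ_apply']
    exact goodStrip.pd_comp GoodDom.Icc01 (φ := fun t => (x, t))
      (L := (0 : ℝ →L[ℝ] Eu n).prod (ContinuousLinearMap.id ℝ ℝ)) 1 hk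
      ((hasFDerivAt_const x t).prodMk (hasFDerivAt_id t)) (fun t ht => ⟨trivial, ht⟩) ht

/-- Mixed partial derivatives commute, so the derivative of a family in a parameter direction can be
taken before or after passing to jets. -/
lemma iter_comm {ψ : Eu n × ℝ → V} (h : ContDiffOn ℝ ∞ ψ (strip n)) (v w : Eu n × ℝ) (k : ℕ) :
    EqOn ((pd (strip n) v)^[k] (pd (strip n) w ψ)) (pd (strip n) w ((pd (strip n) v)^[k] ψ))
      (strip n) := by
  induction k with
  | zero => exact fun t _ => rfl
  | succ k ih =>
    intro z hz
    rw [Function.iterate_succ_apply', Function.iterate_succ_apply',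
      goodStrip.pd_congr v ih hz, goodStrip.pd_comm v w (goodStrip.iter_smooth v h k) hz]

/-- Currying: joint continuity on the product with a compact interval is continuity into the sup
norm. -/
lemma toC_family_continuous {ψ : Eu n × ℝ → V} (h : ContinuousOn ψ (strip n)) :
    Continuous fun x => toC (fun t => ψ (x, t)) := by
  have hc : Continuous fun z : Eu n × I => ψ (z.1, z.2) :=
    h.comp_continuous (by fun_prop) fun z => ⟨trivial, z.2.2⟩
  convert (ContinuousMap.curry ⟨_, hc⟩).continuous using 2 with x
  ext t
  exact toC_apply (h.comp (by fun_prop) fun t ht => ⟨trivial, ht⟩) t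

/-- The derivative of a smooth family of functions. -/
def famDeriv (ψ : Eu n × ℝ → V) (h : ContDiffOn ℝ ∞ ψ (strip n)) (x : Eu n) :
    Eu n →L[ℝ] C(I, V) :=
  have hc : ∀ v, ContinuousOn (fun t => pd (strip n) (v, 0) ψ (x, t)) (Icc 0 1) := fun v =>
    (strip_slice (goodStrip.pd_smooth (v, 0) h) x).continuousOn
  LinearMap.toContinuousLinearMap
    { toFun := fun v => toC fun t => pd (strip n) (v, 0) ψ (x, t)
      map_add' := fun v w => by
        ext t
        rw [ContinuousMap.add_apply, toC_apply (hc _), toC_apply (hc _), toC_apply (hc _)]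
        unfold pd
        rw [← map_add, Prod.mk_add_mk, add_zero]
      map_smul' := fun c v => by
        ext t
        rw [RingHom.id_apply, ContinuousMap.smul_apply, toC_apply (hc _), toC_apply (hc _)]
        unfold pd
        rw [← map_smul, Prod.smul_mk, smul_zero] }

lemma famDeriv_apply {ψ : Eu n × ℝ → V} (h : ContDiffOn ℝ ∞ ψ (strip n)) (x v : Eu n) :
    famDeriv ψ h x v = toC fun t => pd (strip n) (v, 0) ψ (x, t) := rfl

/-- The partial derivative D in the parameter is continuous as a map into continuous functions of t.
So one radius δ controls its variation for all t at once, and the mean value inequality bounds the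
remainder uniformly in t. -/
lemma hasFDerivAt_family {ψ : Eu n × ℝ → V} (h : ContDiffOn ℝ ∞ ψ (strip n)) (x : Eu n) :
    HasFDerivAt (fun x => toC (fun t => ψ (x, t))) (famDeriv ψ h x) x := by
  set D : Eu n × ℝ → (Eu n →L[ℝ] V) := fun z =>
    (fderivWithin ℝ ψ (strip n) z).comp (ContinuousLinearMap.inl ℝ (Eu n) ℝ) with hD
  have hDc : ContinuousOn D (strip n) :=
    (((h.fderivWithin (m := ∞) goodStrip.ud (by simp)).continuousOn).clm_comp
      continuousOn_const)
  have hDt : ∀ y, ContinuousOn (fun t => D (y, t)) (Icc 0 1) := fun y =>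
    hDc.comp (by fun_prop) fun t ht => ⟨trivial, ht⟩
  have hG := toC_family_continuous hDc
  have hd : ∀ t ∈ Icc (0 : ℝ) 1, ∀ y, HasFDerivAt (fun y => ψ (y, t)) (D (y, t)) y := by
    intro t ht y
    have h1 := ((h.differentiableOn (by simp)) (y, t) ⟨trivial, ht⟩).hasFDerivWithinAt
    have h2 := h1.comp y (s := univ) (f := fun y => (y, t))
      ((hasFDerivAt_id y).prodMk (hasFDerivAt_const t y)).hasFDerivWithinAt
      (fun y _ => ⟨trivial, ht⟩)
    exact hasFDerivWithinAt_univ.1 h2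
  rw [hasFDerivAt_iff_isLittleO, isLittleO_iff]
  intro ε hε
  obtain ⟨δ, hδ, hb⟩ := Metric.continuous_iff.1 hG x ε hε
  filter_upwards [Metric.ball_mem_nhds x hδ] with y hy
  rw [ContinuousMap.norm_le _ (by positivity)]
  intro t
  have hψ := fun y => (strip_slice h y).continuousOn
  rw [ContinuousMap.sub_apply, ContinuousMap.sub_apply, toC_apply (hψ _), toC_apply (hψ _),
    famDeriv_apply, toC_apply ((strip_slice (goodStrip.pd_smooth _ h) x).continuousOn)]
  refine (convex_ball x δ).norm_image_sub_le_of_norm_hasFDerivWithin_le'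
    (f := fun y => ψ (y, t)) (f' := fun y => D (y, t)) (φ := D (x, t))
    (fun z _ => (hd t t.2 z).hasFDerivWithinAt) (fun z hz => ?_) (Metric.mem_ball_self hδ) hy
  have h1 := ContinuousMap.norm_coe_le_norm
    (toC (fun t => D (z, t)) - toC (fun t => D (x, t))) t
  rw [ContinuousMap.sub_apply, toC_apply (hDt _), toC_apply (hDt _)] at h1
  refine h1.trans ?_
  rw [← dist_eq_norm]
  exact (hb z hz).le

/-- The topology of the jet space is induced from a product, so little-o of the remainder is tested
on each component. -/
lemma hasFDerivAt_jet {f : Eu n → Jet V T} {f' : Eu n →L[ℝ] Jet V T} {x : Eu n}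
    (h : ∀ k, HasFDerivAt (fun x => (f x).1 k)
      ((ContinuousLinearMap.proj (R := ℝ) (φ := fun _ : ℕ => C(I, V)) k).comp
        ((Jet V T).subtypeL.comp f')) x) : HasFDerivAt f f' x := by
  rw [hasFDerivAt_iff_isLittleOTVS]
  refine ((Jet V T).subtypeL.isThetaTVS_comp Topology.IsInducing.subtypeVal).symm.isBigOTVS.trans_isLittleOTVS
    (g := (Jet V T).subtypeL ∘ fun x' => f x' - f x - f' (x' - x)) ?_
  rw [isLittleOTVS_pi]
  intro k
  exact (hasFDerivAt_iff_isLittleOTVS.1 (h k)).congr_left fun y => rfl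

lemma van_pd {ψ : Eu n × ℝ → V} (h : ContDiffOn ℝ ∞ ψ (strip n)) {t : ℝ} (ht : t ∈ Icc (0 : ℝ) 1)
    (h0 : ∀ x, ψ (x, t) = 0) (v x : Eu n) : pd (strip n) (v, 0) ψ (x, t) = 0 := by
  have hu : GoodDom (univ : Set (Eu n)) := ⟨uniqueDiffOn_univ, by simp⟩
  have := goodStrip.pd_comp hu (φ := fun x => (x, t))
      (L := (ContinuousLinearMap.id ℝ (Eu n)).prod (0 : Eu n →L[ℝ] ℝ)) v h (p := x)
      ((hasFDerivAt_id x).prodMk (hasFDerivAt_const t x)) (fun x _ => ⟨trivial, ht⟩) trivial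
  simp only [h0] at this
  rw [hu.pd_const] at this
  exact this.symm

lemma mkJet_family_val {ψ : Eu n × ℝ → V} (h : ContDiffOn ℝ ∞ ψ (strip n))
    (hv : ∀ x, ∀ t ∈ T, ψ (x, prI t) = 0) (x : Eu n) (k : ℕ) :
    (mkJet T (fun t => ψ (x, t))).1 k = toC (fun t => (pd (strip n) (0, 1))^[k] ψ (x, t)) := by
  rw [mkJet_val ⟨strip_slice h x, hv x⟩]
  exact toC_congr (iter_slice h x k)

lemma continuous_mkJet {ψ : Eu n × ℝ → V} (h : ContDiffOn ℝ ∞ ψ (strip n))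
    (hv : ∀ x, ∀ t ∈ T, ψ (x, prI t) = 0) :
    Continuous (fun x => mkJet T (fun t => ψ (x, t))) := by
  refine continuous_induced_rng.2 (continuous_pi fun k => ?_)
  simp only [Function.comp_apply, mkJet_family_val h hv]
  exact toC_family_continuous (goodStrip.iter_smooth _ h k).continuousOn

/-- Induction on k for all families simultaneously. The derivative in the direction v is the family
of jets of ∂ᵥψ, which again satisfies the hypotheses: a function vanishing on T for all parameters
keeps doing so after ∂ᵥ. -/
lemma isCk_mkJet (k : ℕ) : ∀ {ψ : Eu n × ℝ → V}, ContDiffOn ℝ ∞ ψ (strip n) →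
    (∀ x, ∀ t ∈ T, ψ (x, prI t) = 0) → IsCk k (fun x => mkJet T (fun t => ψ (x, t))) := by
  induction k with
  | zero =>
    intro ψ h hv
    exact continuous_mkJet h hv
  | succ k ih =>
    intro ψ h hv
    have hv' : ∀ v x, ∀ t ∈ T, pd (strip n) (v, 0) ψ (x, prI t) = 0 := fun v x t ht =>
      van_pd h (prI t).2 (fun x => hv x t ht) v x
    have key : ∀ x v j, (mkJet T (fun t => pd (strip n) (v, 0) ψ (x, t))).1 j
        = famDeriv ((pd (strip n) (0, 1))^[j] ψ) (goodStrip.iter_smooth _ h j) x v := by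
      intro x v j
      rw [mkJet_family_val (goodStrip.pd_smooth _ h) (hv' v), famDeriv_apply]
      exact toC_congr fun t ht => iter_comm h _ _ j ⟨trivial, ht⟩
    refine ⟨?_, fun x => LinearMap.toContinuousLinearMap
      { toFun := fun v => mkJet T (fun t => pd (strip n) (v, 0) ψ (x, t))
        map_add' := fun v w => Subtype.ext (funext fun j => by
          rw [Submodule.coe_add, Pi.add_apply, key, key, key, map_add])
        map_smul' := fun c v => Subtype.ext (funext fun j => by
          rw [RingHom.id_apply, Submodule.coe_smul, Pi.smul_apply, key, key, map_smul]) },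
      fun x => hasFDerivAt_jet fun j => ?_, fun v => ?_⟩
    · exact continuous_mkJet h hv
    · simp only [mkJet_family_val h hv]
      convert hasFDerivAt_family (goodStrip.iter_smooth (0, 1) h j) x using 1
      ext1 v
      exact key x v j
    · exact ih (goodStrip.pd_smooth _ h) (hv' v)

end Jets

/-! ### The exponential law, and jets as honest functions. -/

section Jets

variable {V : Type} [NormedAddCommGroup V] [NormedSpace ℝ V] [CompleteSpace V] {T : Set ℝ} {n : ℕ}

lemma Jet.hasDerivWithinAt (f : Jet V T) (k : ℕ) {t : ℝ} (ht : t ∈ Icc (0 : ℝ) 1) :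
    HasDerivWithinAt (fun t => f.1 k (prI t)) (f.1 (k + 1) (prI t)) (Icc 0 1) t := by
  have hc : Continuous fun s => f.1 (k + 1) (prI s) :=
    (f.1 (k + 1)).continuous.comp continuous_prI
  have h1 := (intervalIntegral.integral_hasDerivAt_right (hc.intervalIntegrable 0 t)
    (hc.stronglyMeasurableAtFilter _ _) hc.continuousAt).hasDerivWithinAt (s := Icc 0 1)
  exact (h1.const_add (f.1 k 0)).congr (fun s hs => f.2.1 k s hs) (f.2.1 k t ht)

/-- The remainder in (x, t) is the sum of three parts: the variation of t at fixed x, the variation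
of x measured in the sup norm, and the linear term in x evaluated at the moved instead of the
original time. -/
lemma Jet.hasFDerivWithinAt_eval {u : Eu n → Jet V T} {u' : Eu n →L[ℝ] Jet V T} {z : Eu n × ℝ}
    (hz : z ∈ strip n) (h : HasFDerivAt u u' z.1) (k : ℕ) :
    HasFDerivWithinAt (fun y : Eu n × ℝ => (u y.1).1 k (prI y.2))
      ((((ContinuousMap.evalCLM ℝ (prI z.2)).comp
          ((ContinuousLinearMap.proj (R := ℝ) (φ := fun _ : ℕ => C(I, V)) k).comp
            ((Jet V T).subtypeL.comp u'))).comp (ContinuousLinearMap.fst ℝ (Eu n) ℝ))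
        + (ContinuousLinearMap.snd ℝ (Eu n) ℝ).smulRight ((u z.1).1 (k + 1) (prI z.2)))
      (strip n) z := by
  obtain ⟨x, t⟩ := z
  set A : Eu n →L[ℝ] C(I, V) := (ContinuousLinearMap.proj (R := ℝ) (φ := fun _ : ℕ => C(I, V)) k).comp
            ((Jet V T).subtypeL.comp u') with hA
  have hφ : HasFDerivAt (fun y => (u y).1 k) A x := HasFDerivAt.clm_comp
    ((ContinuousLinearMap.proj (R := ℝ) (φ := fun _ : ℕ => C(I, V)) k).comp (Jet V T).subtypeL) h
  have ht := hz.2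
  have h1 : (fun y : Eu n × ℝ => (u x).1 k (prI y.2) - (u x).1 k (prI t)
      - (y.2 - t) • (u x).1 (k + 1) (prI t)) =o[𝓝[strip n] (x, t)] fun y => y - (x, t) := by
    have := (hasDerivWithinAt_iff_isLittleO.1 (Jet.hasDerivWithinAt (u x) k ht)).comp_tendsto
      (k := fun y : Eu n × ℝ => y.2) (l' := 𝓝[strip n] (x, t))
      (tendsto_nhdsWithin_of_tendsto_nhds_of_eventually_within _
        (continuous_snd.continuousAt.mono_left nhdsWithin_le_nhds)
        (Filter.eventually_of_mem self_mem_nhdsWithin fun y hy => hy.2))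
    refine this.trans_isBigO (IsBigO.of_bound 1 (Filter.Eventually.of_forall fun y => ?_))
    simpa using norm_snd_le (y - (x, t))
  have h2 : (fun y : Eu n × ℝ => ((u y.1).1 k - (u x).1 k - A (y.1 - x)) (prI y.2))
      =o[𝓝[strip n] (x, t)] fun y => y - (x, t) := by
    have := ((hasFDerivAt_iff_isLittleO.1 hφ).comp_tendsto
      (k := fun y : Eu n × ℝ => y.1) (l' := 𝓝[strip n] (x, t))
        (continuous_fst.continuousAt.mono_left nhdsWithin_le_nhds))
    refine IsBigO.trans_isLittleO (IsBigO.of_bound 1 (Filter.Eventually.of_forall fun y => ?_))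
      (this.trans_isBigO (IsBigO.of_bound 1 (Filter.Eventually.of_forall fun y => ?_)))
    · rw [one_mul]
      exact ContinuousMap.norm_coe_le_norm _ _
    · simpa using norm_fst_le (y - (x, t))
  have h3 : (fun y : Eu n × ℝ => (A (y.1 - x)) (prI y.2) - (A (y.1 - x)) (prI t))
      =o[𝓝[strip n] (x, t)] fun y => y - (x, t) := by
    -- Since the parameter space is finite-dimensional, pointwise continuity of s ↦ B s is
    -- continuity in operator norm, so B s - B t tends to 0 and the third part is little-o.
    set B : ℝ → Eu n →L[ℝ] V := fun s => (ContinuousMap.evalCLM ℝ (prI s)).comp A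
    have hB : Continuous B := continuous_clm_apply.2 fun v =>
      (A v).continuous.comp continuous_prI
    have hB0 : Filter.Tendsto (fun y : Eu n × ℝ => B y.2 - B t) (𝓝[strip n] (x, t)) (𝓝 0) := by
      have : Continuous fun y : Eu n × ℝ => B y.2 - B t := by fun_prop
      have h0 := this.tendsto (x, t)
      simp only [sub_self] at h0
      exact h0.mono_left nhdsWithin_le_nhds
    have hs : (fun y : Eu n × ℝ => ‖B y.2 - B t‖ * ‖y - (x, t)‖)
        =o[𝓝[strip n] (x, t)] fun y => 1 * ‖y - (x, t)‖ :=
      ((isLittleO_one_iff ℝ).2 (by simpa using hB0.norm)).mul_isBigO (isBigO_refl _ _)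
    simp only [one_mul] at hs
    refine IsBigO.trans_isLittleO (IsBigO.of_bound 1 (Filter.Eventually.of_forall fun y => ?_))
      hs.of_norm_right
    rw [one_mul, norm_mul, norm_norm, norm_norm]
    exact ((B y.2 - B t).le_opNorm (y.1 - x)).trans
      (mul_le_mul_of_nonneg_left (norm_fst_le (y - (x, t))) (norm_nonneg _))
  rw [hasFDerivWithinAt_iff_isLittleO]
  refine ((h1.add h2).add h3).congr_left fun y => ?_
  simp [ContinuousMap.evalCLM, hA]
  abel

/-- Induction on m for all k: the derivative in the direction (v, τ) evaluates component k of the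
derived family plus τ times component k + 1 of the original one. -/
lemma contDiffOn_eval_jet (m : ℕ) : ∀ {u : Eu n → Jet V T}, (∀ j, IsCk j u) → ∀ k,
    ContDiffOn ℝ m (fun z : Eu n × ℝ => (u z.1).1 k (prI z.2)) (strip n) := by
  induction m with
  | zero =>
    intro u hu k
    have h1 : Continuous fun x => (u x).1 k :=
      (continuous_apply k).comp (continuous_subtype_val.comp (hu 0).continuous)
    rw [Nat.cast_zero, contDiffOn_zero]
    refine Continuous.continuousOn ?_
    exact (h1.comp continuous_fst).eval (continuous_prI.comp continuous_snd)
  | succ m ih =>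
    intro u hu k
    have huu := (hu 1).2
    obtain ⟨u', h', h1⟩ := huu
    -- Each order of differentiability comes with its own choice of derivative. After projection to
    -- the normed spaces C(I, V) derivatives are unique, so the choices agree and the derivative
    -- taken at order one has all orders.
    have hall : ∀ v j, IsCk j (fun x => u' x v) := by
      intro v j
      obtain ⟨u'', h'', h2⟩ := (hu (j + 1)).2
      have e : ∀ x, u'' x v = u' x v := by
        intro x
        have a := HasFDerivAt.clm_comp (Jet V T).subtypeL (h' x)
        have b := HasFDerivAt.clm_comp (Jet V T).subtypeL (h'' x)
        refine Subtype.ext (funext fun i => ?_)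
        have a' := HasFDerivAt.clm_comp
          (ContinuousLinearMap.proj (R := ℝ) (φ := fun _ : ℕ => C(I, V)) i) a
        have b' := HasFDerivAt.clm_comp
          (ContinuousLinearMap.proj (R := ℝ) (φ := fun _ : ℕ => C(I, V)) i) b
        exact congrArg (fun L => L v) (b'.unique a')
      have := h2 v
      simpa only [e] using this
    rw [Nat.cast_add, Nat.cast_one,
      contDiffOn_succ_iff_hasFDerivWithinAt_of_uniqueDiffOn goodStrip.ud]
    refine ⟨fun h => by simp at h, _, ?_, fun z hz =>
      Jet.hasFDerivWithinAt_eval hz (h' z.1) k⟩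
    rw [contDiffOn_clm_apply]
    rintro ⟨v, τ⟩
    exact (ih (hall v) k).add ((ih hu (k + 1)).const_smul τ)

/-- The exponential law for smooth families of smooth functions. -/
theorem forall_isCk_mkJet_iff {u : Eu n → ℝ → V} (hu : ∀ x, IsJet T (u x)) :
    (∀ k, IsCk k (fun x => mkJet T (u x)))
      ↔ ContDiffOn ℝ ∞ (fun z : Eu n × ℝ => u z.1 z.2) (strip n) := by
  constructor
  · intro h
    refine contDiffOn_infty.2 fun m => (contDiffOn_eval_jet m h 0).congr fun z hz => ?_
    exact (mkJet_fn (hu z.1) hz.2).symm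
  · intro h k
    exact isCk_mkJet k h fun x => (hu x).van

/-- A single jet is a constant family over the zero-dimensional parameter space. -/
lemma Jet.contDiffOn_fn (f : Jet V T) : ContDiffOn ℝ ∞ (Jet.fn f) (Icc 0 1) := by
  have hc : ∀ k, IsCk k (fun _ : Eu 0 => f) := by
    intro k
    have : ∀ g : Jet V T, IsCk k (fun _ : Eu 0 => g) := by
      induction k with
      | zero => exact fun g => (continuous_const : Continuous fun _ : Eu 0 => g)
      | succ k ih =>
        refine fun g => ⟨continuous_const, fun _ => 0, fun x => ?_, fun v => ih 0⟩
        rw [hasFDerivAt_iff_isLittleOTVS]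
        exact (IsLittleOTVS.zero _ _).congr_left fun y => by simp
    exact this f
  exact contDiffOn_infty.2 fun m => (contDiffOn_eval_jet m hc 0).comp
    (contDiff_const (c := (0 : Eu 0)).prodMk contDiff_id).contDiffOn
    fun t ht => ⟨trivial, ht⟩

lemma Jet.isJet (f : Jet V T) : IsJet T (Jet.fn f) :=
  ⟨Jet.contDiffOn_fn f, fun t ht => by
    unfold Jet.fn
    rw [prI_coe]; exact f.2.2 t ht⟩

/-- A jet is determined by its component 0, since the others are its derivatives. This gives the
right inverse property of all charts. -/
lemma mkJet_eq (f : Jet V T) {w : ℝ → V} (h : EqOn w (Jet.fn f) (Icc 0 1)) : mkJet T w = f := by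
  have hw : IsJet T w := ⟨(Jet.contDiffOn_fn f).congr h, fun t ht => by
    rw [h (prI t).2]; exact (Jet.isJet f).van t ht⟩
  have key : ∀ k, EqOn ((pd (Icc (0 : ℝ) 1) 1)^[k] w) (fun t => f.1 k (prI t)) (Icc 0 1) := by
    intro k
    induction k with
    | zero => exact h
    | succ k ih =>
      intro t ht
      rw [Function.iterate_succ_apply', GoodDom.Icc01.pd_congr 1 ih ht]
      have := (Jet.hasDerivWithinAt f k ht).hasFDerivWithinAt.fderivWithin (GoodDom.Icc01.ud t ht)
      unfold pd
      rw [this]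
      simp
  refine Subtype.ext (funext fun k => ?_)
  rw [mkJet_val hw]
  ext t
  have hc : Continuous fun t => f.1 k (prI t) := (f.1 k).continuous.comp continuous_prI
  rw [toC_congr (key k), toC_apply hc.continuousOn, prI_coe]

end Jets

/-! ### Quaternionic matrices, the Cayley transform and the explicit contraction. -/

section Matrices

instance : CompleteSpace MatH := FiniteDimensional.complete ℝ MatH

instance : ProperSpace MatH := FiniteDimensional.proper_real MatH

/-- The entries of a quaternionic matrix. -/
def ent (i j : Fin 2) : MatH →L[ℝ] ℍ[ℝ] :=
  LinearMap.toContinuousLinearMap (E := MatH)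
    { toFun := fun M : Matrix (Fin 2) (Fin 2) ℍ[ℝ] => M i j
      map_add' := fun _ _ => rfl
      map_smul' := fun _ _ => rfl }

/-- The matrix with given entries. -/
def matL : (ℍ[ℝ] × ℍ[ℝ] × ℍ[ℝ] × ℍ[ℝ]) →L[ℝ] MatH :=
  LinearMap.toContinuousLinearMap
    { toFun := fun p => (!![p.1, p.2.1; p.2.2.1, p.2.2.2] : Matrix (Fin 2) (Fin 2) ℍ[ℝ])
      map_add' := fun p q => by
        refine Matrix.ext (α := ℍ[ℝ]) fun i j => ?_
        fin_cases i <;> fin_cases j <;> rfl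
      map_smul' := fun c p => by
        refine Matrix.ext (α := ℍ[ℝ]) fun i j => ?_
        fin_cases i <;> fin_cases j <;> rfl }

lemma MatH.ext {M N : MatH} (h : ∀ i j, ent i j M = ent i j N) : M = N :=
  Matrix.ext (α := ℍ[ℝ]) h

lemma MatH.ext2 {M N : MatH} (h00 : ent 0 0 M = ent 0 0 N) (h01 : ent 0 1 M = ent 0 1 N)
    (h10 : ent 1 0 M = ent 1 0 N) (h11 : ent 1 1 M = ent 1 1 N) : M = N :=
  MatH.ext fun i j => by fin_cases i <;> fin_cases j <;> assumption

lemma ent_mul (i j : Fin 2) (M N : MatH) :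
    ent i j (M * N) = ent i 0 M * ent 0 j N + ent i 1 M * ent 1 j N :=
  (Matrix.mul_apply (M := (M : Matrix (Fin 2) (Fin 2) ℍ[ℝ])) (N := N)).trans
    (Fin.sum_univ_two _)

lemma ent_star (i j : Fin 2) (M : MatH) : ent i j (star M) = star (ent j i M) := rfl

@[simp] lemma ent_matL00 (p : ℍ[ℝ] × ℍ[ℝ] × ℍ[ℝ] × ℍ[ℝ]) : ent 0 0 (matL p) = p.1 := rfl
@[simp] lemma ent_matL01 (p : ℍ[ℝ] × ℍ[ℝ] × ℍ[ℝ] × ℍ[ℝ]) : ent 0 1 (matL p) = p.2.1 := rfl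
@[simp] lemma ent_matL10 (p : ℍ[ℝ] × ℍ[ℝ] × ℍ[ℝ] × ℍ[ℝ]) : ent 1 0 (matL p) = p.2.2.1 := rfl
@[simp] lemma ent_matL11 (p : ℍ[ℝ] × ℍ[ℝ] × ℍ[ℝ] × ℍ[ℝ]) : ent 1 1 (matL p) = p.2.2.2 := rfl
@[simp] lemma ent_one00 : ent 0 0 (1 : MatH) = 1 := rfl
@[simp] lemma ent_one01 : ent 0 1 (1 : MatH) = 0 := rfl
@[simp] lemma ent_one10 : ent 1 0 (1 : MatH) = 0 := rfl
@[simp] lemma ent_one11 : ent 1 1 (1 : MatH) = 1 := rfl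

lemma diagH_eq (e f : ℍ[ℝ]) : diagH e f = matL (e, 0, 0, f) :=
  MatH.ext2 rfl rfl rfl rfl

lemma star_mul_self_re (q : ℍ[ℝ]) : star q * q = ((‖q‖ ^ 2 : ℝ) : ℍ[ℝ]) := by
  rw [Quaternion.star_mul_self, Quaternion.normSq_eq_norm_mul_self, sq]

lemma self_mul_star_re (q : ℍ[ℝ]) : q * star q = ((‖q‖ ^ 2 : ℝ) : ℍ[ℝ]) := by
  rw [Quaternion.self_mul_star, Quaternion.normSq_eq_norm_mul_self, sq]

lemma eq_zero_of_star_mul_self {M : MatH} (h : star M * M = 0) : M = 0 := by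
  have key : ∀ j, ent 0 j M = 0 ∧ ent 1 j M = 0 := by
    intro j
    have h1 := congrArg (ent j j) h
    rw [ent_mul, ent_star, ent_star, star_mul_self_re, star_mul_self_re, map_zero,
      ← Quaternion.coe_add, ← Quaternion.coe_zero, Quaternion.coe_inj] at h1
    have a := sq_nonneg ‖ent 0 j M‖
    have b := sq_nonneg ‖ent 1 j M‖
    exact ⟨norm_eq_zero.1 (pow_eq_zero_iff two_ne_zero |>.1 (by linarith)),
      norm_eq_zero.1 (pow_eq_zero_iff two_ne_zero |>.1 (by linarith))⟩
  refine MatH.ext2 ?_ ?_ ?_ ?_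
  · exact (key 0).1
  · exact (key 1).1
  · exact (key 0).2
  · exact (key 1).2

/-- In a finite-dimensional algebra injective left multiplication is surjective, which would provide
an inverse. The matrix M plays the role of an eigenvector. -/
lemma exists_mul_eq_zero_of_not_isUnit {x : MatH} (h : ¬ IsUnit x) : ∃ M : MatH, M ≠ 0 ∧ x * M = 0 := by
  by_contra! hc
  have hi : Function.Injective (LinearMap.mulLeft ℝ x) := by
    rw [← LinearMap.ker_eq_bot, LinearMap.ker_eq_bot']
    intro M hM
    by_contra h0
    exact hc M h0 hM
  obtain ⟨y, hy⟩ := (LinearMap.injective_iff_surjective.1 hi) 1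
  have hy' : x * y = 1 := hy
  have h2 : y * x = 1 := hi (by
    show x * (y * x) = x * 1
    rw [← mul_assoc, hy', one_mul, mul_one])
  exact h ⟨⟨x, y, hy', h2⟩, rfl⟩

/-- If 1 + Y kills M, then M = -YM and M*M = -M*YM. The left side is self-adjoint and the right side
is skew, so both vanish. -/
lemma isUnit_one_add_of_skew {Y : MatH} (h : star Y = -Y) : IsUnit (1 + Y) := by
  by_contra hc
  obtain ⟨M, hM, h0⟩ := exists_mul_eq_zero_of_not_isUnit hc
  refine hM (eq_zero_of_star_mul_self ?_)
  have e1 : M = -(Y * M) := by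
    rw [add_mul, one_mul] at h0
    exact eq_neg_of_add_eq_zero_left h0
  have e2 : star M * M = -(star M * (Y * M)) := by
    calc star M * M = star M * -(Y * M) := congrArg (star M * ·) e1
      _ = _ := mul_neg _ _
  have e3 : star M * M = star M * (Y * M) := by
    have := congrArg star e2
    simp only [star_neg, star_mul, star_star, h, mul_neg, neg_mul, neg_neg, mul_assoc] at this
    exact this
  have e4 : star M * M + star M * M = 0 := by
    nth_rewrite 1 [e2]
    rw [e3]; simp
  have : (2 : ℝ) • (star M * M) = 0 := by rw [two_smul, e4]
  exact (smul_eq_zero.1 this).resolve_left two_ne_zero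

/-- The Cayley transform. -/
def cay (y : MatH) : MatH := (1 - y) * Ring.inverse (1 + y)

lemma isUnit_ringInverse' {x : MatH} (h : IsUnit x) : IsUnit (Ring.inverse x) := by
  obtain ⟨u, rfl⟩ := h
  rw [Ring.inverse_unit]; exact u⁻¹.isUnit

lemma one_add_cay {y : MatH} (h : IsUnit (1 + y)) : 1 + cay y = (2 : ℝ) • Ring.inverse (1 + y) := by
  have := Ring.mul_inverse_cancel _ h
  unfold cay
  nth_rewrite 1 [← this]
  rw [← add_mul, two_smul, ← two_mul]
  congr 1
  rw [add_add_sub_cancel]; norm_num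

lemma isUnit_one_add_cay {y : MatH} (h : IsUnit (1 + y)) : IsUnit (1 + cay y) := by
  rw [one_add_cay h]
  exact (isUnit_ringInverse' h).smul (Units.mk0 (2 : ℝ) two_ne_zero)

/-- Being an involution, the transform is both the chart of the unitary group and its inverse. -/
lemma cay_cay {y : MatH} (h : IsUnit (1 + y)) : cay (cay y) = y := by
  have hu := isUnit_one_add_cay h
  have e : cay (cay y) * (1 + cay y) = 1 - cay y := by
    show (1 - cay y) * Ring.inverse (1 + cay y) * (1 + cay y) = _
    rw [mul_assoc, Ring.inverse_mul_cancel _ hu, mul_one]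
  refine hu.mul_right_cancel ?_
  rw [e, one_add_cay h, mul_smul_comm]
  have := Ring.mul_inverse_cancel _ h
  unfold cay
  nth_rewrite 1 [← this]
  rw [← sub_mul, ← smul_mul_assoc]
  congr 1
  rw [two_smul]; abel

lemma star_ringInverse {x : MatH} (h : IsUnit x) : star (Ring.inverse x) = Ring.inverse (star x) := by
  have h1 := congrArg star (Ring.mul_inverse_cancel _ h)
  rw [star_mul, star_one] at h1
  have h2 := Ring.mul_inverse_cancel _ (h.star)
  calc star (Ring.inverse x) = star (Ring.inverse x) * (star x * Ring.inverse (star x)) := by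
        rw [h2, mul_one]
    _ = _ := by rw [← mul_assoc, h1, one_mul]

lemma cay_comm {y : MatH} (h : IsUnit (1 + y)) : cay y = Ring.inverse (1 + y) * (1 - y) := by
  obtain ⟨u, hu⟩ := h
  have c : (1 - y) * (1 + y) = (1 + y) * (1 - y) := by noncomm_ring
  unfold cay
  rw [← hu] at c ⊢
  rw [Ring.inverse_unit, Units.mul_inv_eq_iff_eq_mul, mul_assoc, c, ← mul_assoc, Units.inv_mul,
    one_mul]

lemma star_cay {y : MatH} (h : IsUnit (1 + y)) : star (cay y) = cay (star y) := by
  have h' : IsUnit (1 + star y) := by simpa using h.star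
  rw [cay_comm h']
  unfold cay
  rw [star_mul, star_ringInverse h]
  simp

lemma cay_mul_cay_neg {y : MatH} (h : IsUnit (1 + y)) (h' : IsUnit (1 - y)) :
    cay y * cay (-y) = 1 := by
  have h'' : IsUnit (1 + -y) := by rwa [← sub_eq_add_neg]
  rw [cay_comm h]
  unfold cay
  rw [← sub_eq_add_neg, sub_neg_eq_add, mul_assoc, ← mul_assoc (1 - y)]
  have c : (1 - y) * (1 + y) = (1 + y) * (1 - y) := by noncomm_ring
  rw [c, mul_assoc, Ring.mul_inverse_cancel _ h', mul_one, Ring.inverse_mul_cancel _ h]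

lemma isUnit_one_sub_of_skew {Y : MatH} (h : star Y = -Y) : IsUnit (1 - Y) := by
  rw [sub_eq_add_neg]
  exact isUnit_one_add_of_skew (by rw [star_neg, h])

lemma cay_mem_unitary {Y : MatH} (h : star Y = -Y) : cay Y ∈ unitary MatH := by
  have h1 := isUnit_one_add_of_skew h
  have h2 := isUnit_one_sub_of_skew h
  rw [Unitary.mem_iff, star_cay h1, h]
  refine ⟨?_, cay_mul_cay_neg h1 h2⟩
  have := cay_mul_cay_neg (y := -Y) (by rwa [← sub_eq_add_neg]) (by rwa [sub_neg_eq_add])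
  rwa [neg_neg] at this

/-- Multiplication by 1 + g* on the left and by 1 + g on the right clears both inverses; what
remains follows from g*g = 1. -/
lemma cay_skew {g : MatH} (hg : g ∈ unitary MatH) (h : IsUnit (1 + g)) :
    star (cay g) = - cay g := by
  obtain ⟨h1, h2⟩ := Unitary.mem_iff.1 hg
  have h' : IsUnit (1 + star g) := by simpa using h.star
  rw [star_cay h, cay_comm h']
  refine h'.mul_left_cancel (h.mul_right_cancel ?_)
  unfold cay
  rw [← mul_assoc, Ring.mul_inverse_cancel _ h', one_mul, mul_neg, neg_mul]
  simp only [mul_assoc]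
  rw [Ring.inverse_mul_cancel _ h, mul_one]
  have : (1 - star g) * (1 + g) = 1 + g - star g - star g * g := by noncomm_ring
  rw [this, h1]
  have : (1 + star g) * (1 - g) = 1 - g + star g - star g * g := by noncomm_ring
  rw [this, h1]; abel

/-- Applied to d = diag(1,0), whose commutant is the diagonal matrices, this keeps Cayley transforms
diagonal. If 1 + y is not invertible, the transform is 0 by the convention for `Ring.inverse`. -/
lemma cay_commute {y d : MatH} (h : Commute y d) : Commute (cay y) d := by
  have h1 : Commute (1 + y) d := (Commute.one_left d).add_left h
  refine ((Commute.one_left d).sub_left h).mul_left ?_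
  by_cases hu : IsUnit (1 + y)
  · obtain ⟨u, hu⟩ := hu
    rw [← hu] at h1 ⊢
    rw [Ring.inverse_unit]
    exact h1.units_inv_left
  · rw [Ring.inverse_non_unit _ hu]
    exact Commute.zero_left d

lemma cay_contDiffAt {y : MatH} (h : IsUnit (1 + y)) : ContDiffAt ℝ ∞ cay y := by
  obtain ⟨u, hu⟩ := h
  refine (contDiffAt_const.sub contDiffAt_id).mul ?_
  have h1 := contDiffAt_ringInverse ℝ (n := ∞) u
  rw [hu] at h1
  exact h1.comp y (contDiffAt_const.add contDiffAt_id)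

/-- The contraction of (a part of) the unitary group onto the unit, by straight lines in a
translated Cayley chart. -/
def contr (a : MatH) (s : ℝ) (y : MatH) : MatH :=
  -- The segment joins the Cayley coordinate of 1 to that of y, both relative to a. For y = 1 it is
  -- constant, so base points do not move.
  a * cay (s • cay (star a * y) + (1 - s) • cay (star a))

/-- The points `y` at which the contraction `contr a` is smooth. -/
structure InDom (a y : MatH) : Prop where
  a_mem : a ∈ unitary MatH
  mem : y ∈ unitary MatH
  -- The unit element has to lie in the same chart as y, because the contraction starts there.
  a_unit : IsUnit (1 + star a)
  unit : IsUnit (1 + star a * y)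

namespace InDom

variable {a y : MatH} (h : InDom a y)

include h

lemma prod_mem : star a * y ∈ unitary MatH := mul_mem (Unitary.star_mem h.a_mem) h.mem

/-- Real affine combinations of skew-Hermitian matrices are skew-Hermitian, so the outer Cayley
transform in `contr` is defined and unitary for every real s. -/
lemma skew (s : ℝ) : star (s • cay (star a * y) + (1 - s) • cay (star a))
    = -(s • cay (star a * y) + (1 - s) • cay (star a)) := by
  rw [star_add, star_smul, star_smul, cay_skew h.prod_mem h.unit,
    cay_skew (Unitary.star_mem h.a_mem) h.a_unit]
  simp only [star_trivial, smul_neg]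
  abel

lemma contr_mem (s : ℝ) : contr a s y ∈ unitary MatH :=
  mul_mem h.a_mem (cay_mem_unitary (h.skew s))

lemma contr_zero : contr a 0 y = 1 := by
  unfold contr
  rw [zero_smul, zero_add, sub_zero, one_smul, cay_cay h.a_unit]
  exact (Unitary.mem_iff.1 h.a_mem).2

lemma contr_one : contr a 1 y = y := by
  unfold contr
  rw [one_smul, sub_self, zero_smul, add_zero, cay_cay h.unit, ← mul_assoc,
    (Unitary.mem_iff.1 h.a_mem).2, one_mul]

lemma contr_self (s : ℝ) : contr a s 1 = 1 := by
  unfold contr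
  rw [mul_one, ← add_smul, add_sub_cancel, one_smul, cay_cay h.a_unit]
  exact (Unitary.mem_iff.1 h.a_mem).2

lemma contr_commute {d : MatH} (had : Commute a d) (had' : Commute (star a) d)
    (hy : Commute y d) (s : ℝ) : Commute (contr a s y) d :=
  had.mul_left (cay_commute
    (((cay_commute (had'.mul_left hy)).smul_left s).add_left
      ((cay_commute had').smul_left (1 - s))))

lemma contDiffAt (s : ℝ) : ContDiffAt ℝ ∞ (fun p : ℝ × MatH => contr a p.1 p.2) (s, y) := by
  have h1 : ContDiffAt ℝ ∞ (fun p : ℝ × MatH => cay (star a * p.2)) (s, y) :=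
    ContDiffAt.comp (s, y) (g := cay) (f := fun p : ℝ × MatH => star a * p.2)
      (cay_contDiffAt h.unit) (contDiffAt_const.mul contDiffAt_snd)
  have h2 : ContDiffAt ℝ ∞ (fun p : ℝ × MatH =>
      p.1 • cay (star a * p.2) + (1 - p.1) • cay (star a)) (s, y) :=
    (contDiffAt_fst.smul h1).add ((contDiffAt_const.sub contDiffAt_fst).smul contDiffAt_const)
  exact contDiffAt_const.mul (ContDiffAt.comp (s, y) (g := cay)
    (cay_contDiffAt (isUnit_one_add_of_skew (h.skew s))) h2)

end InDom

lemma isOpen_unit_dom (a : MatH) : IsOpen {y : MatH | IsUnit (1 + star a * y)} := by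
  have : Continuous fun y : MatH => 1 + star a * y := by fun_prop
  exact Units.isOpen.preimage this

end Matrices

/-! ### General position: centres whose Cayley chart contains a given family. -/

section GeneralPosition

open Quaternion

instance : StarModule ℝ ℍ[ℝ] :=
  ⟨fun r x => Quaternion.star_smul r x⟩

/-- Imaginary quaternions. -/
def imH : (ℝ × ℝ × ℝ) →L[ℝ] ℍ[ℝ] :=
  LinearMap.toContinuousLinearMap
    { toFun := fun p => ⟨0, p.1, p.2.1, p.2.2⟩
      map_add' := fun p q => by ext; exacts [(add_zero 0).symm, rfl, rfl, rfl]
      map_smul' := fun c p => by ext; exacts [(mul_zero c).symm, rfl, rfl, rfl] }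

/-- The coordinates of the imaginary part of a quaternion. -/
def coH : ℍ[ℝ] →L[ℝ] (ℝ × ℝ × ℝ) :=
  LinearMap.toContinuousLinearMap
    { toFun := fun q => (q.imI, q.imJ, q.imK)
      map_add' := fun p q => rfl
      map_smul' := fun c p => rfl }

lemma re_imH (p : ℝ × ℝ × ℝ) : (imH p).re = 0 := rfl
lemma imI_imH (p : ℝ × ℝ × ℝ) : (imH p).imI = p.1 := rfl
lemma imJ_imH (p : ℝ × ℝ × ℝ) : (imH p).imJ = p.2.1 := rfl
lemma imK_imH (p : ℝ × ℝ × ℝ) : (imH p).imK = p.2.2 := rfl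

lemma star_imH (p : ℝ × ℝ × ℝ) : star (imH p) = -imH p :=
  Quaternion.star_eq_neg.2 rfl

/-- Hyperspherical coordinates on the unit quaternions. -/
def sphH (p : ℝ × ℝ × ℝ) : ℍ[ℝ] :=
  Real.cos p.1 • 1 + imH (Real.sin p.1 * Real.cos p.2.1,
    Real.sin p.1 * Real.sin p.2.1 * Real.cos p.2.2,
    Real.sin p.1 * Real.sin p.2.1 * Real.sin p.2.2)

lemma contDiff_sphH {n : ℕ∞} : ContDiff ℝ n sphH := by
  refine ContDiff.add (by fun_prop) (imH.contDiff.comp (f := fun p : ℝ × ℝ × ℝ =>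
    (Real.sin p.1 * Real.cos p.2.1, Real.sin p.1 * Real.sin p.2.1 * Real.cos p.2.2,
    Real.sin p.1 * Real.sin p.2.1 * Real.sin p.2.2)) (by fun_prop))

lemma exists_polar (x y : ℝ) :
    ∃ θ : ℝ, x = √(x ^ 2 + y ^ 2) * Real.cos θ ∧ y = √(x ^ 2 + y ^ 2) * Real.sin θ := by
  refine ⟨Complex.arg ⟨x, y⟩, ?_, ?_⟩
  · have h := Complex.norm_mul_cos_arg (⟨x, y⟩ : ℂ)
    rw [Complex.norm_eq_sqrt_sq_add_sq] at h
    exact h.symm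
  · have h := Complex.norm_mul_sin_arg (⟨x, y⟩ : ℂ)
    rw [Complex.norm_eq_sqrt_sq_add_sq] at h
    exact h.symm

/-- Polar coordinates are split off three times, beginning with the last two components. Only
surjectivity from ℝ³ matters, as it bounds the dimension of the unit quaternions. -/
lemma exists_sphH {q : ℍ[ℝ]} (hq : star q * q = 1) : ∃ p, sphH p = q := by
  obtain ⟨c, hc1, hc2⟩ := exists_polar q.imJ q.imK
  obtain ⟨b, hb1, hb2⟩ := exists_polar q.imI √(q.imJ ^ 2 + q.imK ^ 2)
  obtain ⟨a, ha1, ha2⟩ := exists_polar q.re √(q.imI ^ 2 + √(q.imJ ^ 2 + q.imK ^ 2) ^ 2)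
  rw [Quaternion.star_mul_self, ← Quaternion.coe_one, Quaternion.coe_inj,
    Quaternion.normSq_def'] at hq
  rw [Real.sq_sqrt (by positivity), Real.sq_sqrt (by positivity)] at ha1 ha2
  rw [Real.sq_sqrt (by positivity)] at hb1 hb2
  have h1 : q.re ^ 2 + (q.imI ^ 2 + (q.imJ ^ 2 + q.imK ^ 2)) = 1 := by linarith
  rw [h1, Real.sqrt_one, one_mul] at ha1 ha2
  rw [ha2] at hb1 hb2
  rw [hb2] at hc1 hc2
  refine ⟨(a, b, c), ?_⟩
  ext <;> simp [sphH, re_imH, imI_imH, imJ_imH, imK_imH]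
  · exact ha1.symm
  · exact hb1.symm
  · exact hc1.symm
  · exact hc2.symm

/-- The unitary matrix with first column proportional to `(1, u)`. -/
def sec (u : ℍ[ℝ]) : MatH := (√(1 + ‖u‖ ^ 2))⁻¹ • matL (1, -star u, u, 1)

lemma contDiff_sec {n : ℕ∞} : ContDiff ℝ n sec := by
  have h : ∀ u : ℍ[ℝ], 1 + ‖u‖ ^ 2 ≠ 0 := fun u => by positivity
  refine ContDiff.smul (((contDiff_const.add (contDiff_norm_sq ℝ)).sqrt h).inv
    fun u => (Real.sqrt_pos.2 (by positivity)).ne') (matL.contDiff.comp ?_)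
  exact contDiff_const.prodMk ((starL' ℝ (A := ℍ[ℝ])).contDiff.neg.prodMk
    (contDiff_id.prodMk contDiff_const))

lemma star_matL (a b c d : ℍ[ℝ]) :
    star (matL (a, b, c, d)) = matL (star a, star c, star b, star d) :=
  MatH.ext2 rfl rfl rfl rfl

lemma matL_mul (a b c d a' b' c' d' : ℍ[ℝ]) : matL (a, b, c, d) * matL (a', b', c', d')
    = matL (a * a' + b * c', a * b' + b * d', c * a' + d * c', c * b' + d * d') := by
  refine MatH.ext2 ?_ ?_ ?_ ?_ <;> simp [ent_mul]

lemma sq_sqrt_inv (u : ℍ[ℝ]) :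
    (√(1 + ‖u‖ ^ 2))⁻¹ * ((√(1 + ‖u‖ ^ 2))⁻¹ * (1 + ‖u‖ ^ 2)) = 1 := by
  have h : (0 : ℝ) < 1 + ‖u‖ ^ 2 := by positivity
  rw [← mul_assoc, ← mul_inv, Real.mul_self_sqrt h.le, inv_mul_cancel₀ h.ne']

lemma sec_mem (u : ℍ[ℝ]) : sec u ∈ unitary MatH := by
  have e1 : (1 : ℍ[ℝ]) + ((‖u‖ ^ 2 : ℝ) : ℍ[ℝ]) = ((1 + ‖u‖ ^ 2 : ℝ) : ℍ[ℝ]) := by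
    rw [Quaternion.coe_add, Quaternion.coe_one]
  have e2 : matL (((1 + ‖u‖ ^ 2 : ℝ) : ℍ[ℝ]), 0, 0, ((1 + ‖u‖ ^ 2 : ℝ) : ℍ[ℝ]))
      = (1 + ‖u‖ ^ 2) • (1 : MatH) := by
    refine MatH.ext2 ?_ ?_ ?_ ?_ <;> simp [← Quaternion.coe_mul_eq_smul]
  rw [Unitary.mem_iff]
  unfold sec
  rw [StarModule.star_smul, star_trivial, star_matL, smul_mul_smul_comm, smul_mul_smul_comm, matL_mul,
    matL_mul]
  simp only [star_one, star_neg, star_star, one_mul, mul_one, neg_mul, mul_neg, neg_neg,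
    star_mul_self_re, self_mul_star_re, add_neg_cancel, neg_add_cancel]
  rw [add_comm ((‖u‖ ^ 2 : ℝ) : ℍ[ℝ]), e1, e2, smul_smul, mul_assoc, sq_sqrt_inv, one_smul]
  exact ⟨rfl, rfl⟩

lemma sec_zero : sec 0 = 1 := by
  unfold sec
  refine MatH.ext2 ?_ ?_ ?_ ?_ <;> simp

/-- A set of dimension less than that of a linear space of skew-Hermitian matrices misses a
Cayley transform of an element of that space. -/
lemma exists_cay_notMem {W : Type*} [NormedAddCommGroup W] [NormedSpace ℝ W]
    [FiniteDimensional ℝ W] (L : W →L[ℝ] MatH) (R : MatH →L[ℝ] W) (hR : ∀ w, R (L w) = w)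
    (hL : ∀ w, star (L w) = -L w) {B : Set MatH} (hB : dimH B < Module.finrank ℝ W) :
    ∃ w, cay (L w) ∉ B := by
  by_contra! h
  -- If every Cayley transform lay in B, then R ∘ cay would map a part of B onto W. This map is
  -- locally Lipschitz and cannot raise the Hausdorff dimension.
  have h1 : (univ : Set W) ⊆ (fun y => R (cay y)) '' (B ∩ {y | IsUnit (1 + y)}) := by
    intro w _
    have hu := isUnit_one_add_of_skew (hL w)
    refine ⟨cay (L w), ⟨h w, isUnit_one_add_cay hu⟩, ?_⟩
    simp only [cay_cay hu, hR]
  have h2 : dimH ((fun y => R (cay y)) '' (B ∩ {y | IsUnit (1 + y)}))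
      ≤ dimH (B ∩ {y | IsUnit (1 + y)}) := by
    refine dimH_image_le_of_locally_lipschitzOn fun y hy => ?_
    have hc : ContDiffAt ℝ 1 (fun y => R (cay y)) y :=
      (R.contDiff.contDiffAt (x := cay y)).comp y ((cay_contDiffAt hy.2).of_le (by norm_cast))
    obtain ⟨K, t, ht, hl⟩ := hc.exists_lipschitzOnWith
    exact ⟨K, t, mem_nhdsWithin_of_mem_nhds ht, hl⟩
  have h3 := (dimH_mono h1).trans (h2.trans (dimH_mono inter_subset_left))
  rw [Real.dimH_univ_eq_finrank] at h3
  exact absurd h3 (not_le.2 hB)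

lemma diagH_mem_iff {e f : ℍ[ℝ]} :
    diagH e f ∈ unitary MatH ↔ (star e * e = 1 ∧ e * star e = 1) ∧ star f * f = 1 ∧ f * star f = 1 := by
  rw [Unitary.mem_iff, star_diagH, diagH_mul, diagH_mul, ← diagH_one]
  constructor
  · rintro ⟨h1, h2⟩
    exact ⟨⟨congrArg (ent 0 0) h1, congrArg (ent 0 0) h2⟩,
      congrArg (ent 1 1) h1, congrArg (ent 1 1) h2⟩
  · rintro ⟨⟨h1, h2⟩, h3, h4⟩
    rw [h1, h2, h3, h4]
    exact ⟨rfl, rfl⟩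

/-- A unitary matrix with first column `(-1, 0)`. -/
lemma eq_diag_of_col {d : MatH} (hd : d ∈ unitary MatH) (h0 : ent 0 0 d = -1)
    (h1 : ent 1 0 d = 0) : d = diagH (-1) (ent 1 1 d) := by
  have h := congrArg (ent 0 1) (Unitary.mem_iff.1 hd).1
  rw [ent_mul, ent_star, ent_star, h0, h1] at h
  refine MatH.ext2 h0 ?_ h1 rfl
  rw [diagH_eq]
  simpa using h

lemma eq_diag_of_col' {d : MatH} (hd : d ∈ unitary MatH) (h0 : ent 0 1 d = 0)
    (h1 : ent 1 1 d = -1) : d = diagH (ent 0 0 d) (-1) := by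
  have h := congrArg (ent 1 0) (Unitary.mem_iff.1 hd).1
  rw [ent_mul, ent_star, ent_star, h0, h1] at h
  refine MatH.ext2 rfl h0 ?_ h1
  rw [diagH_eq]
  simpa using h

/-- Unitary matrices with eigenvalue `-1`. -/
lemma exists_of_not_isUnit {b : MatH} (hb : b ∈ unitary MatH) (h : ¬ IsUnit (1 + b)) :
    (∃ q p, star b = sec q * diagH (-1) (sphH p) * star (sec q)) ∨
      ∃ p, star b = diagH (sphH p) (-1) := by
  obtain ⟨M, hM, h0⟩ := exists_mul_eq_zero_of_not_isUnit h
  have hbM : b * M = -M := by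
    rw [add_mul, one_mul, add_comm] at h0
    exact eq_neg_of_add_eq_zero_left h0
  have hsM : star b * M = -M := by
    have := congrArg (star b * ·) hbM
    simp only [← mul_assoc, (Unitary.mem_iff.1 hb).1, one_mul, mul_neg] at this
    exact (neg_eq_iff_eq_neg.2 this).symm
  have hsb := Unitary.star_mem hb
  set c := star b with hc
  clear_value c
  by_cases h00 : ∃ j, ent 0 j M ≠ 0
  · left
    obtain ⟨j, hj⟩ := h00
    have e0 := congrArg (ent 0 j) hsM
    have e1 := congrArg (ent 1 j) hsM
    rw [ent_mul, map_neg] at e0 e1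
    -- Column j of M is an eigenvector for the real eigenvalue -1. Such vectors form a right
    -- ℍ-space, so the column may be scaled on the right to (1, q), which is the first column of
    -- `sec q` up to a real factor.
    set q := ent 1 j M * (ent 0 j M)⁻¹ with hq
    have e0' : ent 0 0 c + ent 0 1 c * q = -1 := by
      have := congrArg (· * (ent 0 j M)⁻¹) e0
      simp only [add_mul, mul_assoc, mul_inv_cancel₀ hj, neg_mul, mul_one] at this
      exact this
    have e1' : ent 1 0 c + ent 1 1 c * q = -q := by
      have := congrArg (· * (ent 0 j M)⁻¹) e1
      simp only [add_mul, mul_assoc, mul_inv_cancel₀ hj, neg_mul, mul_one] at this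
      exact this
    have hS := sec_mem q
    obtain ⟨hS1, hS2⟩ := Unitary.mem_iff.1 hS
    -- Conjugation by `sec q` moves the eigenvector to e₁. What remains is diag(-1, unit
    -- quaternion), so this stratum has 4 + 3 parameters.
    have hd : star (sec q) * c * sec q ∈ unitary MatH :=
      mul_mem (mul_mem (Unitary.star_mem hS) hsb) hS
    have k0 : ent 0 0 (c * sec q) = -ent 0 0 (sec q) := by
      rw [ent_mul]
      simp only [sec, map_smul, ent_matL00, ent_matL10]
      rw [mul_smul_comm, mul_smul_comm, ← smul_add, mul_one, e0', smul_neg]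
    have k1 : ent 1 0 (c * sec q) = -ent 1 0 (sec q) := by
      rw [ent_mul]
      simp only [sec, map_smul, ent_matL00, ent_matL10]
      rw [mul_smul_comm, mul_smul_comm, ← smul_add, mul_one, e1', smul_neg]
    have kk : ∀ i, ent i 0 (star (sec q) * c * sec q) = - ent i 0 (1 : MatH) := by
      intro i
      rw [mul_assoc, ent_mul, k0, k1, mul_neg, mul_neg, ← neg_add, ← ent_mul, hS1]
    have hdd := eq_diag_of_col hd (by rw [kk]; rfl) (by rw [kk]; simp)
    rw [hdd] at hd
    obtain ⟨p, hp⟩ := exists_sphH (diagH_mem_iff.1 hd).2.1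
    refine ⟨q, p, ?_⟩
    rw [hp, ← hdd]
    simp only [← mul_assoc, hS2, one_mul]
    rw [mul_assoc, hS2, mul_one]
  -- All columns of M are multiples of e₂, the one line without an affine coordinate.
  · right
    push Not at h00
    have : ∃ j, ent 1 j M ≠ 0 := by
      by_contra! h1
      exact hM (MatH.ext2 (h00 _) (h00 _) (h1 _) (h1 _))
    obtain ⟨j, hj⟩ := this
    have e0 := congrArg (ent 0 j) hsM
    have e1 := congrArg (ent 1 j) hsM
    rw [ent_mul, map_neg, h00, mul_zero, zero_add] at e0 e1
    rw [neg_zero] at e0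
    have hd := eq_diag_of_col' hsb ((mul_eq_zero.1 e0).resolve_right hj)
      (mul_right_cancel₀ hj (by rw [e1, neg_one_mul]))
    rw [hd] at hsb
    obtain ⟨p, hp⟩ := exists_sphH (diagH_mem_iff.1 hsb).1.1
    exact ⟨p, by rw [hp, ← hd]⟩

/-- A smooth family of unitary matrices over the square avoids the singular set of a translated
Cayley chart. -/
lemma exists_inDom_sq {f : ℝ × ℝ → MatH} (hf : ContDiffOn ℝ ∞ f uSq)
    (hu : ∀ x ∈ uSq, f x ∈ unitary MatH) : ∃ a : MatH, ∀ x ∈ uSq, InDom a (f x) := by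
  -- Coordinates of skew-Hermitian matrices: one off-diagonal quaternion and two imaginary diagonal
  -- entries, of real dimension 4 + 3 + 3 = 10.
  let W := ℍ[ℝ] × (ℝ × ℝ × ℝ) × (ℝ × ℝ × ℝ)
  let L : W →L[ℝ] MatH := matL.comp
    ((imH.comp ((ContinuousLinearMap.fst ℝ _ _).comp (ContinuousLinearMap.snd ℝ _ _))).prod
    ((-((starL' ℝ (A := ℍ[ℝ])).toContinuousLinearMap.comp
      (ContinuousLinearMap.fst ℝ ℍ[ℝ] ((ℝ × ℝ × ℝ) × (ℝ × ℝ × ℝ))))).prod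
    ((ContinuousLinearMap.fst ℝ _ _).prod
    (imH.comp ((ContinuousLinearMap.snd ℝ _ _).comp (ContinuousLinearMap.snd ℝ _ _))))))
  let R : MatH →L[ℝ] W := (ent 1 0).prod ((coH.comp (ent 0 0)).prod (coH.comp (ent 1 1)))
  -- If b = a* f(x) has eigenvalue -1, then a = f(x) b*. By the normal form of b*, every bad unitary
  -- centre lies in the image of Φ₁ or of Φ₂.
  let Φ₁ : (ℝ × ℝ) × ℍ[ℝ] × (ℝ × ℝ × ℝ) → MatH := fun p =>
    f p.1 * (sec p.2.1 * diagH (-1) (sphH p.2.2) * star (sec p.2.1))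
  let Φ₂ : (ℝ × ℝ) × (ℝ × ℝ × ℝ) → MatH := fun p => f p.1 * diagH (sphH p.2) (-1)
  have hconv : Convex ℝ uSq := (convex_Icc 0 1).prod (convex_Icc 0 1)
  have hf1 : ContDiffOn ℝ 1 f uSq := hf.of_le (by norm_cast)
  have hΦ₁ : ContDiffOn ℝ 1 Φ₁ (uSq ×ˢ univ) := by
    refine (hf1.comp contDiff_fst.contDiffOn fun p hp => hp.1).mul (ContDiff.contDiffOn ?_)
    have hs : ContDiff ℝ 1 fun p : (ℝ × ℝ) × ℍ[ℝ] × (ℝ × ℝ × ℝ) => sec p.2.1 :=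
      (contDiff_sec (n := 1)).comp (contDiff_fst.comp contDiff_snd)
    refine (hs.mul ?_).mul ((starL' ℝ (A := MatH)).contDiff.comp hs)
    simp only [diagH_eq]
    refine matL.contDiff.comp (contDiff_const.prodMk (contDiff_const.prodMk
      (contDiff_const.prodMk ?_)))
    exact (contDiff_sphH (n := 1)).comp (contDiff_snd.comp contDiff_snd)
  have hΦ₂ : ContDiffOn ℝ 1 Φ₂ (uSq ×ˢ univ) := by
    refine (hf1.comp contDiff_fst.contDiffOn fun p hp => hp.1).mul (ContDiff.contDiffOn ?_)
    simp only [diagH_eq]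
    refine matL.contDiff.comp (ContDiff.prodMk ?_ contDiff_const)
    exact (contDiff_sphH (n := 1)).comp contDiff_snd
  -- The parameters number 2 for the square, 4 for the line and 3 for the unit quaternion.
  have hd₁ : dimH (Φ₁ '' (uSq ×ˢ univ)) ≤ 9 := by
    refine (hΦ₁.dimH_image_le (hconv.prod convex_univ) Subset.rfl).trans
      ((dimH_mono (subset_univ _)).trans ?_)
    rw [Real.dimH_univ_eq_finrank]
    simp [Module.finrank_prod, Quaternion.finrank_eq_four]
  -- There are only 2 + 3 parameters here; the common bound 9 suffices.
  have hd₂ : dimH (Φ₂ '' (uSq ×ˢ univ)) ≤ 9 := by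
    refine (hΦ₂.dimH_image_le (hconv.prod convex_univ) Subset.rfl).trans
      ((dimH_mono (subset_univ _)).trans ?_)
    rw [Real.dimH_univ_eq_finrank]
    simp [Module.finrank_prod]
    norm_num
  have hL : ∀ w, star (L w) = -L w := fun w => by
    show star (matL (imH w.2.1, -star w.1, w.1, imH w.2.2))
      = -(matL (imH w.2.1, -star w.1, w.1, imH w.2.2))
    rw [star_matL, star_imH, star_imH, star_neg, star_star, ← map_neg matL]
    simp only [Prod.neg_mk, neg_neg]
  obtain ⟨w, hw⟩ := exists_cay_notMem L R (fun w => rfl) hL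
    (B := Φ₁ '' (uSq ×ˢ univ) ∪ Φ₂ '' (uSq ×ˢ univ)) (by
      rw [dimH_union]
      refine (max_le hd₁ hd₂).trans_lt ?_
      simp only [W, Module.finrank_prod, Quaternion.finrank_eq_four, Module.finrank_self]
      norm_num)
  have ha := cay_mem_unitary (hL w)
  refine ⟨cay (L w), fun x hx => ⟨ha, hu x hx, ?_, ?_⟩⟩
  · have h1 := isUnit_one_add_of_skew (hL w)
    simpa using (isUnit_one_add_cay h1).star
  · by_contra hc
    have hb : star (cay (L w)) * f x ∈ unitary MatH := mul_mem (Unitary.star_mem ha) (hu x hx)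
    have e : f x * star (star (cay (L w)) * f x) = cay (L w) := by
      rw [star_mul, star_star, ← mul_assoc, (Unitary.mem_iff.1 (hu x hx)).2, one_mul]
    refine hw ?_
    rcases exists_of_not_isUnit hb hc with ⟨q, p, h⟩ | ⟨p, h⟩
    · left
      exact ⟨(x, q, p), ⟨hx, trivial⟩, by rw [← e, h]⟩
    · right
      exact ⟨(x, p), ⟨hx, trivial⟩, by rw [← e, h]⟩

lemma isUnit_diagH {e f : ℍ[ℝ]} (he : e ≠ 0) (hf : f ≠ 0) : IsUnit (diagH e f) :=
  ⟨⟨diagH e f, diagH e⁻¹ f⁻¹, by rw [diagH_mul, mul_inv_cancel₀ he, mul_inv_cancel₀ hf, diagH_one],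
    by rw [diagH_mul, inv_mul_cancel₀ he, inv_mul_cancel₀ hf, diagH_one]⟩, rfl⟩

/-- A smooth path of diagonal unitary matrices avoids the singular set of a translated
Cayley chart at a diagonal matrix. -/
lemma exists_inDom_diag {f : ℝ → MatH} (hf : ContDiffOn ℝ ∞ f (Icc 0 1))
    (hu : ∀ x ∈ Icc (0 : ℝ) 1, f x ∈ unitary MatH)
    (hdiag : ∀ x ∈ Icc (0 : ℝ) 1, ∃ e g, f x = diagH e g) :
    ∃ a : MatH, (∃ e g, a = diagH e g) ∧ ∀ x ∈ Icc (0 : ℝ) 1, InDom a (f x) := by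
  -- Centres are sought among diagonal matrices, a space of dimension 6, whereas the bad ones need 1
  -- + 3 parameters.
  let W := (ℝ × ℝ × ℝ) × (ℝ × ℝ × ℝ)
  let L : W →L[ℝ] MatH := matL.comp
    ((imH.comp (ContinuousLinearMap.fst ℝ _ _)).prod ((0 : W →L[ℝ] ℍ[ℝ]).prod
    ((0 : W →L[ℝ] ℍ[ℝ]).prod (imH.comp (ContinuousLinearMap.snd ℝ _ _)))))
  let R : MatH →L[ℝ] W := (coH.comp (ent 0 0)).prod (coH.comp (ent 1 1))
  let Φ₁ : ℝ × (ℝ × ℝ × ℝ) → MatH := fun p => f p.1 * diagH (-1) (sphH p.2)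
  let Φ₂ : ℝ × (ℝ × ℝ × ℝ) → MatH := fun p => f p.1 * diagH (sphH p.2) (-1)
  have hf1 : ContDiffOn ℝ 1 f (Icc 0 1) := hf.of_le (by norm_cast)
  have hΦ₁ : ContDiffOn ℝ 1 Φ₁ (Icc 0 1 ×ˢ univ) := by
    refine (hf1.comp contDiff_fst.contDiffOn fun p hp => hp.1).mul (ContDiff.contDiffOn ?_)
    simp only [diagH_eq]
    refine matL.contDiff.comp (contDiff_const.prodMk (contDiff_const.prodMk
      (contDiff_const.prodMk ?_)))
    exact (contDiff_sphH (n := 1)).comp contDiff_snd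
  have hΦ₂ : ContDiffOn ℝ 1 Φ₂ (Icc 0 1 ×ˢ univ) := by
    refine (hf1.comp contDiff_fst.contDiffOn fun p hp => hp.1).mul (ContDiff.contDiffOn ?_)
    simp only [diagH_eq]
    refine matL.contDiff.comp (ContDiff.prodMk ?_ contDiff_const)
    exact (contDiff_sphH (n := 1)).comp contDiff_snd
  have hd : dimH (univ : Set (ℝ × (ℝ × ℝ × ℝ))) ≤ 4 := by
    rw [Real.dimH_univ_eq_finrank]
    simp [Module.finrank_prod]
  have hd₁ : dimH (Φ₁ '' (Icc 0 1 ×ˢ univ)) ≤ 4 :=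
    (hΦ₁.dimH_image_le ((convex_Icc 0 1).prod convex_univ) Subset.rfl).trans
      ((dimH_mono (subset_univ _)).trans hd)
  have hd₂ : dimH (Φ₂ '' (Icc 0 1 ×ˢ univ)) ≤ 4 :=
    (hΦ₂.dimH_image_le ((convex_Icc 0 1).prod convex_univ) Subset.rfl).trans
      ((dimH_mono (subset_univ _)).trans hd)
  have hL' : ∀ w, L w = diagH (imH w.1) (imH w.2) := fun w => (diagH_eq _ _).symm
  have hL : ∀ w, star (L w) = -L w := fun w => by
    rw [hL', star_diagH, star_imH, star_imH, diagH_eq, diagH_eq, ← map_neg matL]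
    simp only [Prod.neg_mk, neg_zero]
  obtain ⟨w, hw⟩ := exists_cay_notMem L R (fun w => rfl) hL
    (B := Φ₁ '' (Icc 0 1 ×ˢ univ) ∪ Φ₂ '' (Icc 0 1 ×ˢ univ)) (by
      rw [dimH_union]
      refine (max_le hd₁ hd₂).trans_lt ?_
      simp only [W, Module.finrank_prod, Module.finrank_self]
      norm_num)
  have ha := cay_mem_unitary (hL w)
  -- The matrix L w commutes with diag(1,0), hence so does its Cayley transform.
  have had : ∃ e g, cay (L w) = diagH e g := by
    have hc : Commute (L w) (diagH 1 0) := by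
      rw [hL']
      show _ * _ = _ * _
      rw [diagH_mul, diagH_mul]; simp
    have hc' := cay_commute hc
    have h1 := congrArg (ent 0 1) hc'.eq
    have h2 := congrArg (ent 1 0) hc'.eq
    simp only [ent_mul, diagH_eq, ent_matL00, ent_matL01, ent_matL10, ent_matL11] at h1 h2
    refine ⟨ent 0 0 (cay (L w)), ent 1 1 (cay (L w)), ?_⟩
    rw [diagH_eq]
    refine MatH.ext2 rfl ?_ ?_ rfl
    · simpa using h1.symm
    · simpa using h2
  refine ⟨cay (L w), had, fun x hx => ⟨ha, hu x hx, ?_, ?_⟩⟩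
  · have h1 := isUnit_one_add_of_skew (hL w)
    simpa using (isUnit_one_add_cay h1).star
  · by_contra hc
    have hb : star (cay (L w)) * f x ∈ unitary MatH := mul_mem (Unitary.star_mem ha) (hu x hx)
    have e : f x * star (star (cay (L w)) * f x) = cay (L w) := by
      rw [star_mul, star_star, ← mul_assoc, (Unitary.mem_iff.1 (hu x hx)).2, one_mul]
    obtain ⟨c, d, hcd⟩ := had
    obtain ⟨k, l, hkl⟩ := hdiag x hx
    have hbd : star (cay (L w)) * f x = diagH (star c * k) (star d * l) := by
      rw [hcd, hkl, star_diagH, diagH_mul]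
    rw [hbd] at hb hc e
    obtain ⟨⟨_, h1⟩, _, h2⟩ := diagH_mem_iff.1 hb
    obtain ⟨p, hp⟩ := exists_sphH (q := star (star c * k)) (by rw [star_star]; exact h1)
    obtain ⟨p', hp'⟩ := exists_sphH (q := star (star d * l)) (by rw [star_star]; exact h2)
    have hadd : (1 : MatH) + diagH (star c * k) (star d * l)
        = diagH (1 + star c * k) (1 + star d * l) := by
      rw [diagH_eq, diagH_eq]
      refine MatH.ext2 ?_ ?_ ?_ ?_ <;> simp
    rw [hadd] at hc
    rw [star_diagH] at e
    refine hw ?_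
    -- A diagonal matrix that is not invertible has a zero diagonal entry; the two cases land in the
    -- images of Φ₁ and Φ₂.
    by_cases h0 : 1 + star c * k = 0
    · left
      refine ⟨(x, p'), ⟨hx, trivial⟩, ?_⟩
      have : star c * k = -1 := (neg_eq_of_add_eq_zero_right h0).symm
      rw [← e, this, ← hp', star_neg, star_one]
    · have h0' : 1 + star d * l = 0 := by
        by_contra h3
        exact hc (isUnit_diagH h0 h3)
      right
      refine ⟨(x, p), ⟨hx, trivial⟩, ?_⟩
      have : star d * l = -1 := (neg_eq_of_add_eq_zero_right h0').symm
      rw [← e, this, ← hp, star_neg, star_one]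

end GeneralPosition

/-! ### Local tools for diffeological spaces. -/

section Plots

lemma isPlot_quotient_iff {X Y : Type*} [DiffeologicalSpace X] {π : X → Y}
    {hπ : Function.Surjective π} {n : ℕ} {p : Eu n → Y} :
    @IsPlot Y (quotientDiffeology π hπ) n p ↔
      ∀ x, ∃ q : Eu n → X, IsPlot q ∧ (π ∘ q) =ᶠ[𝓝 x] p :=
  ⟨fun h x => h x trivial, fun h x _ => h x⟩

lemma isPlot_of_locally {X : Type*} [DiffeologicalSpace X] {n : ℕ} {p : Eu n → X}
    (h : ∀ x, ∃ q : Eu n → X, IsPlot q ∧ q =ᶠ[𝓝 x] p) : IsPlot p := by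
  refine DiffeologicalSpace.locality fun x => ?_
  obtain ⟨q, hq, e⟩ := h x
  obtain ⟨u, hu, ho, hx⟩ := eventually_nhds_iff.1 e
  refine ⟨u, ho, hx, fun {m f} hf hs => ?_⟩
  have : p ∘ f = q ∘ f := funext fun y => (hu _ (hf y)).symm
  rw [this]
  exact isPlot_reparam hq hs

/-- A smooth map into a given neighbourhood of a point, equal to the identity near that point. -/
lemma exists_shrink {n : ℕ} {x : Eu n} {V : Set (Eu n)} (hV : V ∈ 𝓝 x) :
    ∃ ρ : Eu n → Eu n, ContDiff ℝ ∞ ρ ∧ (∀ y, ρ y ∈ V) ∧ ρ =ᶠ[𝓝 x] id := by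
  obtain ⟨ε, hε, hb⟩ := Metric.mem_nhds_iff.1 hV
  let χ : ContDiffBump x := ⟨ε / 4, ε / 2, by positivity, by linarith⟩
  -- Scaling y - x by a bump function gives y near x and collapses to x far away. Plots live on all
  -- of ℝⁿ, so composition with this map replaces restriction to an open subset.
  refine ⟨fun y => x + χ y • (y - x), contDiff_const.add
    (χ.contDiff.smul (contDiff_id.sub contDiff_const)), fun y => hb ?_, ?_⟩
  · rw [Metric.mem_ball, dist_eq_norm, add_sub_cancel_left, norm_smul, Real.norm_of_nonneg χ.nonneg]
    by_cases hy : dist y x < ε / 2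
    · rw [← dist_eq_norm]
      calc χ y * dist y x ≤ 1 * dist y x := by
            gcongr
            exact χ.le_one
        _ < ε := by linarith
    · rw [χ.zero_of_le_dist (not_lt.1 hy), zero_mul]; exact hε
  · filter_upwards [χ.eventuallyEq_one] with y hy
    simp [hy]

/-- Openness in the D-topology is tested on plots, so f is continuous, and an injective continuous
map into a Hausdorff space forces the source to be Hausdorff. -/
lemma t2Space_of_plots {X Z : Type*} [DiffeologicalSpace X] [TopologicalSpace Z] [T2Space Z]
    {f : X → Z} (hi : Function.Injective f)
    (hf : ∀ (n : ℕ) (p : Eu n → X), IsPlot p → Continuous (f ∘ p)) :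
    @T2Space X dTopology := by
  let _ : TopologicalSpace X := dTopology
  refine T2Space.of_injective_continuous hi (continuous_def.2 fun u hu => ?_)
  exact isOpen_iff_preimages_plots.2 fun n p hp => hu.preimage (hf n p hp)

/-- The tube lemma: projection along the compact interval is a closed map. It makes conditions on
whole paths open in the parameter. -/
lemma isOpen_forall_Icc {X Z : Type*} [TopologicalSpace X] [TopologicalSpace Z] {φ : X × ℝ → Z}
    (hφ : ContinuousOn φ (univ ×ˢ Icc 0 1)) {U : Set Z} (hU : IsOpen U) :
    IsOpen {x | ∀ r ∈ Icc (0 : ℝ) 1, φ (x, r) ∈ U} := by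
  have hc : Continuous fun z : X × I => φ (z.1, z.2) :=
    hφ.comp_continuous (by fun_prop) fun z => ⟨trivial, z.2.2⟩
  have h := isClosedMap_fst_of_compactSpace _ (hU.isClosed_compl.preimage hc)
  convert h.isOpen_compl using 1
  ext x
  simp

end Plots

/-! ### Quaternionic lines as orthogonal projections, with their affine coordinate. -/

section Lines

/-- The orthogonal projection onto the first coordinate line. -/
def prD : MatH := diagH 1 0

/-- The projection onto the image of the first coordinate line. -/
def conjD (M : MatH) : MatH := M * prD * star M

lemma conjD_mul (g M : MatH) : conjD (g * M) = g * conjD M * star g := by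
  unfold conjD; rw [star_mul]; simp only [mul_assoc]

lemma conjD_eq (M : MatH) : conjD M = matL (ent 0 0 M * star (ent 0 0 M),
    ent 0 0 M * star (ent 1 0 M), ent 1 0 M * star (ent 0 0 M), ent 1 0 M * star (ent 1 0 M)) := by
  unfold conjD prD
  rw [diagH_eq]
  refine MatH.ext2 ?_ ?_ ?_ ?_ <;> simp [ent_mul, ent_star]

lemma conjD_one : conjD 1 = prD := by unfold conjD; simp

lemma norm_col {M : MatH} (hM : M ∈ unitary MatH) : ‖ent 0 0 M‖ ^ 2 + ‖ent 1 0 M‖ ^ 2 = 1 := by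
  have h := congrArg (ent 0 0) (Unitary.mem_iff.1 hM).1
  rw [ent_mul, ent_star, ent_star, star_mul_self_re, star_mul_self_re, ent_one00,
    ← Quaternion.coe_add, ← Quaternion.coe_one, Quaternion.coe_inj] at h
  exact h

lemma re_conjD (M : MatH) : (ent 0 0 (conjD M)).re = ‖ent 0 0 M‖ ^ 2 := by
  rw [conjD_eq, ent_matL00, self_mul_star_re, Quaternion.re_coe]

/-- The affine coordinate of a quaternionic line. -/
def affH (P : MatH) : ℍ[ℝ] := (ent 0 0 P).re⁻¹ • ent 1 0 P

lemma conjD_sec (u : ℍ[ℝ]) :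
    conjD (sec u) = (1 + ‖u‖ ^ 2)⁻¹ • matL (1, star u, u, ((‖u‖ ^ 2 : ℝ) : ℍ[ℝ])) := by
  have hs : (√(1 + ‖u‖ ^ 2))⁻¹ * (√(1 + ‖u‖ ^ 2))⁻¹ = (1 + ‖u‖ ^ 2)⁻¹ := by
    rw [← mul_inv, Real.mul_self_sqrt (by positivity)]
  rw [conjD_eq, ← map_smul]
  simp only [sec, map_smul, ent_matL00, ent_matL10, Quaternion.star_smul, smul_mul_smul_comm, hs,
    star_one, mul_one, one_mul, self_mul_star_re, Prod.smul_mk]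

lemma re_conjD_sec (u : ℍ[ℝ]) : (ent 0 0 (conjD (sec u))).re = (1 + ‖u‖ ^ 2)⁻¹ := by
  rw [conjD_sec, map_smul, ent_matL00, Quaternion.re_smul, Quaternion.re_one, smul_eq_mul, mul_one]

lemma re_conjD_sec_ne (u : ℍ[ℝ]) : (ent 0 0 (conjD (sec u))).re ≠ 0 := by
  rw [re_conjD_sec]; positivity

lemma affH_conjD_sec (u : ℍ[ℝ]) : affH (conjD (sec u)) = u := by
  unfold affH
  rw [re_conjD_sec, conjD_sec, map_smul, ent_matL10, smul_smul, inv_inv,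
    mul_inv_cancel₀ (by positivity), one_smul]

/-- If the first column (a, b) of M has a ≠ 0, its line is spanned by (1, ba⁻¹). The normalising
factor agrees because |a|² + |b|² = 1. -/
lemma conjD_sec_affH {M : MatH} (hM : M ∈ unitary MatH) (h : (ent 0 0 (conjD M)).re ≠ 0) :
    conjD (sec (affH (conjD M))) = conjD M := by
  have hn := norm_col hM
  rw [conjD_sec]
  have e0 : affH (conjD M) = (‖ent 0 0 M‖ ^ 2)⁻¹ • (ent 1 0 M * star (ent 0 0 M)) := by
    unfold affH
    rw [re_conjD, conjD_eq, ent_matL10]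
  rw [re_conjD] at h
  set a := ent 0 0 M with ha
  set b := ent 1 0 M with hb
  have e1 : ‖affH (conjD M)‖ ^ 2 = (‖a‖ ^ 2)⁻¹ * ‖b‖ ^ 2 := by
    rw [e0, norm_smul, norm_mul, Quaternion.norm_star, Real.norm_of_nonneg (by positivity)]
    field_simp
  have e2 : (1 + ‖affH (conjD M)‖ ^ 2)⁻¹ = ‖a‖ ^ 2 := by
    rw [e1, ← inv_inv (‖a‖ ^ 2), inv_inj, inv_inv]
    have h' : (0 : ℝ) < ‖a‖ ^ 2 := lt_of_le_of_ne (by positivity) h.symm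
    have : ‖b‖ ^ 2 = 1 - ‖a‖ ^ 2 := by linarith
    rw [this, mul_sub, inv_mul_cancel₀ h]
    ring
  rw [e2, e1, ← map_smul, e0, conjD_eq, ← ha, ← hb]
  congr 1
  simp only [Prod.smul_mk, Quaternion.star_smul, star_mul, star_star, smul_smul,
    mul_inv_cancel₀ h, one_smul, self_mul_star_re]
  refine Prod.ext ?_ (Prod.ext rfl (Prod.ext rfl ?_))
  · rw [← Quaternion.coe_mul_eq_smul, mul_one]
  · dsimp only
    rw [← Quaternion.coe_mul_eq_smul, ← Quaternion.coe_mul, mul_inv_cancel_left₀ h]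

lemma affH_prD : affH prD = 0 := by
  have := affH_conjD_sec 0
  rwa [sec_zero, conjD_one] at this

lemma re_prD : (ent 0 0 prD).re = 1 := by
  rw [prD, diagH_eq, ent_matL00, Quaternion.re_one]

/-- The real part of a quaternion. -/
def reL : ℍ[ℝ] →L[ℝ] ℝ :=
  LinearMap.toContinuousLinearMap
    { toFun := fun q => q.re
      map_add' := fun _ _ => rfl
      map_smul' := fun _ _ => rfl }

lemma contDiff_re_ent : ContDiff ℝ ∞ fun P : MatH => (ent 0 0 P).re :=
  (reL.comp (ent 0 0)).contDiff

lemma affH_contDiffAt {P : MatH} (h : (ent 0 0 P).re ≠ 0) : ContDiffAt ℝ ∞ affH P :=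
  (contDiff_re_ent.contDiffAt.inv h).smul (ent 1 0).contDiff.contDiffAt

lemma conjD_contDiff : ContDiff ℝ ∞ conjD :=
  (contDiff_id.mul contDiff_const).mul (starL' ℝ (A := MatH)).contDiff

/-- For unitary M the left side says that M commutes with diag(1,0). So Spin(4) is the stabiliser of
the base line, which identifies Spin(5)/Spin(4) with ℍP¹. -/
lemma conjD_eq_prD_iff {M : MatH} (hM : M ∈ unitary MatH) :
    conjD M = prD ↔ ∃ e f, M = diagH e f := by
  constructor
  · intro h
    have hc : M * prD = prD * M := by
      have := congrArg (· * M) h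
      simp only [conjD, mul_assoc, (Unitary.mem_iff.1 hM).1, mul_one] at this
      exact this
    have h1 := congrArg (ent 0 1) hc
    have h2 := congrArg (ent 1 0) hc
    simp only [prD, ent_mul, diagH_eq, ent_matL00, ent_matL01, ent_matL10, ent_matL11] at h1 h2
    refine ⟨ent 0 0 M, ent 1 1 M, ?_⟩
    rw [diagH_eq]
    refine MatH.ext2 rfl ?_ ?_ rfl
    · simpa using h1.symm
    · simpa using h2
  · rintro ⟨e, f, rfl⟩
    have := (diagH_mem_iff.1 hM).1.2
    unfold conjD prD
    rw [star_diagH, diagH_mul, diagH_mul]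
    simp [this]

end Lines

/-! ### The space of objects as a space of based paths of lines. -/

section Objects

/-- The objects of `String(5)/String(4)`. -/
abbrev QO : Type := string4to5.QOb

/-- The arrows of `String(5)/String(4)`. -/
abbrev QA : Type := string4to5.QAr

variable {Γ : Subgroup (unitary MatH)} {n : ℕ}

/-- A smooth function on the unit interval as an element of the path group. -/
def mkP0 (h : ℝ → MatH) (hs : ContDiffOn ℝ ∞ h (Icc 0 1))
    (hu : ∀ t ∈ Icc (0 : ℝ) 1, h t ∈ unitary MatH) (h0 : h 0 = 1)
    (hΓ : ∀ t (ht : t ∈ Icc (0 : ℝ) 1), (⟨h t, hu t ht⟩ : unitary MatH) ∈ Γ) : P0 Γ :=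
  ⟨fun t => ⟨h t, hu t t.2⟩, hs.congr fun t ht => by
    show h (prI t) = h t
    rw [coe_prI ht], Subtype.ext h0, fun t => hΓ t t.2⟩

lemma mkP0_ev {h : ℝ → MatH} {hs hu h0} {hΓ : ∀ t (ht : t ∈ Icc (0 : ℝ) 1),
    (⟨h t, hu t ht⟩ : unitary MatH) ∈ Γ} {t : ℝ} (ht : t ∈ Icc (0 : ℝ) 1) :
    (mkP0 h hs hu h0 hΓ).ev t = h t := by
  show h (prI t) = h t
  rw [coe_prI ht]

lemma P0.ev_mem (g : P0 Γ) (r : ℝ) : g.ev r ∈ unitary MatH := (g.1 (prI r)).2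

lemma P0.ev_l (g : P0 Γ) (r : ℝ) : star (g.ev r) * g.ev r = 1 := (Unitary.mem_iff.1 (g.ev_mem r)).1

lemma P0.ev_r (g : P0 Γ) (r : ℝ) : g.ev r * star (g.ev r) = 1 := (Unitary.mem_iff.1 (g.ev_mem r)).2

lemma P0.ev_zero (g : P0 Γ) : g.ev 0 = 1 := by
  show ((g.1 (prI 0) : unitary MatH) : MatH) = 1
  rw [prI_zero, g.2.2.1]; rfl

lemma P0.ext_ev {g g' : P0 Γ} (h : ∀ r ∈ Icc (0 : ℝ) 1, g.ev r = g'.ev r) : g = g' :=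
  P0.ext' fun t => Subtype.ext (by
    have := h t t.2
    simpa only [P0.ev, ext1, prI_coe] using this)

lemma isPlot_P0_iff {p : Eu n → P0 Γ} :
    IsPlot p ↔ ContDiffOn ℝ ∞ (fun z : Eu n × ℝ => (p z.1).ev z.2) (strip n) := Iff.rfl

lemma contDiffOn_strip_of_slice {V : Type*} [NormedAddCommGroup V] [NormedSpace ℝ V] {f : ℝ → V}
    (hf : ContDiffOn ℝ ∞ f (Icc 0 1)) : ContDiffOn ℝ ∞ (fun z : Eu n × ℝ => f z.2) (strip n) :=
  hf.comp contDiff_snd.contDiffOn fun z hz => hz.2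

lemma P0.ev_strip (g : P0 Γ) : ContDiffOn ℝ ∞ (fun z : Eu n × ℝ => g.ev z.2) (strip n) :=
  contDiffOn_strip_of_slice g.smu.sm

lemma contDiffOn_star {E : Type*} [NormedAddCommGroup E] [NormedSpace ℝ E] {f : E → MatH}
    {S : Set E} (hf : ContDiffOn ℝ ∞ f S) : ContDiffOn ℝ ∞ (fun x => star (f x)) S :=
  (starL' ℝ (A := MatH)).contDiff.comp_contDiffOn hf

lemma spin4_conjD (k : P0 Spin4) (r : ℝ) : conjD (k.ev r) = prD :=
  (conjD_eq_prD_iff (k.ev_mem r)).2 (k.2.2.2 (prI r))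

/-- The path of lines in `ℍ²` determined by an object of `String(5)/String(4)`, as a path of
orthogonal projections. -/
def obP (q : QO) : ℝ → MatH :=
  Quotient.liftOn' q (fun g r => conjD (g.ev r)) (by
    intro g g' h
    obtain ⟨k, rfl⟩ := string4to5.mkOb_eq.1 (Quotient.sound' h : string4to5.mkOb g = string4to5.mkOb g')
    funext r
    show conjD (g.ev r) = conjD (g.ev r * k.ev r)
    rw [conjD_mul, spin4_conjD]; rfl)

lemma obP_mk (g : P0 Spin5) (r : ℝ) : obP (string4to5.mkOb g) r = conjD (g.ev r) := rfl

/-- If g and g' give the same lines, then g⁻¹g' fixes the base line at each time and is therefore a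
path in Spin(4). -/
lemma obP_ext {q q' : QO} (h : ∀ r ∈ Icc (0 : ℝ) 1, obP q r = obP q' r) : q = q' := by
  obtain ⟨g, rfl⟩ := string4to5.mkOb_surjective q
  obtain ⟨g', rfl⟩ := string4to5.mkOb_surjective q'
  refine string4to5.mkOb_eq.2 ⟨⟨(g⁻¹ * g').1, (g⁻¹ * g').2.1, (g⁻¹ * g').2.2.1, fun t => ?_⟩, ?_⟩
  · refine (conjD_eq_prD_iff ((g⁻¹ * g').1 t).2).1 ?_
    have e := h t t.2
    rw [obP_mk, obP_mk] at e
    have e2 : (((g⁻¹ * g').1 t : unitary MatH) : MatH) = star (g.ev t) * g'.ev t := by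
      rw [← prI_coe t]
      simp only [prI_coe]
      show star ((g.1 t : unitary MatH) : MatH) * (g'.1 t : unitary MatH) = _
      simp only [P0.ev, ext1, prI_coe]
    rw [e2, conjD_mul, ← e]
    unfold conjD
    rw [star_star, ← mul_assoc, ← mul_assoc, g.ev_l, one_mul, mul_assoc, g.ev_l, mul_one]
  · exact (mul_inv_cancel_left g g').symm

lemma obP_zero (q : QO) : obP q 0 = prD := by
  obtain ⟨g, rfl⟩ := string4to5.mkOb_surjective q
  rw [obP_mk, g.ev_zero, conjD_one]

lemma obP_smooth (q : QO) : ContDiffOn ℝ ∞ (obP q) (Icc 0 1) := by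
  obtain ⟨g, rfl⟩ := string4to5.mkOb_surjective q
  exact conjD_contDiff.comp_contDiffOn g.smu.sm

lemma obP_strip_of_isPlot {p : Eu n → QO} (hp : IsPlot p) :
    ContDiffOn ℝ ∞ (fun z : Eu n × ℝ => obP (p z.1) z.2) (strip n) := by
  intro z hz
  obtain ⟨q, hq, e⟩ := (isPlot_quotient_iff (hπ := string4to5.mkOb_surjective)).1 hp z.1
  have h1 : ContDiffOn ℝ ∞ (fun z : Eu n × ℝ => conjD ((q z.1).ev z.2)) (strip n) :=
    conjD_contDiff.comp_contDiffOn (isPlot_P0_iff.1 hq)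
  refine (h1 z hz).congr_of_eventuallyEq ?_ ?_
  · filter_upwards [mem_nhdsWithin_of_mem_nhds (continuous_fst.continuousAt.eventually e)] with y hy
    rw [← hy]; rfl
  · rw [← e.self_of_nhds]; rfl

/-- The path of lines of an object, relative to a path `g` in `Sp(2)`. -/
def obRel (g : P0 Spin5) (q : QO) (r : ℝ) : MatH := star (g.ev r) * obP q r * g.ev r

lemma obRel_mk (g g' : P0 Spin5) (r : ℝ) :
    obRel g (string4to5.mkOb g') r = conjD (star (g.ev r) * g'.ev r) := by
  rw [conjD_mul, star_star]; rfl

lemma obRel_self (g : P0 Spin5) (r : ℝ) : obRel g (string4to5.mkOb g) r = prD := by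
  rw [obRel_mk, g.ev_l, conjD_one]

/-- Gives access to the lemmas on projections of the form M diag(1,0) M*, without choosing a
representative of the object each time. -/
lemma exists_obRel (g : P0 Spin5) (q : QO) (r : ℝ) :
    ∃ M ∈ unitary MatH, obRel g q r = conjD M := by
  obtain ⟨g', rfl⟩ := string4to5.mkOb_surjective q
  exact ⟨_, mul_mem (Unitary.star_mem (g.ev_mem r)) (g'.ev_mem r), obRel_mk g g' r⟩

lemma obRel_zero (g : P0 Spin5) (q : QO) : obRel g q 0 = prD := by
  unfold obRel
  rw [obP_zero, g.ev_zero, star_one, one_mul, mul_one]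

lemma obP_eq_obRel (g : P0 Spin5) (q : QO) (r : ℝ) :
    obP q r = g.ev r * obRel g q r * star (g.ev r) := by
  unfold obRel
  simp only [← mul_assoc, g.ev_r, one_mul]
  rw [mul_assoc, g.ev_r, mul_one]

lemma obRel_smooth (g : P0 Spin5) (q : QO) : ContDiffOn ℝ ∞ (obRel g q) (Icc 0 1) :=
  (g.smu.star_sm.mul (obP_smooth q)).mul g.smu.sm

lemma obRel_strip (g : P0 Spin5) {p : Eu n → QO}
    (hp : ContDiffOn ℝ ∞ (fun z : Eu n × ℝ => obP (p z.1) z.2) (strip n)) :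
    ContDiffOn ℝ ∞ (fun z : Eu n × ℝ => obRel g (p z.1) z.2) (strip n) :=
  ((contDiffOn_star g.ev_strip).mul hp).mul g.ev_strip

/-- The domain of the affine chart at `g`. -/
def obDom (g : P0 Spin5) : Set QO := {q | ∀ r ∈ Icc (0 : ℝ) 1, (ent 0 0 (obRel g q r)).re ≠ 0}

/-- The affine chart at `g`. -/
def obCo (g : P0 Spin5) (q : QO) (r : ℝ) : ℍ[ℝ] := affH (obRel g q r)

lemma obCo_isJet (g : P0 Spin5) {q : QO} (hq : q ∈ obDom g) : IsJet {0} (obCo g q) where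
  sm t ht := (affH_contDiffAt (hq t ht)).comp_contDiffWithinAt t (obRel_smooth g q t ht)
  van t ht := by
    obtain rfl : t = 0 := ht
    show affH (obRel g q (prI 0 : I)) = 0
    rw [prI_zero]
    show affH (obRel g q 0) = 0
    rw [obRel_zero, affH_prD]

lemma obCo_strip (g : P0 Spin5) {p : Eu n → QO} (hd : ∀ x, p x ∈ obDom g)
    (hp : ContDiffOn ℝ ∞ (fun z : Eu n × ℝ => obP (p z.1) z.2) (strip n)) :
    ContDiffOn ℝ ∞ (fun z : Eu n × ℝ => obCo g (p z.1) z.2) (strip n) := fun z hz =>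
  (affH_contDiffAt (hd z.1 z.2 hz.2)).comp_contDiffWithinAt z (obRel_strip g hp z hz)

/-- The path `g · sec w`. -/
def obLift (g : P0 Spin5) (w : ℝ → ℍ[ℝ]) (hw : IsJet {0} w) : P0 Spin5 :=
  mkP0 (fun r => g.ev r * sec (w r))
    (g.smu.sm.mul ((contDiff_sec (n := ⊤)).comp_contDiffOn hw.sm))
    (fun r _ => mul_mem (g.ev_mem r) (sec_mem _))
    (by
      have := hw.van 0 rfl
      rw [prI_zero] at this
      have h0 : w 0 = 0 := this
      rw [h0, sec_zero, g.ev_zero, mul_one])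
    fun _ _ => trivial

lemma obLift_ev (g : P0 Spin5) {w : ℝ → ℍ[ℝ]} (hw : IsJet {0} w) {r : ℝ}
    (hr : r ∈ Icc (0 : ℝ) 1) : (obLift g w hw).ev r = g.ev r * sec (w r) := mkP0_ev hr

lemma obRel_obLift (g : P0 Spin5) {w : ℝ → ℍ[ℝ]} (hw : IsJet {0} w) {r : ℝ}
    (hr : r ∈ Icc (0 : ℝ) 1) :
    obRel g (string4to5.mkOb (obLift g w hw)) r = conjD (sec (w r)) := by
  rw [obRel_mk, obLift_ev g hw hr, ← mul_assoc, g.ev_l, one_mul]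

lemma obLift_mem (g : P0 Spin5) {w : ℝ → ℍ[ℝ]} (hw : IsJet {0} w) :
    string4to5.mkOb (obLift g w hw) ∈ obDom g := fun r hr => by
  rw [obRel_obLift g hw hr]; exact re_conjD_sec_ne _

lemma obCo_obLift (g : P0 Spin5) {w : ℝ → ℍ[ℝ]} (hw : IsJet {0} w) {r : ℝ}
    (hr : r ∈ Icc (0 : ℝ) 1) : obCo g (string4to5.mkOb (obLift g w hw)) r = w r := by
  unfold obCo
  rw [obRel_obLift g hw hr, affH_conjD_sec]

lemma obP_of_obCo (g : P0 Spin5) {q : QO} (hq : q ∈ obDom g) {r : ℝ} (hr : r ∈ Icc (0 : ℝ) 1) :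
    obP q r = conjD (g.ev r * sec (obCo g q r)) := by
  have h0 := hq r hr
  rw [obP_eq_obRel g, conjD_mul]
  unfold obCo
  obtain ⟨M, hM, e⟩ := exists_obRel g q r
  rw [e] at h0 ⊢
  rw [conjD_sec_affH hM h0]

lemma mkOb_obLift (g : P0 Spin5) {q : QO} (hq : q ∈ obDom g) :
    string4to5.mkOb (obLift g (obCo g q) (obCo_isJet g hq)) = q :=
  obP_ext fun r hr => by rw [obP_mk, obLift_ev g _ hr, obP_of_obCo g hq hr]

/-- Over the domain of an affine chart, `obLift` is a section of the quotient map from paths in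
Sp(2), and this says that the section is smooth in families. -/
lemma obLift_isPlot (g : P0 Spin5) {w : Eu n → ℝ → ℍ[ℝ]} (hw : ∀ x, IsJet {0} (w x))
    (h : ContDiffOn ℝ ∞ (fun z : Eu n × ℝ => w z.1 z.2) (strip n)) :
    IsPlot (fun x => obLift g (w x) (hw x)) := by
  refine isPlot_P0_iff.2 (ContDiffOn.congr (g.ev_strip.mul
    ((contDiff_sec (n := ⊤)).comp_contDiffOn h)) fun z hz => ?_)
  exact obLift_ev g (hw z.1) hz.2

lemma mem_obDom_self (g : P0 Spin5) : string4to5.mkOb g ∈ obDom g := fun r _ => by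
  rw [obRel_self, re_prD]; exact one_ne_zero

/-- Avoiding the line at infinity over the compact interval is an open condition. It is stated for
families of paths of lines, since that such families are plots is yet to be shown. -/
lemma isOpen_obDom_preimage (g : P0 Spin5) {p : Eu n → QO}
    (hp : ContDiffOn ℝ ∞ (fun z : Eu n × ℝ => obP (p z.1) z.2) (strip n)) :
    IsOpen (p ⁻¹' obDom g) :=
  isOpen_forall_Icc (φ := fun z : Eu n × ℝ => (ent 0 0 (obRel g (p z.1) z.2)).re)
    (contDiff_re_ent.continuous.comp_continuousOn (obRel_strip g hp).continuousOn)
    isOpen_compl_singleton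

lemma mkOb_isPlot {g : Eu n → P0 Spin5} (hg : IsPlot g) :
    IsPlot fun x => string4to5.mkOb (g x) :=
  (isPlot_quotient_iff (hπ := string4to5.mkOb_surjective)).2 fun x => ⟨g, hg, Filter.EventuallyEq.rfl⟩

/-- A map to the space of objects is smooth if and only if it is a smooth family of paths of
lines. -/
theorem isPlot_ob_iff {p : Eu n → QO} :
    IsPlot p ↔ ContDiffOn ℝ ∞ (fun z : Eu n × ℝ => obP (p z.1) z.2) (strip n) := by
  refine ⟨obP_strip_of_isPlot, fun hp => isPlot_of_locally fun x => ?_⟩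
  obtain ⟨g, hg⟩ := string4to5.mkOb_surjective (p x)
  have hx : x ∈ p ⁻¹' obDom g := by
    show p x ∈ obDom g
    rw [← hg]; exact mem_obDom_self g
  -- Near x the family stays in the chart domain of a representative g of p(x). After shrinking it
  -- does so everywhere, and `obLift` produces the required lift to a plot of paths.
  obtain ⟨ρ, hρ, hm, e⟩ := exists_shrink ((isOpen_obDom_preimage g hp).mem_nhds hx)
  have hp' : ContDiffOn ℝ ∞ (fun z : Eu n × ℝ => obP (p (ρ z.1)) z.2) (strip n) :=
    hp.comp ((hρ.comp contDiff_fst).prodMk contDiff_snd).contDiffOn fun z hz => ⟨trivial, hz.2⟩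
  refine ⟨p ∘ ρ, ?_, e.fun_comp p⟩
  have h := mkOb_isPlot (obLift_isPlot g (fun y => obCo_isJet g (hm y))
    (obCo_strip g (p := p ∘ ρ) hm hp'))
  convert h using 1
  funext y
  exact (mkOb_obLift g (hm y)).symm

/-- The local lifts of smooth families of objects to smooth families of paths. -/
lemma exists_lift_ob {p : Eu n → QO} (hp : IsPlot p) (x : Eu n) :
    ∃ g : Eu n → P0 Spin5, IsPlot g ∧ (fun y => string4to5.mkOb (g y)) =ᶠ[𝓝 x] p :=
  (isPlot_quotient_iff (hπ := string4to5.mkOb_surjective)).1 hp x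

lemma obDom_open (g : P0 Spin5) : IsOpen[dTopology] (obDom g) :=
  isOpen_iff_preimages_plots.2 fun _ _ hp => isOpen_obDom_preimage g (isPlot_ob_iff.1 hp)

lemma obCo_strip_iff (g : P0 Spin5) {p : Eu n → QO} (hd : ∀ x, p x ∈ obDom g) :
    IsPlot p ↔ ContDiffOn ℝ ∞ (fun z : Eu n × ℝ => obCo g (p z.1) z.2) (strip n) := by
  refine ⟨fun hp => obCo_strip g hd (isPlot_ob_iff.1 hp), fun h => ?_⟩
  have h := mkOb_isPlot (obLift_isPlot g (fun y => obCo_isJet g (hd y)) h)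
  convert h using 1
  funext y
  exact (mkOb_obLift g (hd y)).symm

/-- The charts of the space of objects. -/
def obChart (g : P0 Spin5) : Chart QO (frechetJet ℍ[ℝ] {0}) where
  toFun q := mkJet {0} (obCo g q)
  invFun w := string4to5.mkOb (obLift g (Jet.fn w) (Jet.isJet w))
  source := obDom g
  -- The section `sec` is defined on all of ℍ, so every function vanishing at 0 is a coordinate.
  target := univ
  map_source' _ _ := trivial
  map_target' w _ := obLift_mem g _
  left_inv' q hq := by
    refine obP_ext fun r hr => ?_
    rw [obP_mk, obLift_ev g _ hr, mkJet_fn (obCo_isJet g hq) hr, obP_of_obCo g hq hr]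
  right_inv' w _ := mkJet_eq w fun r hr => obCo_obLift g _ hr
  open_source := obDom_open g
  open_target := isOpen_univ
  smooth n p hp := (obCo_strip_iff g hp).trans
    (forall_isCk_mkJet_iff fun x => obCo_isJet g (hp x)).symm

lemma continuous_obP {p : Eu n → QO} (hp : IsPlot p) {r : ℝ} (hr : r ∈ Icc (0 : ℝ) 1) :
    Continuous fun x => obP (p x) r :=
  (isPlot_ob_iff.1 hp).continuousOn.comp_continuous (f := fun x => (x, r)) (by fun_prop)
    fun x => ⟨trivial, hr⟩

/-- Objects are separated by the values of their paths of lines, which vary continuously along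
plots. -/
lemma ob_manifold : IsFrechetManifold QO where
  hausdorff := by
    refine t2Space_of_plots (f := fun (q : QO) (r : I) => obP q r) (fun q q' h => ?_)
      fun n p hp => continuous_pi fun r => continuous_obP hp r.2
    exact obP_ext fun r hr => congrFun h ⟨r, hr⟩
  charts q := by
    obtain ⟨g, rfl⟩ := string4to5.mkOb_surjective q
    exact ⟨_, obChart g, mem_obDom_self g⟩

end Objects

/-! ### Arrows: contraction of loops and spheres, and determination by source and target. -/

section Contractions

variable {Γ : Subgroup (unitary MatH)} {n : ℕ}

lemma diagH_commute (e f : ℍ[ℝ]) : Commute (diagH e f) prD := by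
  show diagH e f * diagH 1 0 = diagH 1 0 * diagH e f
  rw [diagH_mul, diagH_mul]; simp

lemma eq_diagH_of_commute {M : MatH} (h : Commute M prD) : ∃ e f, M = diagH e f := by
  have h1 := congrArg (ent 0 1) h.eq
  have h2 := congrArg (ent 1 0) h.eq
  simp only [prD, ent_mul, diagH_eq, ent_matL00, ent_matL01, ent_matL10, ent_matL11] at h1 h2
  refine ⟨ent 0 0 M, ent 1 1 M, ?_⟩
  rw [diagH_eq]
  refine MatH.ext2 rfl ?_ ?_ rfl
  · simpa using h1.symm
  · simpa using h2

/-- With a diagonal centre the contraction commutes with diag(1,0) throughout, so it does not leave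
Spin(4). -/
lemma contr_diagH {a y : MatH} (h : InDom a y) (ha : ∃ e f, a = diagH e f)
    (hy : ∃ e f, y = diagH e f) (s : ℝ) : ∃ e f, contr a s y = diagH e f := by
  obtain ⟨e, f, rfl⟩ := ha
  obtain ⟨e', f', rfl⟩ := hy
  refine eq_diagH_of_commute (h.contr_commute (diagH_commute _ _) ?_ (diagH_commute _ _) s)
  rw [star_diagH]; exact diagH_commute _ _

lemma contr_smooth {E : Type*} [NormedAddCommGroup E] [NormedSpace ℝ E] {S : Set E} {a : MatH}
    {τ : E → ℝ} {y : E → MatH} (hτ : ContDiffOn ℝ ∞ τ S) (hy : ContDiffOn ℝ ∞ y S)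
    (hd : ∀ x ∈ S, InDom a (y x)) : ContDiffOn ℝ ∞ (fun x => contr a (τ x) (y x)) S :=
  fun x hx => by
  have h1 := (hd x hx).contDiffAt (τ x)
  have h2 : ContDiffWithinAt ℝ ∞ (fun x => (τ x, y x)) S x := (hτ x hx).prodMk (hy x hx)
  exact ContDiffAt.comp_contDiffWithinAt (f := fun x => (τ x, y x)) x h1 h2

/-- A smooth function on the unit square as a path of loops. -/
def mkP0L0 (h : ℝ × ℝ → MatH) (hs : ContDiffOn ℝ ∞ h uSq)
    (hu : ∀ p ∈ uSq, h p ∈ unitary MatH) (h0 : ∀ r ∈ Icc (0 : ℝ) 1, h (0, r) = 1)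
    (h1 : ∀ s ∈ Icc (0 : ℝ) 1, h (s, 0) = 1) (h2 : ∀ s ∈ Icc (0 : ℝ) 1, h (s, 1) = 1)
    (hΓ : ∀ p (hp : p ∈ uSq), (⟨h p, hu p hp⟩ : unitary MatH) ∈ Γ) : P0L0 Γ :=
  ⟨fun p => ⟨h (p.1, p.2), hu _ ⟨p.1.2, p.2.2⟩⟩, hs.congr fun p hp => by
    show h (prI p.1, prI p.2) = h p
    rw [coe_prI hp.1, coe_prI hp.2], fun r => Subtype.ext (h0 r r.2),
    fun s => Subtype.ext (h1 s s.2), fun s => Subtype.ext (h2 s s.2), fun p => hΓ (p.1, p.2) ⟨p.1.2, p.2.2⟩⟩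

lemma mkP0L0_ev {h : ℝ × ℝ → MatH} {hs hu h0 h1 h2}
    {hΓ : ∀ p (hp : p ∈ uSq), (⟨h p, hu p hp⟩ : unitary MatH) ∈ Γ} {p : ℝ × ℝ} (hp : p ∈ uSq) :
    (mkP0L0 h hs hu h0 h1 h2 hΓ).ev p = h p := by
  show h (prI p.1, prI p.2) = h p
  rw [coe_prI hp.1, coe_prI hp.2]

/-- The loop `y` contracted by `contr a`. -/
def loopLift (a : MatH) (l : P0 Γ) (h1 : l.ev 1 = 1)
    (hd : ∀ r ∈ Icc (0 : ℝ) 1, InDom a (l.ev r))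
    (hΓ : ∀ p (hp : p ∈ uSq),
      (⟨contr a p.1 (l.ev p.2), (hd p.2 hp.2).contr_mem p.1⟩ : unitary MatH) ∈ Γ) : P0L0 Γ :=
  mkP0L0 (fun p => contr a p.1 (l.ev p.2))
    (contr_smooth contDiff_fst.contDiffOn (l.smu.sm.comp contDiff_snd.contDiffOn fun p hp => hp.2)
      fun p hp => hd p.2 hp.2)
    (fun p hp => (hd p.2 hp.2).contr_mem p.1) (fun r hr => (hd r hr).contr_zero)
    (fun s _ => by rw [l.ev_zero]; exact (hd 0 zero_mem01).contr_self s)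
    (fun s _ => by rw [h1]; exact (hd 0 zero_mem01).contr_self s) hΓ

lemma endP_loopLift {a : MatH} {l : P0 Γ} {h1 : l.ev 1 = 1}
    {hd : ∀ r ∈ Icc (0 : ℝ) 1, InDom a (l.ev r)} {hΓ : ∀ p (hp : p ∈ uSq),
      (⟨contr a p.1 (l.ev p.2), (hd p.2 hp.2).contr_mem p.1⟩ : unitary MatH) ∈ Γ} :
    endP (loopLift a l h1 hd hΓ) = l := by
  refine P0.ext_ev fun r hr => ?_
  rw [← endP_ev]
  exact (mkP0L0_ev (p := (1, r)) ⟨one_mem01, hr⟩).trans (hd r hr).contr_one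

/-- Loops in `Spin(4)` are smoothly contractible. -/
lemma exists_stringT_spin4 {k : P0 Spin4} (hk : k.ev 1 = 1) : ∃ m : LHat Spin4, stringT m = k := by
  obtain ⟨a, ha, hd⟩ := exists_inDom_diag k.smu.sm (fun r _ => k.ev_mem r)
    fun r _ => k.2.2.2 (prI r)
  have hΓ : ∀ p (hp : p ∈ uSq),
      (⟨contr a p.1 (k.ev p.2), (hd p.2 hp.2).contr_mem p.1⟩ : unitary MatH) ∈ Spin4 :=
    fun p hp => contr_diagH (hd p.2 hp.2) ha (k.2.2.2 (prI p.2)) p.1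
  exact ⟨LHat.mk ⟨loopLift a k hk hd hΓ, 1⟩,
    (stringT_mk _).trans (endP_loopLift (h1 := hk) (hd := hd) (hΓ := hΓ))⟩

/-- Spheres in `Spin(5)` are smoothly contractible. -/
lemma exists_isDisc {f : P0L0 Spin5} (hf : endP f = 1) : ∃ F, IsDisc F f := by
  obtain ⟨a, hd⟩ := exists_inDom_sq f.squ.smu.sm fun p _ => (f.1 (prI p.1, prI p.2)).2
  have hd' : ∀ p : I × I, InDom a (f.1 p : MatH) := fun p => by
    have := hd (p.1, p.2) ⟨p.1.2, p.2.2⟩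
    simpa only [P0L0.ev, ext2, prI_coe] using this
  -- On the whole boundary of the square f equals 1, the side s = 1 by `hf`. The contraction fixes
  -- 1, so these sides remain at 1 for all times.
  have hself : ∀ {p : I × I} (t : I), f.1 p = 1 → contr a t (f.1 p : MatH) = 1 := by
    intro p t h
    have h' := (hd' p).contr_self t
    rw [h]; exact h'
  refine ⟨fun p => ⟨contr a p.1 (f.1 p.2), (hd' p.2).contr_mem p.1⟩, ?_, fun _ => trivial,
    fun t r => Subtype.ext (hself t (f.2.2.1 r)), fun t r => Subtype.ext (hself t ?_),
    fun t s => Subtype.ext (hself t (f.2.2.2.1 s)), fun t s => Subtype.ext (hself t (f.2.2.2.2.1 s)),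
    fun p => Subtype.ext (hd' p).contr_zero, fun p => Subtype.ext (hd' p).contr_one⟩
  · refine ContDiffOn.congr (f := fun p : ℝ × ℝ × ℝ => contr a p.1 (f.ev p.2))
      (contr_smooth contDiff_fst.contDiffOn (f.squ.smu.sm.comp contDiff_snd.contDiffOn
        fun p hp => hp.2) fun p hp => hd p.2 hp.2) fun p hp => ?_
    show contr a (prI p.1) _ = _
    rw [coe_prI hp.1]; rfl
  · exact congrArg (fun g : P0 Spin5 => g.1 r) hf

/-- Elements of the kernel of `t` are given by phases. -/
lemma exists_phase {x : LHat Spin5} (hx : stringT x = 1) : ∃ z : Circle, x = LHat.mk ⟨1, z⟩ := by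
  obtain ⟨⟨f, z⟩, rfl⟩ := LHat.mk_surjective x
  obtain ⟨F, hF⟩ := exists_isDisc (f := f) hx
  -- The disc F makes (f, exp ∫ω) trivial modulo N; splitting it off leaves the constant loop with
  -- the corrected phase.
  refine ⟨z * (ph (rawW (ext3 F)))⁻¹, ?_⟩
  have h1 : LHat.mk (⟨f, ph (rawW (ext3 F))⟩ : Ext Spin5) = 1 :=
    (QuotientGroup.eq_one_iff _).2 ⟨F, hF, rfl⟩
  rw [← mul_one (LHat.mk ⟨1, _⟩), ← h1, ← map_mul]
  congr 1
  refine Ext.ext (one_mul f).symm ?_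
  rw [Ext.mul_phase, cocycle_one_left]
  simp

/-- The constant loop is fixed by conjugation, and the correction integral contains its derivative,
which is 0. -/
lemma stringAct_phase (g : P0 Spin5) (z : Circle) :
    stringAct g (LHat.mk ⟨1, z⟩) = LHat.mk ⟨1, z⟩ := by
  rw [stringAct_mk]
  congr 1
  refine Ext.ext ?_ ?_
  · show conjP g 1 = 1
    have h := conjP_mul g 1 1
    rw [one_mul] at h
    exact mul_eq_left.1 h.symm
  · show z * ph (rawX g.ev (1 : P0L0 Spin5).ev) = z
    rw [P0L0.ev_one, rawX_one_right, ph_zero, mul_one]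

/-- Multiplying by a value of t therefore leaves the endpoint of a path unchanged: this is why
arrows only join objects with the same endpoint. -/
lemma stringT_ev_one (x : LHat Γ) : (stringT x).ev 1 = 1 := by
  obtain ⟨a, rfl⟩ := LHat.mk_surjective x
  rw [stringT_mk, ← endP_ev]
  show ((a.path.1 (prI 1, prI 1) : unitary MatH) : MatH) = 1
  rw [prI_one, a.path.2.2.2.2.1]; rfl

/-- An arrow of `String(5)/String(4)` is determined by its source and its target. -/
theorem ar_ext {a b : QA} (hs : string4to5.qsrc a = string4to5.qsrc b)
    (ht : string4to5.qtgt a = string4to5.qtgt b) : a = b := by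
  obtain ⟨g, h, rfl⟩ := string4to5.exists_mk a
  obtain ⟨g', h', rfl⟩ := string4to5.exists_mk b
  obtain ⟨k, rfl⟩ := string4to5.mkOb_eq.1 ht
  obtain ⟨k', hk'⟩ := string4to5.mkOb_eq.1 hs
  change (stringT h'⁻¹ * (g * string4to5.e₀ k)) = stringT h⁻¹ * g * string4to5.e₀ k' at hk'
  -- Equality of the sources, solved for the discrepancy of the two Spin(4) paths. The right side is
  -- a loop, hence so is kk'⁻¹, and it lifts through t in String(4).
  have e1 : g * string4to5.e₀ (k * k'⁻¹) * g⁻¹ = stringT (h' * h⁻¹) := by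
    rw [map_inv, map_inv, inv_mul_eq_iff_eq_mul] at hk'
    rw [map_mul, map_inv, map_mul, map_inv, ← mul_assoc, hk']
    group
  have e2 : (k * k'⁻¹).ev 1 = 1 := by
    have h1 : (string4to5.e₀ (k * k'⁻¹) : P0 Spin5) = g⁻¹ * stringT (h' * h⁻¹) * g := by
      rw [← e1]; group
    have h2 := congrArg (fun q : P0 Spin5 => q.ev 1) h1
    simp only [P0.ev_mul, P0.ev_inv, stringT_ev_one, mul_one, g.ev_l] at h2
    exact h2
  obtain ⟨m, hm⟩ := exists_stringT_spin4 e2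
  -- Once the lift m is removed, the two arrows differ by an element of the kernel of t, which is a
  -- phase.
  have e3 : stringT (h' * h⁻¹ * (stringAct g (string4to5.e₁ m))⁻¹) = 1 := by
    have h3 := (stringCM Spin5).equivariant g (string4to5.e₁ m)
    change stringT (stringAct g (string4to5.e₁ m)) = g * stringT (string4to5.e₁ m) * g⁻¹ at h3
    have h4 : stringT (string4to5.e₁ m) = string4to5.e₀ (k * k'⁻¹) := by
      rw [← hm]; exact (string4to5.t_comm m).symm
    rw [map_mul, map_inv, h3, h4, ← e1, mul_inv_cancel]
  obtain ⟨z, hz⟩ := exists_phase e3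
  -- The phase also exists in String(4) and is fixed by the action of g, so it can be absorbed into
  -- m.
  refine string4to5.mkAr_eq.2 ⟨k, LHat.mk ⟨1, z⟩ * m, Prod.ext rfl ?_⟩
  show h' = stringAct g (string4to5.e₁ (LHat.mk ⟨1, z⟩ * m)) * h
  have e4 : string4to5.e₁ (LHat.mk ⟨1, z⟩) = LHat.mk ⟨1, z⟩ := rfl
  rw [map_mul, map_mul, e4, stringAct_phase, ← hz]
  group

lemma ends_eq (a : QA) : obP (string4to5.qsrc a) 1 = obP (string4to5.qtgt a) 1 := by
  obtain ⟨g, h, rfl⟩ := string4to5.exists_mk a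
  show conjD ((stringT h⁻¹ * g).ev 1) = conjD (g.ev 1)
  rw [P0.ev_mul]
  simp only [stringT_ev_one, one_mul]

lemma P0.contDiff_ev {g : Eu n → P0 Γ} (hg : IsPlot g) {r : ℝ} (hr : r ∈ Icc (0 : ℝ) 1) :
    ContDiff ℝ ∞ fun x => (g x).ev r :=
  contDiffOn_univ.1 ((isPlot_P0_iff.1 hg).comp
    (contDiff_id.prodMk contDiff_const).contDiffOn fun x _ => ⟨trivial, hr⟩)

lemma P0.isPlot_comp {g : Eu n → P0 Γ} (hg : IsPlot g) {ρ : Eu n → Eu n} (hρ : ContDiff ℝ ∞ ρ) :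
    IsPlot fun x => g (ρ x) := isPlot_reparam hg hρ

/-- Smooth families of elements of `Spin(4)` are locally the endpoints of smooth families of
paths. -/
lemma exists_spin4_paths {c : Eu n → MatH} (hc : ContDiff ℝ ∞ c)
    (hu : ∀ x, c x ∈ unitary MatH) (hdiag : ∀ x, ∃ e f, c x = diagH e f) (x : Eu n) :
    ∃ (ρ : Eu n → Eu n) (κ : Eu n → P0 Spin4), ContDiff ℝ ∞ ρ ∧ ρ =ᶠ[𝓝 x] id ∧ IsPlot κ ∧
      ∀ y, (κ y).ev 1 = c (ρ y) := by
  obtain ⟨a, ha, hd⟩ := exists_inDom_diag (f := fun _ => c x) contDiffOn_const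
    (fun _ _ => hu x) fun _ _ => hdiag x
  have h0 := hd 0 zero_mem01
  -- The domain of the contraction is open, so the centre chosen for c(x) serves all nearby values.
  obtain ⟨ρ, hρ, hm, e⟩ := exists_shrink
    (((isOpen_unit_dom a).preimage hc.continuous).mem_nhds h0.unit)
  have hd' : ∀ y, InDom a (c (ρ y)) := fun y => ⟨h0.a_mem, hu _, h0.a_unit, hm y⟩
  have hΓ : ∀ y, ∀ r ∈ Icc (0 : ℝ) 1,
      (⟨contr a r (c (ρ y)), (hd' y).contr_mem r⟩ : unitary MatH) ∈ Spin4 :=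
    fun y r _ => contr_diagH (hd' y) ha (hdiag _) r
  refine ⟨ρ, fun y => mkP0 (fun r => contr a r (c (ρ y)))
    (contr_smooth contDiffOn_id contDiffOn_const fun _ _ => hd' y)
    (fun r _ => (hd' y).contr_mem r) (hd' y).contr_zero (hΓ y), hρ, e, ?_, fun y => ?_⟩
  · refine isPlot_P0_iff.2 (ContDiffOn.congr (f := fun z : Eu n × ℝ => contr a z.2 (c (ρ z.1)))
      (contr_smooth contDiff_snd.contDiffOn ((hc.comp hρ).comp contDiff_fst).contDiffOn
        fun z _ => hd' z.1) fun z hz => mkP0_ev hz.2)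
  · exact (mkP0_ev one_mem01).trans (hd' y).contr_one

/-- A path is treated as a square that is constant in one variable. -/
lemma exists_inDom_path (l : P0 Spin5) : ∃ a : MatH, ∀ r ∈ Icc (0 : ℝ) 1, InDom a (l.ev r) := by
  obtain ⟨a, hd⟩ := exists_inDom_sq (f := fun p => l.ev p.2)
    (l.smu.sm.comp contDiff_snd.contDiffOn fun p hp => hp.2) fun p _ => l.ev_mem p.2
  exact ⟨a, fun r hr => hd (0, r) ⟨zero_mem01, hr⟩⟩

/-- Smooth families of loops in `Spin(5)` are locally the endpoints of smooth families of paths of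
loops. -/
lemma exists_spin5_loops {l : Eu n → P0 Spin5} (hl : IsPlot l) (h1 : ∀ x, (l x).ev 1 = 1)
    (x : Eu n) : ∃ (ρ : Eu n → Eu n) (f : Eu n → P0L0 Spin5), ContDiff ℝ ∞ ρ ∧
      ρ =ᶠ[𝓝 x] id ∧ IsPlot f ∧ ∀ y, endP (f y) = l (ρ y) := by
  obtain ⟨a, hd⟩ := exists_inDom_path (l x)
  have hs := isPlot_P0_iff.1 hl
  -- By compactness of the loop, the centre found for l(x) works for all loops with nearby
  -- parameters.
  have ho := isOpen_forall_Icc (φ := fun z : Eu n × ℝ => (l z.1).ev z.2) hs.continuousOn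
    (isOpen_unit_dom a)
  obtain ⟨ρ, hρ, hm, e⟩ := exists_shrink (ho.mem_nhds (x := x) fun r hr => (hd r hr).unit)
  have h0 := hd 0 zero_mem01
  have hd' : ∀ y, ∀ r ∈ Icc (0 : ℝ) 1, InDom a ((l (ρ y)).ev r) := fun y r hr =>
    ⟨h0.a_mem, (l (ρ y)).ev_mem r, h0.a_unit, hm y r hr⟩
  refine ⟨ρ, fun y => loopLift a (l (ρ y)) (h1 _) (hd' y) fun _ _ => trivial, hρ, e, ?_,
    fun y => endP_loopLift⟩
  refine ContDiffOn.congr (f := fun z : Eu n × (ℝ × ℝ) => contr a z.2.1 ((l (ρ z.1)).ev z.2.2))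
    (contr_smooth (contDiff_fst.comp contDiff_snd).contDiffOn ?_ fun z hz => hd' z.1 z.2.2 hz.2.2)
    fun z hz => mkP0L0_ev hz.2
  exact hs.comp ((hρ.comp contDiff_fst).prodMk (contDiff_snd.comp contDiff_snd)).contDiffOn
    fun z hz => ⟨trivial, hz.2.2⟩

lemma isPlot_P0_mul {g g' : Eu n → P0 Γ} (hg : IsPlot g) (hg' : IsPlot g') :
    IsPlot fun x => g x * g' x :=
  isPlot_P0_iff.2 ((isPlot_P0_iff.1 hg).mul (isPlot_P0_iff.1 hg'))

lemma isPlot_P0_inv {g : Eu n → P0 Γ} (hg : IsPlot g) : IsPlot fun x => (g x)⁻¹ :=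
  isPlot_P0_iff.2 (contDiffOn_star (isPlot_P0_iff.1 hg))

/-- Local existence of smooth families of arrows. -/
lemma exists_arrows {g g' : Eu n → P0 Spin5} (hg : IsPlot g) (hg' : IsPlot g')
    (h : ∀ x, conjD ((g x).ev 1) = conjD ((g' x).ev 1)) (x : Eu n) :
    ∃ (ρ : Eu n → Eu n) (q : Eu n → QA), ContDiff ℝ ∞ ρ ∧ ρ =ᶠ[𝓝 x] id ∧ IsPlot q ∧
      ∀ y, string4to5.qsrc (q y) = string4to5.mkOb (g (ρ y)) ∧
        string4to5.qtgt (q y) = string4to5.mkOb (g' (ρ y)) := by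
  have hu : ∀ x, star ((g x).ev 1) * (g' x).ev 1 ∈ unitary MatH := fun x =>
    mul_mem (Unitary.star_mem ((g x).ev_mem 1)) ((g' x).ev_mem 1)
  -- Both endpoints carry the base line to the same line, so they differ by an element of Spin(4). A
  -- path κ in Spin(4) ending there makes gκ and g' end at the same group element without changing
  -- the class of g.
  obtain ⟨ρ, κ, hρ, e, hκ, hκ1⟩ := exists_spin4_paths
    (c := fun x => star ((g x).ev 1) * (g' x).ev 1)
    (((starL' ℝ (A := MatH)).contDiff.comp (P0.contDiff_ev hg one_mem01)).mul
      (P0.contDiff_ev hg' one_mem01)) hu (fun x => (conjD_eq_prD_iff (hu x)).1 (by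
        rw [conjD_mul, ← h, ← conjD_mul, (g x).ev_l, conjD_one])) x
  have hgκ : IsPlot fun y => g (ρ y) * string4to5.e₀ (κ y) :=
    isPlot_P0_mul (P0.isPlot_comp hg hρ) hκ
  -- Now g'(gκ)⁻¹ is a loop and equals t of some [f, 1]. The arrow represented by (g', [f, 1]) has
  -- source represented by gκ.
  obtain ⟨ρ', f, hρ', e', hf, hf1⟩ := exists_spin5_loops
    (l := fun y => g' (ρ y) * (g (ρ y) * string4to5.e₀ (κ y))⁻¹)
    (isPlot_P0_mul (P0.isPlot_comp hg' hρ) (isPlot_P0_inv hgκ)) (fun y => by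
      have : (string4to5.e₀ (κ y)).ev 1 = _ := hκ1 y
      simp only [P0.ev_mul, P0.ev_inv, this]
      rw [← mul_assoc, (g (ρ y)).ev_r, one_mul, (g' (ρ y)).ev_r]) x
  have hx : ρ' x = x := e'.self_of_nhds
  refine ⟨ρ ∘ ρ', fun y => string4to5.mkAr (g' (ρ (ρ' y)), LHat.mk ⟨f y, 1⟩), hρ.comp hρ', ?_, ?_,
    fun y => ⟨?_, rfl⟩⟩
  · have hc : Filter.Tendsto ρ' (𝓝 x) (𝓝 x) := by
      have := hρ'.continuous.tendsto x
      rwa [hx] at this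
    filter_upwards [e', hc.eventually e] with y h1 h2
    show ρ (ρ' y) = y
    rw [h2]; exact h1
  · refine (isPlot_quotient_iff (hπ := string4to5.mkAr_surjective)).2 fun z =>
      ⟨fun y => (g' (ρ (ρ' y)), LHat.mk ⟨f y, 1⟩),
        ⟨P0.isPlot_comp (P0.isPlot_comp hg' hρ) hρ', ?_⟩, Filter.EventuallyEq.rfl⟩
    exact (isPlot_quotient_iff (hπ := LHat.mk_surjective)).2 fun z =>
      ⟨fun y => ⟨f y, 1⟩, ⟨hf, isPlot_const⟩, Filter.EventuallyEq.rfl⟩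
  · show string4to5.mkOb (stringT (LHat.mk ⟨f y, 1⟩)⁻¹ * g' (ρ (ρ' y))) = _
    rw [map_inv, stringT_mk, hf1]
    refine (string4to5.mkOb_eq.2 ⟨κ (ρ' y), ?_⟩).symm
    simp only [Function.comp_apply]
    group

/-- The case of a zero-dimensional parameter space. -/
lemma exists_arrow {x y : QO} (h : obP x 1 = obP y 1) :
    ∃ a : QA, string4to5.qsrc a = x ∧ string4to5.qtgt a = y := by
  obtain ⟨g, rfl⟩ := string4to5.mkOb_surjective x
  obtain ⟨g', rfl⟩ := string4to5.mkOb_surjective y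
  obtain ⟨ρ, q, -, -, -, hq⟩ := exists_arrows (n := 0) (g := fun _ => g) (g' := fun _ => g')
    isPlot_const isPlot_const (fun _ => h) 0
  exact ⟨q 0, hq 0⟩

/-- A plot of arrows is lifted twice, through the quotient defining arrows and then through the
quotient by N. The endpoint of the resulting path of loops is jointly smooth. -/
lemma src_smooth : DSmooth string4to5.qsrc := by
  intro n p hp
  refine isPlot_of_locally fun x => ?_
  obtain ⟨q, hq, e⟩ := (isPlot_quotient_iff (hπ := string4to5.mkAr_surjective)).1 hp x
  obtain ⟨h, hh, e'⟩ := (isPlot_quotient_iff (hπ := LHat.mk_surjective)).1 hq.2 x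
  have hf : IsPlot fun y => (h y).path := hh.1
  have hend : IsPlot fun y => endP (h y).path := by
    refine isPlot_P0_iff.2 (ContDiffOn.congr (f := fun z : Eu n × ℝ => (h z.1).path.ev (1, z.2))
      (ContDiffOn.comp (g := fun z : Eu n × (ℝ × ℝ) => (h z.1).path.ev z.2) hf
        (contDiff_fst.prodMk (contDiff_const.prodMk contDiff_snd)).contDiffOn
        fun z hz => ⟨trivial, one_mem01, hz.2⟩) fun z _ => (endP_ev _ _).symm)
  refine ⟨_, mkOb_isPlot (isPlot_P0_mul (isPlot_P0_inv hend) hq.1), ?_⟩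
  filter_upwards [e, e'] with y h1 h2
  show _ = string4to5.qsrc (p y)
  rw [← h1]
  show _ = string4to5.mkOb (stringT (q y).2⁻¹ * (q y).1)
  rw [← h2]
  rfl

lemma tgt_smooth : DSmooth string4to5.qtgt := by
  intro n p hp
  refine isPlot_of_locally fun x => ?_
  obtain ⟨q, hq, e⟩ := (isPlot_quotient_iff (hπ := string4to5.mkAr_surjective)).1 hp x
  exact ⟨_, mkOb_isPlot hq.1, by
    filter_upwards [e] with y h1
    show _ = string4to5.qtgt (p y)
    rw [← h1]
    rfl⟩

/-- A map to the space of arrows is smooth if and only if its source and its target are. -/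
theorem isPlot_ar_iff {p : Eu n → QA} : IsPlot p ↔
    IsPlot (string4to5.qsrc ∘ p) ∧ IsPlot (string4to5.qtgt ∘ p) := by
  refine ⟨fun h => ⟨src_smooth n p h, tgt_smooth n p h⟩, fun ⟨hs, ht⟩ =>
    isPlot_of_locally fun x => ?_⟩
  obtain ⟨g, hg, e⟩ := exists_lift_ob hs x
  obtain ⟨g', hg', e'⟩ := exists_lift_ob ht x
  -- Composition with τ makes the lifts represent source and target of p at every parameter, so
  -- their endpoint lines match and a smooth family of arrows exists. By uniqueness of arrows it
  -- agrees with p near x.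
  obtain ⟨τ, hτ, hm, eτ⟩ := exists_shrink (e.and e')
  obtain ⟨ρ, q, hρ, eρ, hq, hst⟩ := exists_arrows (P0.isPlot_comp hg hτ) (P0.isPlot_comp hg' hτ)
    (fun y => by
      have h1 : string4to5.mkOb (g (τ y)) = _ := (hm y).1
      have h2 : string4to5.mkOb (g' (τ y)) = _ := (hm y).2
      rw [← obP_mk, ← obP_mk, h1, h2]
      exact ends_eq _) x
  refine ⟨q, hq, ?_⟩
  have hx : ρ x = x := eρ.self_of_nhds
  have hc : Filter.Tendsto ρ (𝓝 x) (𝓝 x) := by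
    have := hρ.continuous.tendsto x
    rwa [hx] at this
  filter_upwards [eρ, hc.eventually eτ] with y h1 h2
  have h3 : τ (ρ y) = y := by rw [h2]; exact h1
  have h4 := hm (ρ y)
  rw [h3] at h4
  refine ar_ext ?_ ?_
  · rw [(hst y).1, h3]; exact h4.1
  · rw [(hst y).2, h3]; exact h4.2

end Contractions

/-! ### Charts on spaces of pairs of paths with a common endpoint. -/

section PairSpaces

variable {X : Type} [DiffeologicalSpace X] {n : ℕ}

/-- The space `X` with the maps `σ, τ` is the space of pairs of objects with equal endpoints. -/
structure PairSpace (src tgt : X → QO) : Prop where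
  ends : ∀ x, obP (src x) 1 = obP (tgt x) 1
  ext : ∀ {x y}, src x = src y → tgt x = tgt y → x = y
  ex : ∀ {x y : QO}, obP x 1 = obP y 1 → ∃ a, src a = x ∧ tgt a = y
  plot : ∀ {n : ℕ} {p : Eu n → X}, IsPlot p ↔ IsPlot (src ∘ p) ∧ IsPlot (tgt ∘ p)

/-- The axioms are symmetric, so one construction of charts serves both source and target. The
abstraction also covers the fibre product in the essential surjectivity of the identity functor. -/
lemma PairSpace.symm {src tgt : X → QO} (h : PairSpace src tgt) : PairSpace tgt src :=
  ⟨fun x => (h.ends x).symm, fun h1 h2 => h.ext h2 h1, fun h1 => by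
    obtain ⟨a, h2, h3⟩ := h.ex h1.symm
    exact ⟨a, h3, h2⟩, h.plot.trans and_comm⟩

/-- Representatives are read off from an arrow: they differ by a value of t, which is a loop. Equal
endpoints in the group, not only equal lines, are needed for the charts of pairs. -/
lemma exists_common_end {x y : QO} (h : obP x 1 = obP y 1) : ∃ g g' : P0 Spin5,
    string4to5.mkOb g = x ∧ string4to5.mkOb g' = y ∧ g.ev 1 = g'.ev 1 := by
  obtain ⟨a, rfl, rfl⟩ := exists_arrow h
  obtain ⟨g, b, rfl⟩ := string4to5.exists_mk a
  refine ⟨stringT b⁻¹ * g, g, rfl, rfl, ?_⟩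
  rw [P0.ev_mul]
  simp only [stringT_ev_one, one_mul]

lemma IsJet.zero_of_mem {T : Set ℝ} {w : ℝ → ℍ[ℝ]} (h : IsJet T w) {t : ℝ} (ht : t ∈ T)
    (ht' : t ∈ Icc (0 : ℝ) 1) : w t = 0 := by
  have := h.van t ht
  rwa [coe_prI ht'] at this

lemma zero_one_mem {t : ℝ} (ht : t ∈ ({0, 1} : Set ℝ)) : t ∈ Icc (0 : ℝ) 1 := by
  rcases ht with rfl | rfl
  · exact zero_mem01
  · exact one_mem01

lemma isJet_of {T : Set ℝ} (hT : T ⊆ Icc (0 : ℝ) 1) {w : ℝ → ℍ[ℝ]}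
    (hs : ContDiffOn ℝ ∞ w (Icc 0 1)) (h : ∀ t ∈ T, w t = 0) : IsJet T w :=
  ⟨hs, fun t ht => by rw [coe_prI (hT ht), h t ht]⟩

lemma singleton_subset01 : ({0} : Set ℝ) ⊆ Icc (0 : ℝ) 1 := by
  rintro t rfl
  exact zero_mem01

lemma obCo_zero (g : P0 Spin5) (q : QO) : obCo g q 0 = 0 := by
  unfold obCo
  rw [obRel_zero, affH_prD]

variable {src tgt : X → QO} {g g' : P0 Spin5}

/-- Both paths end at the same line, and the affine coordinates relative to g and g' coincide at
time 1 because g(1) = g'(1). -/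
lemma PairSpace.co_one (h : PairSpace src tgt) (hg : g.ev 1 = g'.ev 1) (x : X) :
    obCo g' (tgt x) 1 = obCo g (src x) 1 := by
  unfold obCo obRel
  rw [hg, h.ends]

lemma PairSpace.isJet_sub (h : PairSpace src tgt) (hg : g.ev 1 = g'.ev 1) {x : X}
    (h1 : src x ∈ obDom g) (h2 : tgt x ∈ obDom g') :
    IsJet {0, 1} (fun r => obCo g' (tgt x) r - obCo g (src x) r) := by
  refine isJet_of (fun t => zero_one_mem) ((obCo_isJet g' h2).sm.sub (obCo_isJet g h1).sm) ?_
  rintro t (rfl | rfl)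
  · rw [obCo_zero, obCo_zero, sub_zero]
  · rw [h.co_one hg, sub_self]

lemma isJet_fn_add (w : Jet ℍ[ℝ] {0}) (w' : Jet ℍ[ℝ] {0, 1}) :
    IsJet {0} (fun r => Jet.fn w' r + Jet.fn w r) := by
  refine isJet_of singleton_subset01 ((Jet.contDiffOn_fn w').add (Jet.contDiffOn_fn w)) ?_
  rintro t rfl
  rw [(Jet.isJet w').zero_of_mem (by simp) zero_mem01, (Jet.isJet w).zero_of_mem rfl zero_mem01,
    add_zero]

lemma PairSpace.ex_inv (h : PairSpace src tgt) (hg : g.ev 1 = g'.ev 1)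
    (w : Jet ℍ[ℝ] {0} × Jet ℍ[ℝ] {0, 1}) : ∃ x,
    src x = string4to5.mkOb (obLift g (Jet.fn w.1) (Jet.isJet w.1)) ∧
    tgt x = string4to5.mkOb (obLift g' _ (isJet_fn_add w.1 w.2)) :=
  h.ex (by
    rw [obP_mk, obP_mk, obLift_ev _ _ one_mem01, obLift_ev _ _ one_mem01, hg,
      (Jet.isJet w.2).zero_of_mem (by simp) one_mem01, zero_add])

/-- Charts for spaces of pairs. -/
def PairSpace.chart (h : PairSpace src tgt) (hg : g.ev 1 = g'.ev 1) :
    Chart X (frechetJet ℍ[ℝ] {0} × frechetJet ℍ[ℝ] {0, 1}) where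
  -- The difference of the two coordinates vanishes at 0 and at 1. Using it as second coordinate
  -- turns the common endpoint condition into a linear one and leaves the chart of the source as the
  -- first component.
  toFun x := (mkJet {0} (obCo g (src x)),
    mkJet {0, 1} (fun r => obCo g' (tgt x) r - obCo g (src x) r))
  invFun w := (h.ex_inv hg w).choose
  source := {x | src x ∈ obDom g ∧ tgt x ∈ obDom g'}
  target := univ
  map_source' _ _ := trivial
  map_target' w _ := by
    obtain ⟨h1, h2⟩ := (h.ex_inv hg w).choose_spec
    refine ⟨?_, ?_⟩
    · rw [h1]; exact obLift_mem g _
    · rw [h2]; exact obLift_mem g' _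
  left_inv' x hx := by
    obtain ⟨h1, h2⟩ := (h.ex_inv hg (mkJet {0} (obCo g (src x)),
      mkJet {0, 1} (fun r => obCo g' (tgt x) r - obCo g (src x) r))).choose_spec
    refine h.ext (h1.trans ?_) (h2.trans ?_)
    · refine obP_ext fun r hr => ?_
      rw [obP_mk, obLift_ev g _ hr, mkJet_fn (obCo_isJet g hx.1) hr, obP_of_obCo g hx.1 hr]
    · refine obP_ext fun r hr => ?_
      rw [obP_mk, obLift_ev g' _ hr, mkJet_fn (obCo_isJet g hx.1) hr,
        mkJet_fn (h.isJet_sub hg hx.1 hx.2) hr, sub_add_cancel, obP_of_obCo g' hx.2 hr]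
  right_inv' w _ := by
    obtain ⟨h1, h2⟩ := (h.ex_inv hg w).choose_spec
    refine Prod.ext (mkJet_eq w.1 fun r hr => ?_) (mkJet_eq w.2 fun r hr => ?_)
    · rw [h1]; exact obCo_obLift g _ hr
    · dsimp only
      rw [h1, h2, obCo_obLift g _ hr, obCo_obLift g' _ hr, add_sub_cancel_right]
  open_source := isOpen_iff_preimages_plots.2 fun n p hp =>
    (isOpen_obDom_preimage g (isPlot_ob_iff.1 (h.plot.1 hp).1)).inter
      (isOpen_obDom_preimage g' (isPlot_ob_iff.1 (h.plot.1 hp).2))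
  open_target := isOpen_univ
  smooth n p hp := by
    refine h.plot.trans (Iff.trans ?_ isCk_prod.symm)
    refine Iff.trans ?_ (and_congr (forall_isCk_mkJet_iff fun x => obCo_isJet g (hp x).1).symm
      (forall_isCk_mkJet_iff fun x => h.isJet_sub hg (hp x).1 (hp x).2).symm)
    rw [obCo_strip_iff g (p := src ∘ p) fun x => (hp x).1,
      obCo_strip_iff g' (p := tgt ∘ p) fun x => (hp x).2]
    refine ⟨fun hh => ⟨hh.1, hh.2.sub hh.1⟩, fun hh => ⟨hh.1, (hh.2.add hh.1).congr fun z _ => ?_⟩⟩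
    exact (sub_add_cancel _ _).symm

lemma PairSpace.submersion (h : PairSpace src tgt) : IsSubmersion src := by
  intro x
  obtain ⟨g, g', h1, h2, hg⟩ := exists_common_end (h.ends x)
  refine ⟨_, _, h.chart hg, obChart g, ⟨?_, ?_⟩, fun y hy => hy.1, fun y hy => rfl⟩
  · rw [← h1]; exact mem_obDom_self g
  · rw [← h2]; exact mem_obDom_self g'

lemma PairSpace.manifold (h : PairSpace src tgt) : IsFrechetManifold X where
  hausdorff := by
    refine t2Space_of_plots (f := fun (x : X) (r : I) => (obP (src x) r, obP (tgt x) r))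
      (fun x y hxy => ?_) fun n p hp => continuous_pi fun r =>
        (continuous_obP (h.plot.1 hp).1 r.2).prodMk (continuous_obP (h.plot.1 hp).2 r.2)
    have := fun r (hr : r ∈ Icc (0 : ℝ) 1) => Prod.ext_iff.1 (congrFun hxy ⟨r, hr⟩)
    exact h.ext (obP_ext fun r hr => (this r hr).1) (obP_ext fun r hr => (this r hr).2)
  charts x := by
    obtain ⟨g, g', h1, h2, hg⟩ := exists_common_end (h.ends x)
    refine ⟨FrechetSpace.prod (frechetJet ℍ[ℝ] {0}) (frechetJet ℍ[ℝ] {0, 1}), h.chart hg, ?_, ?_⟩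
    · rw [← h1]; exact mem_obDom_self g
    · rw [← h2]; exact mem_obDom_self g'

lemma arrows_pairSpace : PairSpace string4to5.qsrc string4to5.qtgt :=
  ⟨ends_eq, ar_ext, exists_arrow, isPlot_ar_iff⟩

/-- `String(5)/String(4)` is a Lie groupoid. -/
theorem isLieGroupoid_stringQuotient : IsLieGroupoid stringQuotient where
  ob := ob_manifold
  ar := arrows_pairSpace.manifold
  smooth_src := src_smooth
  smooth_tgt := tgt_smooth
  submersion_src := arrows_pairSpace.submersion
  submersion_tgt := arrows_pairSpace.symm.submersion
  -- Since smoothness of maps into the space of arrows is tested on source and target, the groupoid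
  -- axioms reduce each structure map to `src` and `tgt`.
  smooth_one n p hp := by
    refine isPlot_ar_iff.2 ⟨?_, ?_⟩
    · convert hp using 1
      exact funext fun x => stringQuotient.src_one (p x)
    · convert hp using 1
      exact funext fun x => stringQuotient.tgt_one (p x)
  smooth_inv n p hp := by
    refine isPlot_ar_iff.2 ⟨?_, ?_⟩
    · convert tgt_smooth n p hp using 1
      exact funext fun x => stringQuotient.src_inv (p x)
    · convert src_smooth n p hp using 1
      exact funext fun x => stringQuotient.tgt_inv (p x)
  smooth_comp n p hp := by
    refine isPlot_ar_iff.2 ⟨?_, ?_⟩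
    · convert src_smooth n _ hp.2 using 1
      exact funext fun x => stringQuotient.src_comp _ _ (p x).2
    · convert tgt_smooth n _ hp.1 using 1
      exact funext fun x => stringQuotient.tgt_comp _ _ (p x).2

end PairSpaces

/-! ### The identification ℍP¹ ≅ S⁴ and the endpoint functor. -/

section Sphere

variable {n : ℕ}

/-- The point of `ℝ⁵` determined by a projection. -/
def vecS (P : MatH) : EuclideanSpace ℝ (Fin 5) :=
  WithLp.toLp 2 ![2 * (ent 0 0 P).re - 1, 2 * (ent 1 0 P).re, 2 * (ent 1 0 P).imI,
    2 * (ent 1 0 P).imJ, 2 * (ent 1 0 P).imK]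

/-- The quaternion formed by the last four coordinates, halved. -/
def quatS (v : EuclideanSpace ℝ (Fin 5)) : ℍ[ℝ] :=
  (v 1 / 2) • 1 + imH (v 2 / 2, v 3 / 2, v 4 / 2)

/-- The projection determined by a point of `ℝ⁵`. -/
def frS (v : EuclideanSpace ℝ (Fin 5)) : MatH :=
  matL (((1 + v 0) / 2) • 1, star (quatS v), quatS v, ((1 - v 0) / 2) • 1)

lemma contDiff_vecS : ContDiff ℝ ∞ vecS := by
  rw [contDiff_euclidean]
  have h1 : ContDiff ℝ ∞ fun P : MatH => ent 1 0 P := (ent 1 0).contDiff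
  have hre : ContDiff ℝ ∞ fun P : MatH => (ent 1 0 P).re := reL.contDiff.comp h1
  have hco : ContDiff ℝ ∞ fun P : MatH => coH (ent 1 0 P) := coH.contDiff.comp h1
  intro i
  fin_cases i
  · exact (contDiff_const.mul contDiff_re_ent).sub contDiff_const
  · exact contDiff_const.mul hre
  · exact contDiff_const.mul (contDiff_fst.comp hco)
  · exact contDiff_const.mul (contDiff_fst.comp (contDiff_snd.comp hco))
  · exact contDiff_const.mul (contDiff_snd.comp (contDiff_snd.comp hco))

lemma contDiff_coord (i : Fin 5) : ContDiff ℝ ∞ fun v : EuclideanSpace ℝ (Fin 5) => v i :=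
  (EuclideanSpace.proj (𝕜 := ℝ) i).contDiff

lemma contDiff_quatS : ContDiff ℝ ∞ quatS := by
  have h := contDiff_coord
  refine (((h 1).div_const 2).smul contDiff_const).add (imH.contDiff.comp ?_)
  exact ((h 2).div_const 2).prodMk (((h 3).div_const 2).prodMk ((h 4).div_const 2))

lemma contDiff_frS : ContDiff ℝ ∞ frS := by
  have h := contDiff_coord
  refine matL.contDiff.comp (ContDiff.prodMk ?_ (ContDiff.prodMk
    ((starL' ℝ (A := ℍ[ℝ])).contDiff.comp contDiff_quatS) (contDiff_quatS.prodMk ?_)))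
  · exact ((contDiff_const.add (h 0)).div_const 2).smul contDiff_const
  · exact ((contDiff_const.sub (h 0)).div_const 2).smul contDiff_const

lemma quatS_vecS (P : MatH) : quatS (vecS P) = ent 1 0 P := by
  ext <;> simp [quatS, vecS, re_imH, imI_imH, imJ_imH, imK_imH]

lemma vecS_frS (v : EuclideanSpace ℝ (Fin 5)) : vecS (frS v) = v := by
  ext i
  fin_cases i <;>
    simp [vecS, frS, quatS, re_imH, imI_imH, imJ_imH, imK_imH] <;> ring

/-- The diagonal entries |a|² and |b|² of the projection add up to 1, so the first coordinate
recovers both. -/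
lemma frS_vecS {M : MatH} (hM : M ∈ unitary MatH) : frS (vecS (conjD M)) = conjD M := by
  have hn := norm_col hM
  unfold frS
  rw [quatS_vecS]
  have h0 : vecS (conjD M) 0 = 2 * (ent 0 0 (conjD M)).re - 1 := rfl
  rw [h0, re_conjD]
  conv_rhs => rw [conjD_eq]
  rw [conjD_eq, ent_matL10, self_mul_star_re, self_mul_star_re, star_mul, star_star]
  have e1 : (1 + (2 * ‖ent 0 0 M‖ ^ 2 - 1)) / 2 = ‖ent 0 0 M‖ ^ 2 := by ring
  have e2 : (1 - (2 * ‖ent 0 0 M‖ ^ 2 - 1)) / 2 = ‖ent 1 0 M‖ ^ 2 := by linarith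
  rw [e1, e2, ← Quaternion.coe_mul_eq_smul, ← Quaternion.coe_mul_eq_smul, mul_one, mul_one]

lemma norm_sq_quat (q : ℍ[ℝ]) : ‖q‖ ^ 2 = q.re ^ 2 + q.imI ^ 2 + q.imJ ^ 2 + q.imK ^ 2 := by
  rw [sq, ← Quaternion.normSq_eq_norm_mul_self, Quaternion.normSq_def']

/-- With |a|² + |b|² = 1 this is the identity (2|a|² - 1)² + 4|a|²|b|² = 1. -/
lemma vecS_mem {M : MatH} (hM : M ∈ unitary MatH) :
    vecS (conjD M) ∈ Metric.sphere (0 : EuclideanSpace ℝ (Fin 5)) 1 := by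
  have hn := norm_col hM
  rw [mem_sphere_zero_iff_norm, ← sq_eq_sq₀ (norm_nonneg _) zero_le_one, EuclideanSpace.norm_sq_eq,
    Fin.sum_univ_five]
  have e : ‖ent 1 0 (conjD M)‖ ^ 2 = ‖ent 0 0 M‖ ^ 2 * ‖ent 1 0 M‖ ^ 2 := by
    rw [conjD_eq, ent_matL10, norm_mul, Quaternion.norm_star]; ring
  rw [norm_sq_quat] at e
  have h0 : vecS (conjD M) 0 = 2 * ‖ent 0 0 M‖ ^ 2 - 1 := by rw [← re_conjD]; rfl
  have h1 : vecS (conjD M) 1 = 2 * (ent 1 0 (conjD M)).re := rfl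
  have h2 : vecS (conjD M) 2 = 2 * (ent 1 0 (conjD M)).imI := rfl
  have h3 : vecS (conjD M) 3 = 2 * (ent 1 0 (conjD M)).imJ := rfl
  have h4 : vecS (conjD M) 4 = 2 * (ent 1 0 (conjD M)).imK := rfl
  rw [h0, h1, h2, h3, h4]
  simp only [Real.norm_eq_abs, sq_abs]
  have hn' : ‖ent 1 0 M‖ ^ 2 = 1 - ‖ent 0 0 M‖ ^ 2 := by linarith
  rw [hn'] at e
  linear_combination 4 * e

/-- Every point of the sphere comes from a quaternionic line. -/
lemma exists_frS (y : S4) : ∃ M ∈ unitary MatH, frS y.1 = conjD M := by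
  have hy : ‖y.1‖ ^ 2 = 1 := by
    rw [mem_sphere_zero_iff_norm.1 y.2, one_pow]
  rw [EuclideanSpace.norm_sq_eq, Fin.sum_univ_five] at hy
  simp only [Real.norm_eq_abs, sq_abs] at hy
  generalize y.1 = v at hy
  have hq : ‖quatS v‖ ^ 2 = (1 - v 0 ^ 2) / 4 := by
    rw [norm_sq_quat]
    simp [quatS, re_imH, imI_imH, imJ_imH, imK_imH]
    linear_combination (1 / 4) * hy
  -- The excluded pole is the line ℍe₂ at infinity; the matrix given for it takes e₁ to e₂.
  by_cases h0 : 1 + v 0 = 0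
  · refine ⟨matL (0, -1, 1, 0), ?_, ?_⟩
    · rw [Unitary.mem_iff, star_matL, matL_mul, matL_mul]
      constructor <;> refine MatH.ext2 ?_ ?_ ?_ ?_ <;> simp
    · have hv : v 0 = -1 := by linarith
      have hq0 : quatS v = 0 := by
        rw [← norm_eq_zero, ← sq_eq_zero_iff, hq, hv]; norm_num
      unfold frS
      rw [conjD_eq, hq0, hv]
      refine MatH.ext2 ?_ ?_ ?_ ?_ <;> simp
  -- The affine coordinate is the quotient of the lower left entry of the projection by the upper
  -- left entry (1 + v 0)/2.
  · set u := (2 / (1 + v 0)) • quatS v with hu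
    refine ⟨sec u, sec_mem u, ?_⟩
    have hun : ‖u‖ ^ 2 = (1 - v 0) / (1 + v 0) := by
      rw [hu, norm_smul, mul_pow, hq, Real.norm_eq_abs, sq_abs]
      field_simp
      ring
    have e1 : (1 + ‖u‖ ^ 2)⁻¹ = (1 + v 0) / 2 := by
      rw [hun]; field_simp; ring
    rw [conjD_sec, e1, ← map_smul, hun, hu]
    unfold frS
    congr 1
    simp only [Prod.smul_mk, Quaternion.star_smul, smul_smul]
    have e2 : (1 + v 0) / 2 * (2 / (1 + v 0)) = 1 := by field_simp
    rw [e2, one_smul, one_smul]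
    refine Prod.ext rfl (Prod.ext rfl (Prod.ext rfl ?_))
    dsimp only
    rw [← Quaternion.coe_mul_eq_smul, ← Quaternion.coe_mul_eq_smul, ← Quaternion.coe_mul, mul_one]
    congr 1
    field_simp

/-- The endpoint map from the space of objects to the 4-sphere. -/
def endpt (q : QO) : S4 := ⟨vecS (obP q 1), by
  obtain ⟨g, rfl⟩ := string4to5.mkOb_surjective q
  exact vecS_mem (g.ev_mem 1)⟩

lemma frS_endpt (q : QO) : frS (endpt q).1 = obP q 1 := by
  obtain ⟨g, rfl⟩ := string4to5.mkOb_surjective q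
  exact frS_vecS (g.ev_mem 1)

lemma endpt_eq_iff {q q' : QO} : endpt q = endpt q' ↔ obP q 1 = obP q' 1 :=
  ⟨fun h => by rw [← frS_endpt, h, frS_endpt], fun h => Subtype.ext (congrArg vecS h)⟩

lemma isPlot_S4_iff {p : Eu n → S4} : IsPlot p ↔ ContDiff ℝ ∞ fun x => (p x).1 := Iff.rfl

lemma obP_one_contDiff {p : Eu n → QO} (hp : IsPlot p) : ContDiff ℝ ∞ fun x => obP (p x) 1 :=
  contDiffOn_univ.1 ((isPlot_ob_iff.1 hp).comp
    (contDiff_id.prodMk contDiff_const).contDiffOn fun x _ => ⟨trivial, one_mem01⟩)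

lemma endpt_smooth : DSmooth endpt := fun n p hp =>
  isPlot_S4_iff.2 (contDiff_vecS.comp (obP_one_contDiff hp))

lemma exists_path {M : MatH} (hM : M ∈ unitary MatH) : ∃ g : P0 Spin5, g.ev 1 = M := by
  obtain ⟨a, hd⟩ := exists_inDom_sq (f := fun _ => M) contDiffOn_const fun _ _ => hM
  have h0 := hd 0 ⟨zero_mem01, zero_mem01⟩
  exact ⟨mkP0 (fun r => contr a r M) (contr_smooth contDiffOn_id contDiffOn_const fun _ _ => h0)
    (fun r _ => h0.contr_mem r) h0.contr_zero fun _ _ => trivial,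
    (mkP0_ev one_mem01).trans h0.contr_one⟩

/-- Every line is the image of the base line under a unitary matrix, and `contr` joins that matrix
to 1. -/
lemma endpt_surjective : Function.Surjective endpt := fun y => by
  obtain ⟨M, hM, e⟩ := exists_frS y
  obtain ⟨g, rfl⟩ := exists_path hM
  refine ⟨string4to5.mkOb g, Subtype.ext ?_⟩
  show vecS (conjD (g.ev 1)) = y.1
  rw [← e, vecS_frS]

/-- The affine coordinate on the sphere relative to `k`. -/
def sphRel (k : MatH) (y : S4) : MatH := star k * frS y.1 * k

/-- The chart of the sphere at g(1) is the time 1 value of the chart of objects at g, so the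
endpoint map becomes evaluation at 1 in coordinates. -/
lemma sphRel_endpt (g : P0 Spin5) (q : QO) : sphRel (g.ev 1) (endpt q) = obRel g q 1 := by
  unfold sphRel obRel
  rw [frS_endpt]

lemma sphRel_contDiff (k : MatH) {p : Eu n → S4} (hp : IsPlot p) :
    ContDiff ℝ ∞ fun x => sphRel k (p x) :=
  (contDiff_const.mul (contDiff_frS.comp (isPlot_S4_iff.1 hp))).mul contDiff_const

/-- The point of the sphere with affine coordinate `u` relative to `k`. -/
def sphInv (k : MatH) (hk : k ∈ unitary MatH) (u : ℍ[ℝ]) : S4 :=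
  ⟨vecS (conjD (k * sec u)), vecS_mem (mul_mem hk (sec_mem u))⟩

lemma sphRel_sphInv {k : MatH} (hk : k ∈ unitary MatH) (u : ℍ[ℝ]) :
    sphRel k (sphInv k hk u) = conjD (sec u) := by
  show star k * frS (vecS (conjD (k * sec u))) * k = _
  rw [frS_vecS (mul_mem hk (sec_mem u)), conjD_mul, ← mul_assoc, ← mul_assoc,
    (Unitary.mem_iff.1 hk).1, one_mul, mul_assoc, (Unitary.mem_iff.1 hk).1, mul_one]

lemma sphInv_affH {k : MatH} (hk : k ∈ unitary MatH) {y : S4}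
    (hy : (ent 0 0 (sphRel k y)).re ≠ 0) : sphInv k hk (affH (sphRel k y)) = y := by
  obtain ⟨M, hM, e⟩ := exists_frS y
  have e1 : sphRel k y = conjD (star k * M) := by
    rw [conjD_mul, star_star, ← e]; rfl
  refine Subtype.ext ?_
  show vecS (conjD (k * sec (affH (sphRel k y)))) = y.1
  rw [e1] at hy ⊢
  rw [conjD_mul, conjD_sec_affH (mul_mem (Unitary.star_mem hk) hM) hy, ← conjD_mul, ← mul_assoc,
    (Unitary.mem_iff.1 hk).2, one_mul, ← e, vecS_frS]

/-- The affine charts of the sphere. -/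
def sphChart (k : MatH) (hk : k ∈ unitary MatH) : Chart S4 (frechetNormed ℍ[ℝ]) where
  toFun y := affH (sphRel k y)
  invFun := sphInv k hk
  source := {y | (ent 0 0 (sphRel k y)).re ≠ 0}
  target := univ
  map_source' _ _ := trivial
  map_target' u _ := by
    show (ent 0 0 (sphRel k (sphInv k hk u))).re ≠ 0
    rw [sphRel_sphInv]; exact re_conjD_sec_ne u
  left_inv' y hy := sphInv_affH hk hy
  right_inv' u _ := by rw [sphRel_sphInv, affH_conjD_sec]
  open_source := isOpen_iff_preimages_plots.2 fun n p hp => by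
    exact isOpen_compl_singleton.preimage
      (contDiff_re_ent.continuous.comp (sphRel_contDiff k hp).continuous)
  open_target := isOpen_univ
  smooth n p hp := by
    refine Iff.trans ?_ forall_isCk_iff.symm
    constructor
    · intro h
      refine contDiff_iff_contDiffAt.2 fun x => ?_
      have h1 := (sphRel_contDiff k h).contDiffAt (x := x)
      exact ContDiffAt.comp (g := affH) (f := fun x => sphRel k (p x)) x (affH_contDiffAt (hp x)) h1
    · intro h
      refine isPlot_S4_iff.2 ?_
      have h1 : ContDiff ℝ ∞ fun x => vecS (conjD (k * sec (affH (sphRel k (p x))))) :=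
        contDiff_vecS.comp (conjD_contDiff.comp
          (contDiff_const.mul ((contDiff_sec (n := ⊤)).comp h)))
      convert h1 using 1
      exact funext fun x => (congrArg Subtype.val (sphInv_affH hk (hp x))).symm

/-- Subtracting the linear interpolation splits a function vanishing at 0 into its end value and a
function vanishing at both ends. -/
lemma isJet_sub_lin {w : ℝ → ℍ[ℝ]} (hw : IsJet {0} w) : IsJet {0, 1} (fun r => w r - r • w 1) := by
  refine isJet_of (fun t => zero_one_mem)
    (hw.sm.sub (contDiffOn_id.smul contDiffOn_const)) ?_
  rintro t (rfl | rfl)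
  · rw [zero_smul, sub_zero]
    exact hw.zero_of_mem rfl zero_mem01
  · rw [one_smul, sub_self]

lemma isJet_add_lin (c : ℍ[ℝ]) (w : Jet ℍ[ℝ] {0, 1}) :
    IsJet {0} (fun r => Jet.fn w r + r • c) := by
  refine isJet_of singleton_subset01
    ((Jet.contDiffOn_fn w).add (contDiffOn_id.smul contDiffOn_const)) ?_
  rintro t rfl
  rw [zero_smul, add_zero]
  exact (Jet.isJet w).zero_of_mem (by simp) zero_mem01

lemma strip_sub_lin_iff {u : Eu n → ℝ → ℍ[ℝ]} :
    ContDiffOn ℝ ∞ (fun z : Eu n × ℝ => u z.1 z.2) (strip n) ↔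
      ContDiff ℝ ∞ (fun x => u x 1) ∧
        ContDiffOn ℝ ∞ (fun z : Eu n × ℝ => u z.1 z.2 - z.2 • u z.1 1) (strip n) := by
  constructor
  · intro h
    have h1 : ContDiff ℝ ∞ fun x => u x 1 := contDiffOn_univ.1 (h.comp
      (contDiff_id.prodMk contDiff_const).contDiffOn fun x _ => ⟨trivial, one_mem01⟩)
    exact ⟨h1, h.sub (contDiff_snd.smul (h1.comp contDiff_fst)).contDiffOn⟩
  · rintro ⟨h1, h2⟩
    refine (h2.add (contDiff_snd.smul (h1.comp contDiff_fst)).contDiffOn).congr fun z _ => ?_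
    exact (sub_add_cancel _ _).symm

/-- The chart of the space of objects adapted to the endpoint map, transported along a bijection. -/
def endChart {X : Type} [DiffeologicalSpace X] (π : X ≃ QO)
    (hπ : ∀ {n : ℕ} {p : Eu n → X}, IsPlot p ↔ IsPlot (π ∘ p)) (g : P0 Spin5) :
    Chart X (frechetNormed ℍ[ℝ] × frechetJet ℍ[ℝ] {0, 1}) where
  toFun x := (obCo g (π x) 1, mkJet {0, 1} (fun r => obCo g (π x) r - r • obCo g (π x) 1))
  invFun w := π.symm (string4to5.mkOb (obLift g _ (isJet_add_lin w.1 w.2)))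
  source := π ⁻¹' obDom g
  target := univ
  map_source' _ _ := trivial
  map_target' w _ := by
    show π (π.symm _) ∈ obDom g
    rw [π.apply_symm_apply]; exact obLift_mem g _
  left_inv' x hx := by
    rw [Equiv.symm_apply_eq]
    refine obP_ext fun r hr => ?_
    rw [obP_mk, obLift_ev g _ hr, mkJet_fn (isJet_sub_lin (obCo_isJet g hx)) hr, sub_add_cancel,
      obP_of_obCo g hx hr]
  right_inv' w _ := by
    have h1 : Jet.fn w.2 1 = 0 := (Jet.isJet w.2).zero_of_mem (by simp) one_mem01
    have h2 := obCo_obLift g (isJet_add_lin w.1 w.2) one_mem01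
    rw [h1, one_smul, zero_add] at h2
    rw [π.apply_symm_apply, h2]
    refine Prod.ext rfl (mkJet_eq w.2 fun r hr => ?_)
    dsimp only
    rw [obCo_obLift g _ hr, add_sub_cancel_right]
  open_source := isOpen_iff_preimages_plots.2 fun n p hp =>
    isOpen_obDom_preimage g (isPlot_ob_iff.1 (hπ.1 hp))
  open_target := isOpen_univ
  smooth n p hp := by
    have h1 := obCo_strip_iff g (p := π ∘ p) hp
    have h2 := strip_sub_lin_iff (u := fun x => obCo g (π (p x)))
    have h3 := forall_isCk_mkJet_iff (u := fun x r => obCo g (π (p x)) r - r • obCo g (π (p x)) 1)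
      fun x => isJet_sub_lin (obCo_isJet g (hp x))
    have h4 := forall_isCk_iff (f := fun x => obCo g (π (p x)) 1)
    have h5 := isCk_prod (f := fun x => (obCo g (π (p x)) 1,
      mkJet {0, 1} fun r => obCo g (π (p x)) r - r • obCo g (π (p x)) 1))
    exact ((hπ.trans h1).trans h2).trans ((and_congr h4.symm h3.symm).trans h5.symm)

/-- In the charts that split off the end value, the endpoint map is the projection to that value.
The bijection π is there so that the statement applies to the graph of the endpoint map. -/
lemma endpt_submersion {X : Type} [DiffeologicalSpace X] (π : X ≃ QO)
    (hπ : ∀ {n : ℕ} {p : Eu n → X}, IsPlot p ↔ IsPlot (π ∘ p)) :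
    IsSubmersion fun x => endpt (π x) := by
  intro x
  obtain ⟨g, hg⟩ := string4to5.mkOb_surjective (π x)
  refine ⟨_, _, endChart π hπ g, sphChart (g.ev 1) (g.ev_mem 1), ?_, fun y hy => ?_, fun y hy => ?_⟩
  · show π x ∈ obDom g
    rw [← hg]; exact mem_obDom_self g
  · show (ent 0 0 (sphRel (g.ev 1) (endpt (π y)))).re ≠ 0
    rw [sphRel_endpt]
    exact hy 1 one_mem01
  · show affH (sphRel (g.ev 1) (endpt (π y))) = obCo g (π y) 1
    rw [sphRel_endpt]; rfl

/-- The identity functor. -/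
def idFunctor : SmoothFunctor stringQuotient stringQuotient where
  obj := id
  arr := id
  smooth_obj := dSmooth_id
  smooth_arr := dSmooth_id
  src_arr _ := rfl
  tgt_arr _ := rfl
  arr_one _ := rfl
  arr_comp _ _ _ _ := rfl

/-- The endpoint functor to the 4-sphere. -/
def endFunctor : SmoothFunctor stringQuotient (discreteGroupoid S4) where
  obj := endpt
  arr a := endpt (string4to5.qsrc a)
  smooth_obj := endpt_smooth
  smooth_arr := endpt_smooth.comp src_smooth
  src_arr _ := rfl
  tgt_arr a := endpt_eq_iff.2 (ends_eq a)
  arr_one x := congrArg endpt (stringQuotient.src_one x)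
  arr_comp a b h _ := (congrArg endpt (stringQuotient.src_comp a b h)).trans
    ((endpt_eq_iff.2 (ends_eq b)).trans (congrArg endpt h.symm))

lemma idFunctor_weakEquivalence : IsWeakEquivalence idFunctor where
  ess_surj y := ⟨⟨(y, stringQuotient.one y), stringQuotient.src_one y⟩, stringQuotient.tgt_one y⟩
  ess_subm := by
    -- An object together with an arrow starting at it is just an arrow, so this is again a space of
    -- pairs, with the target map in the role of the source.
    refine PairSpace.submersion (tgt := fun p => stringQuotient.src p.1.2)
      ⟨fun x => (ends_eq x.1.2).symm, fun {x y} h1 h2 => ?_, fun {x y} h => ?_, fun {n p} => ?_⟩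
    · refine Subtype.ext (Prod.ext ?_ (ar_ext h2 h1))
      exact x.2.symm.trans (h2.trans y.2)
    · obtain ⟨a, ha1, ha2⟩ := exists_arrow h.symm
      exact ⟨⟨(y, a), ha1⟩, ha2, ha1⟩
    · refine ⟨fun h => ⟨tgt_smooth n _ h.2, src_smooth n _ h.2⟩, fun h => ⟨?_, ?_⟩⟩
      · convert h.2 using 1
        exact funext fun x => (p x).2.symm
      · exact isPlot_ar_iff.2 ⟨h.2, h.1⟩
  full_faithful x y b h1 h2 := ⟨b, ⟨h1, h2, rfl⟩, fun a ha => ha.2.2⟩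
  smooth_full_faithful n p _ _ h := h

/-- The graph of the endpoint map. -/
def graphEquiv : {p : QO × S4 // (discreteGroupoid S4).src p.2 = endFunctor.obj p.1} ≃ QO where
  toFun p := p.1.1
  invFun q := ⟨(q, endpt q), rfl⟩
  left_inv p := Subtype.ext (Prod.ext rfl p.2.symm)
  right_inv _ := rfl

lemma endFunctor_weakEquivalence : IsWeakEquivalence endFunctor where
  ess_surj y := by
    obtain ⟨q, hq⟩ := endpt_surjective y
    exact ⟨⟨(q, y), hq.symm⟩, rfl⟩
  ess_subm := by
    -- In the discrete groupoid the second entry of a pair is forced to be the endpoint of the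
    -- first, so the fibre product is the graph and its map to S⁴ is the endpoint map.
    convert endpt_submersion graphEquiv (fun {n p} => ⟨fun h => h.1, fun h => ⟨h, ?_⟩⟩) using 1
    · exact funext fun p => p.2
    · convert endpt_smooth n _ h using 1
      exact funext fun x => (p x).2
  full_faithful x y b h1 h2 := by
    have h : obP x 1 = obP y 1 := endpt_eq_iff.1 (h1.symm.trans h2)
    obtain ⟨a, ha1, ha2⟩ := exists_arrow h
    refine ⟨a, ⟨ha1, ha2, ?_⟩, fun a' ha' => ar_ext (ha'.1.trans ha1.symm) (ha'.2.1.trans ha2.symm)⟩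
    show endpt (string4to5.qsrc a) = b
    rw [ha1]; exact h1.symm
  smooth_full_faithful n p h1 h2 _ := isPlot_ar_iff.2 ⟨h1, h2⟩

end Sphere

end StringTwoGroup

end

theorem mainTheorem9 :
    StringTwoGroup.IsLieGroupoid StringTwoGroup.stringQuotient ∧
      StringTwoGroup.LieGroupoidEquivalent StringTwoGroup.stringQuotient
        (StringTwoGroup.discreteGroupoid StringTwoGroup.S4) :=
  ⟨StringTwoGroup.isLieGroupoid_stringQuotient, _, _, _, _, StringTwoGroup.stringQuotient,
    StringTwoGroup.idFunctor, StringTwoGroup.endFunctor,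
    StringTwoGroup.isLieGroupoid_stringQuotient, StringTwoGroup.idFunctor_weakEquivalence,
    StringTwoGroup.endFunctor_weakEquivalence⟩
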